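/- **Setting.** Let $n,k\ge 1$ and let $F(Z)=\sum_{T\ge 0}c_F(T)\,e^{2\pi i\,\mathrm{tr}(TZ)}$ be a Siegel modular form of weight $k$ for $Sp_n(\mathbb Z)$, where $T$ runs over the positive semi-definite half-integral symmetric matrices of degree $n$ (integral diagonal, off-diagonal entries in $\tfrac12\mathbb Z$). Write $T[U]={}^tUTU$. For $N\ge1$ put $SL_{n,N}(\mathbb Z)=\{U\in SL_n(\mathbb Z): U\equiv 1_n \bmod N\}$, $e_N(T)=\#\{U\in SL_{n,N}(\mathbb Z):T[U]=T\}$, $e(T)=e_1(T)$, and for Dirichlet characters $\chi,\psi$ mod $N$ put $$L(s,F,\chi)=\sum_{T}\frac{\chi(\mathrm{tr}\,T)\,c_F(T)}{e_N(T)(\det T)^s},\qquad L^*(s,F,\psi)=\sum_{T}\frac{\psi(2^{2[n/2]}\det T)\,c_F(T)}{e(T)(\det T)^s},$$ where $T$ runs over representatives of the positive definite half-integral matrices of degree $n$ modulo $SL_{n,N}(\mathbb Z)$, respectively modulo $SL_n(\mathbb Z)$. Let $N=p_1\cdots p_r$ with distinct odd primes $p_i$, and let $\chi$ be a primitive Dirichlet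 character mod $N$. Let $\chi^{(p_i)}$ be its $p_i$-component: for $a$ prime to $p_i$, $\chi^{(p_i)}(a)=\chi(m)$ with $m\equiv a \bmod p_i$, $m\equiv 1\bmod N/p_i$. Let $l_i=\gcd(p_i-1,n)$ and let $u_{0,i}\in\mathbb Z$ be a primitive $l_i$-th root of unity mod $p_i$. Let $\mathcal D_{N,n}$ be the set of Dirichlet characters $\eta$ mod $N$ with $\eta^n=1$, let $\left(\frac{*}{N}\right)$ be the Jacobi symbol, $J(\chi_1,\chi_2)=\sum_{x\in\mathbb Z/N}\chi_1(x)\chi_2(1-x)$, and $$J_m(\psi)=\sum_{Z}\psi(\det Z)\left(\tfrac{\det Z}{N}\right)^{m-1}\psi(1-\mathrm{tr}\,Z),$$ the sum being over the symmetric matrices $Z$ of degree $m$ over $\mathbb Z/N\mathbb Z$ ($J_0(\psi)=1$). For an odd prime $p$ put $$\gamma_{m,p}=p^{m(m-1)/2}\Big(1-\big(\tfrac{(-1)^{m/2}}{p}\big)p^{-m/2}\Big)\prod_{e=1}^{(m-2)/2}(1-p^{-2e})\ (m\text{ even}),\qquad \gamma_{m,p}=p^{m(m-1)/2}\prod_{e=1}^{(m-1)/2}(1-p^{-2e})\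 (m\text{ odd}).$$ **Theorem.** There is a real number $\sigma_0$ such that for all $s$ with $\mathrm{Re}(s)>\sigma_0$ the series $L(s,F,\chi)$ and $L^*(s,F,\psi)$, for all Dirichlet characters $\psi$ mod $N$, converge absolutely and the following holds. (1) If $\chi^{(p_i)}(u_{0,i})\ne1$ for some $i$, then $L(s,F,\chi)=0$. (2) Assume that $\chi^{(p_i)}(u_{0,i})=1$ for all $i$. Then there is a Dirichlet character $\widetilde\chi$ mod $N$ with $\widetilde\chi^{\,n}=\chi$, and for every such $\widetilde\chi$: (2.1) if $n$ is even, $$L(s,F,\chi)=\prod_{i=1}^r(-1)^{(n-2)(p_i-1)/4}\,p_i^{(n-2)/2}\,\gamma_{n,p_i}\sum_{\eta\in\mathcal D_{N,n}}\overline{(\widetilde\chi\eta)(2^n)}\;\overline{J\big(\widetilde\chi\eta\big(\tfrac{*}{N}\big),\big(\tfrac{*}{N}\big)\big)}\;\overline{J_{n-1}(\widetilde\chi\eta)}\;L^*(s,F,\widetilde\chi\eta);$$ (2.2) if $n$ is odd and, in case $n>1$, $\chi^2$ is primitive mod $N$, $$L(s,F,\chi)=\prod_{i=1}^r(-1)^{(n-1)(p_i-1)/4}\,p_i^{(n-1)/2}\,\gamma_{n,p_i}\sum_{\eta\in\mathcal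 D_{N,n}}\overline{(\widetilde\chi\eta)(2^{n-1})}\;\overline{J_{n-1}(\widetilde\chi\eta)}\;L^*(s,F,\widetilde\chi\eta).$$ -/

import Mathlib

noncomputable section

namespace KM

open Matrix

/-! ### Half-integral matrices, the action of `SL_n(ℤ)`, congruence subgroups -/

/-- Half-integral symmetric matrices of degree `n`: integral diagonal entries, off-diagonal
entries in `(1/2)ℤ`. -/
def IsHalfIntegral {n : ℕ} (T : Matrix (Fin n) (Fin n) ℝ) : Prop :=
  T.IsSymm ∧ (∀ i, ∃ a : ℤ, T i i = a) ∧ ∀ i j, ∃ b : ℤ, 2 * T i j = b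

/-- Positive semi-definite half-integral matrices of degree `n`. -/
def SemiHalf (n : ℕ) : Type :=
  {T : Matrix (Fin n) (Fin n) ℝ // IsHalfIntegral T ∧ T.PosSemidef}

/-- Positive definite half-integral matrices of degree `n`. -/
def PosHalf (n : ℕ) : Type :=
  {T : Matrix (Fin n) (Fin n) ℝ // IsHalfIntegral T ∧ T.PosDef}

/-- A positive definite half-integral matrix, seen as a positive semi-definite one. -/
def PosHalf.toSemi {n : ℕ} (T : PosHalf n) : SemiHalf n :=
  ⟨T.1, T.2.1, T.2.2.posSemidef⟩

/-- `T[U] = ᵗU T U` for `U ∈ SL_n(ℤ)`. -/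
def act {n : ℕ} (T : Matrix (Fin n) (Fin n) ℝ) (U : Matrix.SpecialLinearGroup (Fin n) ℤ) :
    Matrix (Fin n) (Fin n) ℝ :=
  ((U : Matrix (Fin n) (Fin n) ℤ).map (Int.cast : ℤ → ℝ))ᵀ * T *
    (U : Matrix (Fin n) (Fin n) ℤ).map (Int.cast : ℤ → ℝ)

theorem act_one {n : ℕ} (T : Matrix (Fin n) (Fin n) ℝ) : act T 1 = T := by
  have h : ((1 : Matrix (Fin n) (Fin n) ℤ)).map (Int.cast : ℤ → ℝ) = 1 :=
    Matrix.map_one _ Int.cast_zero Int.cast_one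
  simp [act, h]

theorem act_mul {n : ℕ} (T : Matrix (Fin n) (Fin n) ℝ) (U V : Matrix.SpecialLinearGroup (Fin n) ℤ) :
    act T (U * V) = act (act T U) V := by
  have h : ((U * V : Matrix.SpecialLinearGroup (Fin n) ℤ) : Matrix (Fin n) (Fin n) ℤ).map
      (Int.cast : ℤ → ℝ) = (U : Matrix (Fin n) (Fin n) ℤ).map (Int.cast : ℤ → ℝ) *
        (V : Matrix (Fin n) (Fin n) ℤ).map (Int.cast : ℤ → ℝ) := by
    refine (congrArg (fun A : Matrix (Fin n) (Fin n) ℤ => A.map (Int.cast : ℤ → ℝ))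
      (Matrix.SpecialLinearGroup.coe_mul U V)).trans ?_
    exact Matrix.map_mul (f := Int.castRingHom ℝ)
  simp only [act, h, Matrix.transpose_mul, Matrix.mul_assoc]

/-- `SL_{n,N}(ℤ) = {U ∈ SL_n(ℤ) : U ≡ 1 mod N}`. -/
def congSubgroup (n N : ℕ) : Subgroup (Matrix.SpecialLinearGroup (Fin n) ℤ) :=
  (Matrix.SpecialLinearGroup.map (n := Fin n) (Int.castRingHom (ZMod N))).ker

/-- Equivalence of positive definite half-integral matrices with respect to a subgroup `G` of
`SL_n(ℤ)`. -/
def equivMod {n : ℕ} (G : Subgroup (Matrix.SpecialLinearGroup (Fin n) ℤ)) : Setoid (PosHalf n) where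
  r T T' := ∃ U ∈ G, T'.1 = act T.1 U
  iseqv :=
    { refl := fun T => ⟨1, G.one_mem, (act_one T.1).symm⟩
      symm := by
        rintro T T' ⟨U, hU, h⟩
        refine ⟨U⁻¹, G.inv_mem hU, ?_⟩
        rw [h, ← act_mul, mul_inv_cancel, act_one]
      trans := by
        rintro T T' T'' ⟨U, hU, h⟩ ⟨V, hV, h'⟩
        exact ⟨U * V, G.mul_mem hU hV, by rw [act_mul, ← h, h']⟩ }

/-- The set of `G`-equivalence classes of positive definite half-integral matrices; for a class
`q`, `q.out` is its member in a fixed complete set of representatives. -/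
abbrev Classes {n : ℕ} (G : Subgroup (Matrix.SpecialLinearGroup (Fin n) ℤ)) : Type :=
  Quotient (equivMod G)

/-- The number of `U ∈ G` with `T[U] = T`. -/
def autCard {n : ℕ} (G : Subgroup (Matrix.SpecialLinearGroup (Fin n) ℤ)) (T : PosHalf n) : ℕ :=
  Nat.card {U : Matrix.SpecialLinearGroup (Fin n) ℤ // U ∈ G ∧ act T.1 U = T.1}

/-! ### Siegel modular forms -/

/-- The Siegel upper half space of degree `n`. -/
def siegelUpperHalfSpace (n : ℕ) : Set (Matrix (Fin n) (Fin n) ℂ) :=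
  {Z | Z.IsSymm ∧ (Z.map Complex.im).PosDef}

/-- Integral matrices as complex matrices. -/
def toComplex {n : ℕ} (A : Matrix (Fin n) (Fin n) ℤ) : Matrix (Fin n) (Fin n) ℂ :=
  A.map (Int.cast : ℤ → ℂ)

/-- The exponential `exp(2πi tr(TZ))`. -/
def fourierExp {n : ℕ} (T : Matrix (Fin n) (Fin n) ℝ) (Z : Matrix (Fin n) (Fin n) ℂ) : ℂ :=
  Complex.exp (2 * Real.pi * Complex.I * (T.map (Complex.ofReal) * Z).trace)

/-- Siegel modular forms of weight `k` for `Sp_n(ℤ)`: holomorphic functions on the Siegel upper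
half space (only the values there matter) with the usual transformation law and with a Fourier
expansion over positive semi-definite half-integral matrices. Differentiability is taken within
the half space, an open subset of the space of symmetric matrices, so that it is holomorphy in
the entries `z_ij`, `i ≤ j`. -/
structure SiegelModularForm (n k : ℕ) where
  toFun : Matrix (Fin n) (Fin n) ℂ → ℂ
  holomorphic : DifferentiableOn ℂ toFun (siegelUpperHalfSpace n)
  automorphic : ∀ M ∈ symplecticGroup (Fin n) ℤ, ∀ Z ∈ siegelUpperHalfSpace n,
    toFun ((toComplex M.toBlocks₁₁ * Z + toComplex M.toBlocks₁₂) *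
        (toComplex M.toBlocks₂₁ * Z + toComplex M.toBlocks₂₂)⁻¹) =
      (toComplex M.toBlocks₂₁ * Z + toComplex M.toBlocks₂₂).det ^ k * toFun Z
  fourier : ∃ c : SemiHalf n → ℂ, ∀ Z ∈ siegelUpperHalfSpace n,
    HasSum (fun T : SemiHalf n => c T * fourierExp T.1 Z) (toFun Z)

/-- The Fourier coefficients `c_F(T)` of `F`; they are determined uniquely by `F`. -/
def SiegelModularForm.coeff {n k : ℕ} (F : SiegelModularForm n k) : SemiHalf n → ℂ :=
  F.fourier.choose

/-! ### The two twisted Koecher–Maass series -/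

/-- The term of the twisted Koecher–Maass series of the first kind at a matrix `T`:
`χ(tr T) c_F(T) / (e_N(T) (det T)^s)`. The trace of `T` is an integer. -/
def firstTerm {n k N : ℕ} (F : SiegelModularForm n k) (χ : DirichletCharacter ℂ N) (s : ℂ)
    (T : PosHalf n) : ℂ :=
  χ ((⌊T.1.trace⌋ : ℤ) : ZMod N) * F.coeff T.toSemi /
    ((autCard (congSubgroup n N) T : ℂ) * ((T.1.det : ℝ) : ℂ) ^ s)

/-- The series `L(s, F, χ)` converges absolutely at `s`. -/
def FirstSummable {n k N : ℕ} (F : SiegelModularForm n k) (χ : DirichletCharacter ℂ N)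
    (s : ℂ) : Prop :=
  Summable fun q : Classes (congSubgroup n N) => firstTerm F χ s q.out

/-- The twisted Koecher–Maass series of the first kind `L(s, F, χ)`. -/
def firstSeries {n k N : ℕ} (F : SiegelModularForm n k) (χ : DirichletCharacter ℂ N)
    (s : ℂ) : ℂ :=
  ∑' q : Classes (congSubgroup n N), firstTerm F χ s q.out

/-- The term of the twisted Koecher–Maass series of the second kind at a matrix `T`:
`χ(2^(2[n/2]) det T) c_F(T) / (e(T) (det T)^s)`. The number `2^(2[n/2]) det T` is an integer. -/
def secondTerm {n k N : ℕ} (F : SiegelModularForm n k) (χ : DirichletCharacter ℂ N) (s : ℂ)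
    (T : PosHalf n) : ℂ :=
  χ ((⌊(2 : ℝ) ^ (2 * (n / 2)) * T.1.det⌋ : ℤ) : ZMod N) * F.coeff T.toSemi /
    ((autCard (⊤ : Subgroup (Matrix.SpecialLinearGroup (Fin n) ℤ)) T : ℂ) * ((T.1.det : ℝ) : ℂ) ^ s)

/-- The series `L*(s, F, χ)` converges absolutely at `s`. -/
def SecondSummable {n k N : ℕ} (F : SiegelModularForm n k) (χ : DirichletCharacter ℂ N)
    (s : ℂ) : Prop :=
  Summable fun q : Classes (⊤ : Subgroup (Matrix.SpecialLinearGroup (Fin n) ℤ)) => secondTerm F χ s q.out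

/-- The twisted Koecher–Maass series of the second kind `L*(s, F, χ)`. -/
def secondSeries {n k N : ℕ} (F : SiegelModularForm n k) (χ : DirichletCharacter ℂ N)
    (s : ℂ) : ℂ :=
  ∑' q : Classes (⊤ : Subgroup (Matrix.SpecialLinearGroup (Fin n) ℤ)), secondTerm F χ s q.out

/-! ### Dirichlet characters and character sums -/

/-- The `p`-component `χ^(p)` of a Dirichlet character `χ` mod `N`, as a function on `ℤ`: with
`p^e` the exact power of `p` in `N`, its value at `a` prime to `p` is `χ(m)` for any
`m ≡ a mod p^e`, `m ≡ 1 mod N/p^e`, and it is `0` at the other integers. -/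
def primeComponent {N : ℕ} (χ : DirichletCharacter ℂ N) (p : ℕ) (a : ℤ) : ℂ :=
  open Classical in
  if h : IsCoprime a (p : ℤ) ∧
      ∃ m : ℤ, m ≡ a [ZMOD ((p ^ N.factorization p : ℕ) : ℤ)] ∧
        m ≡ 1 [ZMOD ((N / p ^ N.factorization p : ℕ) : ℤ)]
  then χ ((h.2.choose : ℤ) : ZMod N) else 0

/-- The Dirichlet characters mod `N` whose `m`-th power is trivial. -/
def torsionChars (N m : ℕ) [NeZero N] : Finset (DirichletCharacter ℂ N) :=
  (Set.toFinite {η : DirichletCharacter ℂ N | η ^ m = 1}).toFinset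

/-- The Jacobi symbol `(* / N)` as a Dirichlet character mod `N`. -/
def jacobiChar (N : ℕ) [NeZero N] : DirichletCharacter ℂ N where
  toFun a := ((jacobiSym (a.val : ℤ) N : ℤ) : ℂ)
  map_one' := by
    rw [ZMod.val_one_eq_one_mod, Int.natCast_mod, ← jacobiSym.mod_left]
    simp
  map_mul' a b := by
    rw [ZMod.val_mul, Int.natCast_mod, ← jacobiSym.mod_left, Nat.cast_mul, jacobiSym.mul_left,
      Int.cast_mul]
  map_nonunit' a ha := by
    rw [Int.cast_eq_zero, jacobiSym.eq_zero_iff_not_coprime, Int.gcd_natCast_natCast]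
    intro h
    apply ha
    rw [← ZMod.natCast_zmod_val a]
    exact (ZMod.isUnit_iff_coprime _ _).2 h

/-- `J_m(χ, η) = ∑_Z χ(det Z) η(1 - tr Z)`, over the symmetric matrices `Z` of degree `m` with
entries in `ℤ/Nℤ`. -/
def matrixJacobiSum {N : ℕ} [NeZero N] (m : ℕ) (χ η : DirichletCharacter ℂ N) : ℂ :=
  ∑ Z ∈ Finset.univ.filter (fun Z : Matrix (Fin m) (Fin m) (ZMod N) => Zᵀ = Z),
    χ Z.det * η (1 - Z.trace)

/-- `J_m(χ) = J_m(χ (* / N)^(m-1), χ)`; for `m = 0` this is the single term `1`. -/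
def matrixJacobiSum' {N : ℕ} [NeZero N] (m : ℕ) (χ : DirichletCharacter ℂ N) : ℂ :=
  matrixJacobiSum m (χ * jacobiChar N ^ (m - 1)) χ

/-- The constant `γ_{m,p}`:
`p^(m(m-1)/2) (1 - ((-1)^(m/2) / p) p^(-m/2)) ∏_{e=1}^{(m-2)/2} (1 - p^(-2e))` for `m` even and
`p^(m(m-1)/2) ∏_{e=1}^{(m-1)/2} (1 - p^(-2e))` for `m` odd. -/
def gammaConst (m p : ℕ) : ℂ :=
  if Even m then
    (p : ℂ) ^ (m ^ 2 - m * (m + 1) / 2) *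
      (1 - ((jacobiSym ((-1) ^ (m / 2)) p : ℤ) : ℂ) / (p : ℂ) ^ (m / 2)) *
      ∏ e ∈ Finset.Icc 1 ((m - 2) / 2), (1 - 1 / (p : ℂ) ^ (2 * e))
  else
    (p : ℂ) ^ (m ^ 2 - m * (m + 1) / 2) *
      ∏ e ∈ Finset.Icc 1 ((m - 1) / 2), (1 - 1 / (p : ℂ) ^ (2 * e))

end KM

end

/-! The series of the first kind is unfolded over `SL_n(ℤ)`-classes. Reduction `SL_n(ℤ) → SL_n(ℤ/N)`
is surjective with kernel `SL_{n,N}(ℤ)`, so the finer classes inside the class of `T` form the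
quotient of `SL_n(ℤ/N)` by the image of the stabilizer of `T`, a group of order `e(T)/e_N(T)`. Since
`c_F(T[U]) = c_F(T)`, this gives `L(s,F,χ) = ∑_T h(T) c_F(T) / (e(T) det(T)^s)` with `h(T) = ∑_g
χ(tr T[g])` over `g ∈ SL_n(ℤ/N)` (`firstSeries_eq_tsum`). The rest of the algebra concerns the
finite sum `h`, which depends only on `T` mod `N` and factors over the primes `p_i`.

Over `F_p`, a matrix `g` of determinant one with `g ᵗg = a` multiplies `h` by `χ(a)`. Such `g`
exists whenever `a^n = 1`, which forces the vanishing in (1). For singular `T` the determinant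
condition can be repaired by an automorphism of `T`, so `h(T) = 0` then as well.

For nonsingular `T`, sort the `g` by `S = T[g]`. Each symmetric `S` with `det S = det T` occurs
equally often, namely as often as the special orthogonal group of `T` has elements (`isomCount_eq`).
Orthogonality of characters resolves the condition `det S = det T`, and only the characters `(ψη)⁻¹`
with `ψ^n = χ`, `η^n = 1` survive (`sum_det_eq_mulChar_trace`). What remains is the sum of `θ(det
S)` over symmetric `S` of trace one. Writing `S` as a bordered matrix, `det S = det Z · (s -
Z⁻¹[w])`, and the sum over `w` follows from the representation numbers of quadratic forms
(`sum_symMatrices_det_trace`, `traceSum_succ`); a matrix Jacobi sum of degree `n - 1` is left. For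
even `n` the group order involves the quadratic character of `det T`, but the character sum is
stable under `η ↦ (*/p) η` (`traceSum_quadChar_mul`) and so vanishes when that character is `-1`;
this is why one constant `γ` serves all `T`.

Convergence: Siegel reduction bounds `F` near the real points, hence `c_F(T)` by a power of `tr T`
(`exists_norm_coeff_le`), and Minkowski reduction picks representatives with entries bounded by a
multiple of `det T` (`exists_summable`). -/

set_option linter.unusedSectionVars false

noncomputable section
open Matrix

namespace KM

/-! ### Bordered matrices -/

section Border

variable {R : Type*}

/-- The matrix with corner entry `a`, first row `r`, first column `c` and lower right block `Z`. -/
def border {m : ℕ} (a : R) (r c : Fin m → R) (Z : Matrix (Fin m) (Fin m) R) :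
    Matrix (Fin (m + 1)) (Fin (m + 1)) R :=
  Matrix.of (Fin.cons (Fin.cons a r) fun i => Fin.cons (c i) (Z i))

section entries

variable {m : ℕ} (a : R) (r c : Fin m → R) (Z : Matrix (Fin m) (Fin m) R)

@[simp] theorem border_zero_zero : border a r c Z 0 0 = a := rfl

@[simp] theorem border_zero_succ (j : Fin m) : border a r c Z 0 j.succ = r j := rfl

@[simp] theorem border_succ_zero (i : Fin m) : border a r c Z i.succ 0 = c i := rfl

@[simp] theorem border_succ_succ (i j : Fin m) : border a r c Z i.succ j.succ = Z i j := rfl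

end entries

theorem border_ext {m : ℕ} {A B : Matrix (Fin (m + 1)) (Fin (m + 1)) R} (h₀ : A 0 0 = B 0 0)
    (h₁ : ∀ j : Fin m, A 0 j.succ = B 0 j.succ) (h₂ : ∀ i : Fin m, A i.succ 0 = B i.succ 0)
    (h₃ : ∀ i j : Fin m, A i.succ j.succ = B i.succ j.succ) : A = B := by
  ext i j
  refine Fin.cases ?_ (fun i => ?_) i <;> refine Fin.cases ?_ (fun j => ?_) j
  exacts [h₀, h₁ j, h₂ i, h₃ i j]

theorem eq_border {m : ℕ} (A : Matrix (Fin (m + 1)) (Fin (m + 1)) R) :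
    A = border (A 0 0) (fun j => A 0 j.succ) (fun i => A i.succ 0)
      (A.submatrix Fin.succ Fin.succ) :=
  border_ext rfl (fun _ => rfl) (fun _ => rfl) fun _ _ => rfl

theorem transpose_border {m : ℕ} (a : R) (r c : Fin m → R) (Z : Matrix (Fin m) (Fin m) R) :
    (border a r c Z)ᵀ = border a c r Zᵀ :=
  border_ext rfl (fun _ => rfl) (fun _ => rfl) fun _ _ => rfl

theorem border_inj {m : ℕ} {a a' : R} {r r' c c' : Fin m → R} {Z Z' : Matrix (Fin m) (Fin m) R} :
    border a r c Z = border a' r' c' Z' ↔ a = a' ∧ r = r' ∧ c = c' ∧ Z = Z' := by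
  refine ⟨fun h => ⟨?_, ?_, ?_, ?_⟩, by rintro ⟨rfl, rfl, rfl, rfl⟩; rfl⟩
  · exact congrFun (congrFun h 0) 0
  · exact funext fun j => congrFun (congrFun h 0) j.succ
  · exact funext fun i => congrFun (congrFun h i.succ) 0
  · ext i j
    exact congrFun (congrFun h i.succ) j.succ

theorem border_submatrix {m : ℕ} (a : R) (r c : Fin m → R) (Z : Matrix (Fin m) (Fin m) R) :
    (border a r c Z).submatrix (Sum.elim (fun _ : Unit => 0) Fin.succ)
      (Sum.elim (fun _ : Unit => 0) Fin.succ) =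
      fromBlocks (Matrix.of fun _ _ => a) (Matrix.of fun _ => r) (Matrix.of fun i _ => c i) Z := by
  ext i j
  rcases i with i | i <;> rcases j with j | j <;> rfl

variable [CommRing R]

theorem border_mul {m : ℕ} (a a' : R) (r r' c c' : Fin m → R) (Z Z' : Matrix (Fin m) (Fin m) R) :
    border a r c Z * border a' r' c' Z' =
      border (a * a' + r ⬝ᵥ c') (a • r' + r ᵥ* Z') (a' • c + Z *ᵥ c') (vecMulVec c r' + Z * Z') := by
  refine border_ext ?_ (fun j => ?_) (fun i => ?_) fun i j => ?_ <;>
    simp [Matrix.mul_apply, Fin.sum_univ_succ, dotProduct, vecMul, mulVec, vecMulVec_apply, mul_comm]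

theorem trace_border {m : ℕ} (a : R) (r c : Fin m → R) (Z : Matrix (Fin m) (Fin m) R) :
    (border a r c Z).trace = a + Z.trace := by
  simp [Matrix.trace, Fin.sum_univ_succ]

/-- The index equivalence behind `border`. -/
def unitSumFin (m : ℕ) : Unit ⊕ Fin m ≃ Fin (m + 1) where
  toFun := Sum.elim (fun _ => 0) Fin.succ
  invFun := Fin.cases (Sum.inl ()) Sum.inr
  left_inv := by rintro (_ | i) <;> rfl
  right_inv := fun i => by refine Fin.cases ?_ (fun j => ?_) i <;> rfl

theorem det_border_eq {m : ℕ} (a : R) (r c : Fin m → R) (Z : Matrix (Fin m) (Fin m) R) :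
    (border a r c Z).det = (fromBlocks (Matrix.of fun _ _ => a) (Matrix.of fun _ => r)
      (Matrix.of fun i _ => c i) Z : Matrix (Unit ⊕ Fin m) (Unit ⊕ Fin m) R).det := by
  rw [← border_submatrix, ← det_submatrix_equiv_self (unitSumFin m)]
  rfl

/-- Schur complement of the lower right block. -/
theorem det_border {m : ℕ} (a : R) (r c : Fin m → R) (Z : Matrix (Fin m) (Fin m) R)
    (hZ : IsUnit Z.det) : (border a r c Z).det = Z.det * (a - r ⬝ᵥ (Z⁻¹ *ᵥ c)) := by
  have := invertibleOfIsUnitDet Z hZ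
  rw [det_border_eq, det_fromBlocks₂₂]
  congr 1
  simp [det_unique, Matrix.mul_apply, dotProduct, mulVec, Finset.sum_mul, Finset.mul_sum,
    invOf_eq_nonsing_inv]
  rw [Finset.sum_comm]
  exact Finset.sum_congr rfl fun i _ => Finset.sum_congr rfl fun j _ => by ring

theorem det_border_zero_row {m : ℕ} (a : R) (c : Fin m → R) (Z : Matrix (Fin m) (Fin m) R) :
    (border a 0 c Z).det = a * Z.det := by
  rw [det_border_eq]
  have : (Matrix.of fun _ => (0 : Fin m → R) : Matrix Unit (Fin m) R) = 0 := rfl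
  rw [this, det_fromBlocks_zero₁₂]
  simp [det_unique]

theorem det_border_zero_col {m : ℕ} (a : R) (r : Fin m → R) (Z : Matrix (Fin m) (Fin m) R) :
    (border a r 0 Z).det = a * Z.det := by
  rw [← det_transpose, transpose_border, det_border_zero_row, det_transpose]

/-- The quadratic form attached to a symmetric matrix. -/
def qform {ι : Type*} [Fintype ι] (S : Matrix ι ι R) (w : ι → R) : R := w ⬝ᵥ (S *ᵥ w)

theorem qform_conj {ι : Type*} [Fintype ι] (S V : Matrix ι ι R) (w : ι → R) :
    qform (Vᵀ * S * V) w = qform S (V *ᵥ w) := by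
  rw [qform, qform, Matrix.mul_assoc, ← mulVec_mulVec, ← mulVec_mulVec, dotProduct_mulVec,
    vecMul_transpose]

theorem qform_diagonal {ι : Type*} [Fintype ι] [DecidableEq ι] (d w : ι → R) :
    qform (diagonal d) w = ∑ i, d i * w i ^ 2 := by
  simp only [qform, dotProduct, mulVec_diagonal]
  exact Finset.sum_congr rfl fun i _ => by ring

theorem conj_apply_zero_zero {m : ℕ} (S V : Matrix (Fin (m + 1)) (Fin (m + 1)) R) :
    (Vᵀ * S * V) 0 0 = qform S (fun i => V i 0) := by
  rw [Matrix.mul_assoc]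
  rfl

end Border

/-- A symmetric matrix over a field of characteristic not two is congruent to a diagonal one. -/
theorem exists_congr_diagonal {F : Type*} [Field F] (h2 : (2 : F) ≠ 0) {n : ℕ}
    (S : Matrix (Fin n) (Fin n) F) (hS : Sᵀ = S) :
    ∃ (V : Matrix (Fin n) (Fin n) F) (d : Fin n → F), IsUnit V.det ∧ Vᵀ * S * V = diagonal d := by
  have : Invertible (2 : F) := invertibleOfNonzero h2
  have hB : LinearMap.IsSymm (Matrix.toBilin' S) := by
    constructor
    intro x y
    simp only [Matrix.toBilin'_apply', RingHom.id_apply]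
    rw [dotProduct_mulVec, ← mulVec_transpose, hS, dotProduct_comm]
  obtain ⟨v, hv⟩ := LinearMap.BilinForm.exists_orthogonal_basis hB
  have hn : Module.finrank F (Fin n → F) = n := by simp
  let v' := v.reindex (finCongr hn)
  let V : Matrix (Fin n) (Fin n) F := (Pi.basisFun F (Fin n)).toMatrix v'
  refine ⟨V, fun i => (Vᵀ * S * V) i i, ?_, ?_⟩
  · have := (Pi.basisFun F (Fin n)).invertibleToMatrix v'
    exact isUnit_det_of_invertible V
  · ext i j
    by_cases hij : i = j
    · subst hij
      simp
    · rw [diagonal_apply_ne _ hij]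
      have := LinearMap.isOrthoᵢ_def.1 hv ((finCongr hn).symm i) ((finCongr hn).symm j)
        (fun h => hij ((finCongr hn).symm.injective h))
      rw [Matrix.toBilin'_apply'] at this
      have hV : ∀ k l, V k l = v ((finCongr hn).symm l) k := fun k l => by
        simp [V, v', Module.Basis.toMatrix_apply]
      rw [← this, Matrix.mul_assoc]
      simp [Matrix.mul_apply, dotProduct, mulVec, hV]

end KM
end

noncomputable section
open Matrix

namespace KM

/-! ### Counting values of quadratic forms over finite fields -/

section FiniteField

variable {F : Type*} [Field F] [Fintype F] [DecidableEq F]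

variable (F) in
/-- The quadratic character with complex values. -/
def quadChar : MulChar F ℂ := (quadraticChar F).ringHomComp (Int.castRingHom ℂ)

theorem quadChar_apply (a : F) : quadChar F a = ((quadraticChar F a : ℤ) : ℂ) := rfl

theorem quadChar_mul_self {a : F} (ha : a ≠ 0) : quadChar F a * quadChar F a = 1 := by
  rw [quadChar_apply, ← Int.cast_mul, ← sq, quadraticChar_sq_one ha, Int.cast_one]

theorem quadChar_sq : quadChar F ^ 2 = 1 := by
  ext a
  rw [MulChar.pow_apply_coe, sq, quadChar_mul_self a.ne_zero, MulChar.one_apply a.isUnit]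

theorem quadChar_inv : (quadChar F)⁻¹ = quadChar F := by
  rw [inv_eq_iff_mul_eq_one, ← sq, quadChar_sq]

theorem quadChar_ne_one (hF : ringChar F ≠ 2) : quadChar F ≠ 1 := by
  obtain ⟨a, ha⟩ := quadraticChar_exists_neg_one' hF
  intro h
  have := congrArg (fun χ : MulChar F ℂ => χ a) h
  simp only [quadChar_apply, ha, MulChar.one_apply a.isUnit] at this
  norm_num at this

theorem quadChar_eq_or {a : F} (ha : a ≠ 0) : quadChar F a = 1 ∨ quadChar F a = -1 := by
  rcases quadraticChar_dichotomy ha with h | h <;> simp [quadChar_apply, h]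

theorem sum_ite_sq_eq (hF : ringChar F ≠ 2) (c : F) :
    ∑ x : F, (if x ^ 2 = c then (1 : ℂ) else 0) = 1 + quadChar F c := by
  have h := quadraticChar_card_sqrts hF c
  rw [quadChar_apply, add_comm, ← Int.cast_one, ← Int.cast_add, ← h]
  simp [Finset.sum_boole]

theorem sum_ite_mul_sq_eq (hF : ringChar F ≠ 2) {a : F} (ha : a ≠ 0) (c : F) :
    ∑ x : F, (if a * x ^ 2 = c then (1 : ℂ) else 0) = 1 + quadChar F (a * c) := by
  have h : quadChar F (a * c) = quadChar F (c / a) := by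
    have : a * c = a * a * (c / a) := by field_simp
    rw [this, map_mul, map_mul, quadChar_mul_self ha, one_mul]
  rw [h, ← sum_ite_sq_eq hF]
  refine Finset.sum_congr rfl fun x _ => ?_
  congr 1
  rw [eq_div_iff ha, mul_comm]

/-- Summation over the fibres of a map to `F`. -/
theorem sum_comp_eq_sum_fiber {α : Type*} [Fintype α] (g : α → F) (f : F → ℂ) :
    ∑ x, f (g x) = ∑ c, (∑ x, if g x = c then (1 : ℂ) else 0) * f c := by
  simp only [Finset.sum_mul, ite_mul, one_mul, zero_mul]
  rw [Finset.sum_comm]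
  simp

theorem sum_mulChar_sub {θ : MulChar F ℂ} (hθ : θ ≠ 1) (c : F) : ∑ x, θ (c - x) = 0 := by
  rw [← MulChar.sum_eq_zero_of_ne_one hθ]
  exact Equiv.sum_comp (Equiv.subLeft c) θ

/-- `∑ χ(y) θ(c - y)` is a multiple of a Jacobi sum. -/
theorem sum_mulChar_mul_sub {χ θ : MulChar F ℂ} (h : χ * θ ≠ 1) (c : F) :
    ∑ y, χ y * θ (c - y) = (χ * θ) c * jacobiSum χ θ := by
  by_cases hc : c = 0
  · subst hc
    have : ∀ y, χ y * θ (0 - y) = θ (-1) * (χ * θ) y := fun y => by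
      rw [zero_sub, neg_eq_neg_one_mul, map_mul, MulChar.mul_apply]
      ring
    simp only [this, ← Finset.mul_sum, MulChar.sum_eq_zero_of_ne_one h, mul_zero, MulChar.map_zero,
      zero_mul]
  · rw [← Equiv.sum_comp (Equiv.mulLeft₀ c hc), jacobiSum, Finset.mul_sum]
    refine Finset.sum_congr rfl fun y _ => ?_
    have : c - c * y = c * (1 - y) := by ring
    change χ (c * y) * θ (c - c * y) = _
    rw [this, map_mul, map_mul, MulChar.mul_apply]
    ring

/-- For `c ≠ 0`, counting square roots by `1 + quadChar` turns the sum into the Jacobi sum of the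
quadratic character with itself, which is `-quadChar (-1)`. For `c = 0` every nonzero `x`
contributes `quadChar (-a)`. -/
theorem sum_quadChar_sub_mul_sq (hF : ringChar F ≠ 2) {a : F} (ha : a ≠ 0) (c : F) :
    ∑ x : F, quadChar F (c - a * x ^ 2) =
      quadChar F (-a) * ((Fintype.card F : ℂ) * (if c = 0 then 1 else 0) - 1) := by
  have hna : quadChar F (-a) = quadChar F (-1) * quadChar F a := by
    rw [← map_mul, neg_one_mul]
  by_cases hc : c = 0
  · subst hc
    have h0 : ∀ x : F, quadChar F (0 - a * x ^ 2) = quadChar F (-a) * (if x = 0 then 0 else 1) := by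
      intro x
      split_ifs with hx
      · simp [hx, MulChar.map_zero]
      · rw [mul_one, zero_sub, ← neg_mul, map_mul, map_pow, sq, quadChar_mul_self hx, mul_one]
    simp only [h0, ← Finset.mul_sum]
    simp [Finset.sum_ite, Finset.filter_ne', Finset.card_erase_of_mem]
    rw [Nat.cast_sub Fintype.card_pos]
    simp
  · rw [sum_comp_eq_sum_fiber (fun x => a * x ^ 2) fun y => quadChar F (c - y)]
    simp only [sum_ite_mul_sq_eq hF ha, add_mul, one_mul, Finset.sum_add_distrib,
      sum_mulChar_sub (quadChar_ne_one hF), map_mul, mul_assoc, ← Finset.mul_sum, if_neg hc]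
    have h1 : ∑ y, quadChar F y * quadChar F (c - y) = -quadChar F (-1) := by
      have := jacobiSum_nontrivial_inv (quadChar_ne_one hF)
      rw [quadChar_inv] at this
      rw [← this, ← Equiv.sum_comp (Equiv.mulLeft₀ c hc), jacobiSum]
      refine Finset.sum_congr rfl fun y _ => ?_
      have h2 : c - c * y = c * (1 - y) := by ring
      change quadChar F (c * y) * quadChar F (c - c * y) = _
      rw [h2, map_mul, map_mul]
      linear_combination quadChar F y * quadChar F (1 - y) * quadChar_mul_self hc
    rw [h1, hna]
    ring

/-- The correction term in the number of representations of `c` by a quadratic form in `m`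
variables. -/
def reprCorrection (F : Type*) [Field F] [Fintype F] [DecidableEq F] (m : ℕ) (c : F) : ℂ :=
  if Even m then (if c = 0 then 1 else 0) - (Fintype.card F : ℂ)⁻¹ else quadChar F c

theorem card_ne_zero_complex : (Fintype.card F : ℂ) ≠ 0 := by
  simp [Fintype.card_ne_zero]

/-- Induction on the number of variables, summing over the first one. Adding a variable to an even
number turns the correction `δ_{c=0} - 1/q` into a quadratic character by counting square roots;
adding one to an odd number turns it back by `sum_quadChar_sub_mul_sq`. -/
theorem sum_ite_diagonal_eq (hF : ringChar F ≠ 2) {m : ℕ} (d : Fin m → F) (hd : ∀ i, d i ≠ 0)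
    (c : F) :
    ∑ w : Fin m → F, (if ∑ i, d i * w i ^ 2 = c then (1 : ℂ) else 0) =
      (Fintype.card F : ℂ) ^ m * (Fintype.card F : ℂ)⁻¹ +
        quadChar F ((-1) ^ (m / 2) * ∏ i, d i) * (Fintype.card F : ℂ) ^ (m / 2) *
          reprCorrection F m c := by
  have hq := card_ne_zero_complex (F := F)
  induction m generalizing c with
  | zero => simp [reprCorrection, eq_comm]
  | succ m ih =>
    have h1 : ∑ w : Fin (m + 1) → F, (if ∑ i, d i * w i ^ 2 = c then (1 : ℂ) else 0) =
        ∑ x : F, ∑ w : Fin m → F,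
          (if ∑ i, d i.succ * w i ^ 2 = c - d 0 * x ^ 2 then (1 : ℂ) else 0) := by
      rw [← Fintype.sum_prod_type', ← (Fin.consEquiv fun _ => F).sum_comp]
      refine Finset.sum_congr rfl fun x _ => ?_
      simp only [Fin.consEquiv, Equiv.coe_fn_mk, Fin.sum_univ_succ, Fin.cons_zero, Fin.cons_succ,
        eq_sub_iff_add_eq']
    rw [h1]
    simp only [ih (fun i => d i.succ) (fun i => hd _), Finset.sum_add_distrib, Finset.sum_const,
      Finset.card_univ, nsmul_eq_mul, ← Finset.mul_sum, Fin.prod_univ_succ]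
    rcases Nat.even_or_odd m with hm | hm
    · have h2 : (m + 1) / 2 = m / 2 := by obtain ⟨k, rfl⟩ := hm; omega
      have h3 : ¬ Even (m + 1) := by simpa [Nat.even_add_one] using hm
      simp only [reprCorrection, if_pos hm, if_neg h3, h2, Finset.sum_sub_distrib, Finset.sum_const,
        Finset.card_univ, nsmul_eq_mul, mul_inv_cancel₀ hq, sub_eq_zero, eq_comm (a := c),
        sum_ite_mul_sq_eq hF (hd 0), map_mul]
      ring
    · have h2 : (m + 1) / 2 = m / 2 + 1 := by obtain ⟨k, rfl⟩ := hm; omega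
      have h3 : Even (m + 1) := by simpa [Nat.even_add_one] using hm
      have h4 : ¬ Even m := Nat.not_even_iff_odd.2 hm
      have h5 : quadChar F (-d 0) = quadChar F (-1) * quadChar F (d 0) := by
        rw [← map_mul, neg_one_mul]
      simp only [reprCorrection, if_pos h3, if_neg h4, h2, sum_quadChar_sub_mul_sq hF (hd 0), map_mul,
        h5, pow_succ (-1 : F)]
      field_simp
      ring

/-- The number of representations of `c` by a nondegenerate quadratic form. -/
theorem sum_ite_qform_eq (hF : ringChar F ≠ 2) {m : ℕ} (S : Matrix (Fin m) (Fin m) F) (hS : Sᵀ = S)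
    (hdet : S.det ≠ 0) (c : F) :
    ∑ w : Fin m → F, (if qform S w = c then (1 : ℂ) else 0) =
      (Fintype.card F : ℂ) ^ m * (Fintype.card F : ℂ)⁻¹ +
        quadChar F ((-1) ^ (m / 2) * S.det) * (Fintype.card F : ℂ) ^ (m / 2) *
          reprCorrection F m c := by
  obtain ⟨V, d, hV, hd⟩ := exists_congr_diagonal (Ring.two_ne_zero hF) S hS
  have hdd : ∏ i, d i = V.det * V.det * S.det := by
    rw [← det_diagonal, ← hd, det_mul, det_mul, det_transpose]
    ring
  have hne : ∏ i, d i ≠ 0 := by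
    rw [hdd]
    exact mul_ne_zero (mul_ne_zero hV.ne_zero hV.ne_zero) hdet
  have h1 := sum_ite_diagonal_eq hF d (fun i => (Finset.prod_ne_zero_iff.1 hne) i (Finset.mem_univ i)) c
  rw [hdd] at h1
  simp only [map_mul, quadChar_mul_self hV.ne_zero, one_mul] at h1 ⊢
  rw [← h1]
  have hbij : Function.Bijective fun w : Fin m → F => V *ᵥ w := by
    rw [← Finite.injective_iff_bijective]
    exact Matrix.mulVec_injective_iff_isUnit.2 ((Matrix.isUnit_iff_isUnit_det _).2 hV)
  rw [← hbij.sum_comp]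
  refine Finset.sum_congr rfl fun w _ => ?_
  rw [← qform_conj, hd, qform_diagonal]

/-- The sum of `θ(s - Q(w))` over all vectors `w`. -/
theorem sum_mulChar_sub_qform (hF : ringChar F ≠ 2) {m : ℕ} (S : Matrix (Fin m) (Fin m) F)
    (hS : Sᵀ = S) (hdet : S.det ≠ 0) {θ : MulChar F ℂ} (hθ : θ ≠ 1)
    (hθ' : quadChar F * θ ≠ 1) (s : F) :
    ∑ w : Fin m → F, θ (s - qform S w) =
      quadChar F ((-1) ^ (m / 2) * S.det) * (Fintype.card F : ℂ) ^ (m / 2) *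
        (if Even m then θ s else (quadChar F * θ) s * jacobiSum (quadChar F) θ) := by
  -- Sorting by the value of the form, the main term of the representation number does not depend on
  -- that value and is killed by `θ ≠ 1`. Only the correction contributes: a point mass for even
  -- `m`, a Jacobi sum for odd `m`.
  rw [sum_comp_eq_sum_fiber (fun w => qform S w) fun c => θ (s - c)]
  simp only [sum_ite_qform_eq hF S hS hdet, add_mul, Finset.sum_add_distrib, mul_assoc,
    ← Finset.mul_sum, sum_mulChar_sub hθ, mul_zero, zero_add]
  congr 2
  by_cases hm : Even m
  · simp only [reprCorrection, if_pos hm, sub_mul, Finset.sum_sub_distrib, ← Finset.mul_sum,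
      sum_mulChar_sub hθ, mul_zero, sub_zero]
    simp
  · simp only [reprCorrection, if_neg hm]
    exact sum_mulChar_mul_sub hθ' s

end FiniteField

end KM
end

noncomputable section
open Matrix

namespace KM

/-! ### Character sums over symmetric matrices -/

section SymmetricSums

/-- A singular symmetric matrix over a field has automorphisms of any nonzero determinant. -/
theorem exists_aut_det_eq {F : Type*} [Field F] {m : ℕ} {Z : Matrix (Fin m) (Fin m) F}
    (hZ : Zᵀ = Z) (hdet : Z.det = 0) (v : F) :
    ∃ V : Matrix (Fin m) (Fin m) F, V.det = v ∧ Vᵀ * Z * V = Z := by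
  obtain ⟨x, hx, hZx⟩ := Matrix.exists_mulVec_eq_zero_iff.2 hdet
  obtain ⟨i, hi⟩ := Function.ne_iff.1 hx
  -- A rank-one perturbation of the identity whose image is spanned by the kernel vector `x`. It
  -- scales `x` by `v` and is invisible to `Z`.
  let V : Matrix (Fin m) (Fin m) F := 1 + vecMulVec ((v - 1) • x) (Pi.single i (x i)⁻¹)
  have hZV : Z * V = Z := by
    rw [Matrix.mul_add, Matrix.mul_one, mul_vecMulVec, mulVec_smul, hZx, smul_zero, zero_vecMulVec,
      add_zero]
  refine ⟨V, ?_, ?_⟩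
  · have : V.det = 1 + (Pi.single i (x i)⁻¹ : Fin m → F) ⬝ᵥ ((v - 1) • x) := by
      rw [← det_one_add_replicateCol_mul_replicateRow (ι := Unit), ← vecMulVec_eq]
    rw [this, single_dotProduct, Pi.smul_apply, smul_eq_mul]
    have hi' : x i ≠ 0 := hi
    field_simp
    ring
  · rw [Matrix.mul_assoc, hZV]
    have := congrArg Matrix.transpose hZV
    rwa [transpose_mul, hZ] at this

variable {F : Type*} [Field F] [Fintype F] [DecidableEq F]

/-- The symmetric matrices of degree `m`. -/
def symMatrices (R : Type*) [Fintype R] [DecidableEq R] (m : ℕ) :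
    Finset (Matrix (Fin m) (Fin m) R) :=
  Finset.univ.filter fun Z => Zᵀ = Z

theorem mem_symMatrices {R : Type*} [Fintype R] [DecidableEq R] {m : ℕ}
    {Z : Matrix (Fin m) (Fin m) R} : Z ∈ symMatrices R m ↔ Zᵀ = Z := by
  simp [symMatrices]

theorem sum_symMatrices_succ {R : Type*} [Fintype R] [DecidableEq R] {m : ℕ}
    (f : Matrix (Fin (m + 1)) (Fin (m + 1)) R → ℂ) :
    ∑ S ∈ symMatrices R (m + 1), f S =
      ∑ Z ∈ symMatrices R m, ∑ s : R, ∑ w : Fin m → R, f (border s w w Z) := by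
  rw [← Finset.sum_congr rfl fun Z _ => Fintype.sum_prod_type'
    (fun (s : R) (w : Fin m → R) => f (border s w w Z)), ← Finset.sum_product']
  symm
  refine Finset.sum_bij' (fun x _ => border x.2.1 x.2.2 x.2.2 x.1)
    (fun S _ => (S.submatrix Fin.succ Fin.succ, S 0 0, fun j => S 0 j.succ)) ?_ ?_ ?_ ?_ ?_
  · rintro ⟨Z, s, w⟩ h
    simp only [Finset.mem_product, mem_symMatrices, Finset.mem_univ, and_true] at h
    simp [mem_symMatrices, transpose_border, h]
  · intro S h
    rw [mem_symMatrices] at h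
    simp [mem_symMatrices, transpose_submatrix, h]
  · rintro ⟨Z, s, w⟩ _
    rfl
  · intro S h
    rw [mem_symMatrices] at h
    refine border_ext rfl (fun _ => rfl) (fun i => ?_) fun _ _ => rfl
    exact congrFun (congrFun h.symm i.succ) 0 |>.symm ▸ rfl
  · intro x _
    rfl

/-- An automorphism `V` of `Z` of determinant `v` induces the substitution `w ↦ wV`, which
multiplies the bordered determinant by `v²`. The sum therefore equals itself times `θ²(v)`. -/
theorem sum_det_border_singular {m : ℕ} {θ : MulChar F ℂ} (hθ : θ ^ 2 ≠ 1)
    {Z : Matrix (Fin m) (Fin m) F} (hZ : Zᵀ = Z) (hdet : Z.det = 0) (s : F) :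
    ∑ w : Fin m → F, θ (border s w w Z).det = 0 := by
  obtain ⟨v, hv⟩ := (MulChar.ne_one_iff).1 hθ
  obtain ⟨V, hV, hVZ⟩ := exists_aut_det_eq hZ hdet (v : F)
  have hbij : Function.Bijective fun w : Fin m → F => w ᵥ* V := by
    rw [← Finite.injective_iff_bijective]
    exact Matrix.vecMul_injective_iff_isUnit.2
      ((Matrix.isUnit_iff_isUnit_det _).2 (hV ▸ v.isUnit))
  have hw : ∀ w : Fin m → F,
      θ (border s (w ᵥ* V) (w ᵥ* V) Z).det = (θ ^ 2) v * θ (border s w w Z).det := by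
    intro w
    have : border s (w ᵥ* V) (w ᵥ* V) Z =
        (border 1 0 0 V)ᵀ * border s w w Z * border 1 0 0 V := by
      rw [transpose_border, border_mul, border_mul]
      simp [hVZ, mulVec_transpose, zero_vecMulVec]
    rw [this, det_mul, det_mul, det_transpose, det_border_zero_row, hV, MulChar.pow_apply_coe]
    simp only [map_mul, one_mul]
    ring
  have := hbij.sum_comp fun w => θ (border s w w Z).det
  simp only [hw, ← Finset.mul_sum] at this
  exact eq_zero_of_mul_eq_self_left hv this

/-- The basic recursion for character sums over symmetric matrices. -/
theorem sum_symMatrices_det_trace (hF : ringChar F ≠ 2) {m : ℕ} {θ : MulChar F ℂ} (hθ : θ ≠ 1)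
    (hθ' : m = 0 ∨ θ ^ 2 ≠ 1) (f : F → ℂ) :
    ∑ S ∈ symMatrices F (m + 1), θ S.det * f S.trace =
      quadChar F ((-1) ^ (m / 2)) * (Fintype.card F : ℂ) ^ (m / 2) *
        (if Even m then 1 else jacobiSum (quadChar F) θ) *
        ∑ Z ∈ symMatrices F m, (quadChar F * θ) Z.det *
          ∑ s, f (s + Z.trace) * (if Even m then θ else quadChar F * θ) s := by
  rw [sum_symMatrices_succ, Finset.mul_sum]
  refine Finset.sum_congr rfl fun Z hZ => ?_
  rw [mem_symMatrices] at hZ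
  simp only [trace_border, ← Finset.sum_mul]
  -- A singular `Z` contributes zero to both sides; it cannot occur for `m = 0`, where the
  -- determinant is one.
  by_cases hdet : Z.det = 0
  · have hm : θ ^ 2 ≠ 1 := by
      refine hθ'.resolve_left ?_
      rintro rfl
      simp at hdet
    simp [sum_det_border_singular hm hZ hdet, hdet, MulChar.map_zero]
  · have hu : IsUnit Z.det := isUnit_iff_ne_zero.2 hdet
    have hinv : Z⁻¹.det = (Z.det)⁻¹ := by
      rw [det_nonsing_inv, Ring.inverse_eq_inv']
    have hq : quadChar F (Z.det)⁻¹ = quadChar F Z.det := by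
      rw [← MulChar.inv_apply', quadChar_inv]
    -- The bordered determinant is `det Z · (s - Z⁻¹[w])`, so the sum over `w` is a character sum
    -- along the quadratic form `Z⁻¹`.
    have key : ∀ s, ∑ w : Fin m → F, θ (border s w w Z).det =
        θ Z.det * (quadChar F ((-1) ^ (m / 2) * (Z.det)⁻¹) * (Fintype.card F : ℂ) ^ (m / 2) *
        (if Even m then θ s else (quadChar F * θ) s * jacobiSum (quadChar F) θ)) := by
      intro s
      simp only [det_border _ _ _ _ hu, map_mul θ, ← Finset.mul_sum]
      by_cases hm : m = 0
      · subst hm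
        simp
      · rw [← hinv, ← sum_mulChar_sub_qform hF Z⁻¹ (by rw [transpose_nonsing_inv, hZ])
          (by rw [hinv]; exact inv_ne_zero hdet) hθ]
        · rfl
        · intro h
          apply hθ'.resolve_left hm
          have := congrArg (· ^ 2) h
          simpa [mul_pow, quadChar_sq] using this
    simp only [key, MulChar.mul_apply (quadChar F) θ Z.det, map_mul, hq]
    simp only [Finset.mul_sum]
    refine Finset.sum_congr rfl fun s _ => ?_
    split_ifs <;> ring

end SymmetricSums

end KM
end

/-! ### Trace sums and matrix Gauss sums. -/

noncomputable section
open Matrix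

namespace KM

section MatrixGaussSums

variable {F : Type*} [Field F] [Fintype F] [DecidableEq F]

theorem sum_symMatrices_smul {m : ℕ} {a : F} (ha : a ≠ 0) (f : Matrix (Fin m) (Fin m) F → ℂ) :
    ∑ S ∈ symMatrices F m, f (a • S) = ∑ S ∈ symMatrices F m, f S := by
  refine Finset.sum_nbij' (fun S => a • S) (fun S => a⁻¹ • S) ?_ ?_ ?_ ?_ ?_
  · intro S hS
    rw [mem_symMatrices] at hS ⊢
    rw [transpose_smul, hS]
  · intro S hS
    rw [mem_symMatrices] at hS ⊢
    rw [transpose_smul, hS]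
  · intro S _
    rw [smul_smul, inv_mul_cancel₀ ha, one_smul]
  · intro S _
    rw [smul_smul, mul_inv_cancel₀ ha, one_smul]
  · intro S _
    rfl

/-- The sum of `θ(det S)` over the symmetric matrices of trace `t`. -/
def traceSum (m : ℕ) (θ : MulChar F ℂ) (t : F) : ℂ :=
  ∑ S ∈ symMatrices F m, θ S.det * (if S.trace = t then 1 else 0)

theorem traceSum_mul {m : ℕ} (θ : MulChar F ℂ) {a : F} (ha : a ≠ 0) (t : F) :
    traceSum m θ (a * t) = (θ ^ m) a * traceSum m θ t := by
  rw [traceSum, ← sum_symMatrices_smul ha, traceSum, Finset.mul_sum]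
  refine Finset.sum_congr rfl fun S _ => ?_
  rw [det_smul, trace_smul, map_mul, map_pow, Fintype.card_fin, smul_eq_mul,
    mul_assoc]
  simp only [mul_right_inj' ha]
  congr 1
  lift a to Fˣ using isUnit_iff_ne_zero.2 ha
  rw [MulChar.pow_apply_coe]

/-- By homogeneity (`traceSum_mul`) all trace sums at nonzero `t` are determined by the one at `t =
1`. -/
theorem sum_symMatrices_eq_traceSum {m : ℕ} (θ : MulChar F ℂ) (f : F → ℂ) :
    ∑ S ∈ symMatrices F m, θ S.det * f S.trace =
      traceSum m θ 0 * f 0 + traceSum m θ 1 * ∑ t, (θ ^ m) t * f t := by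
  have h1 : ∑ S ∈ symMatrices F m, θ S.det * f S.trace = ∑ t, traceSum m θ t * f t := by
    simp only [traceSum, Finset.sum_mul, mul_ite, mul_one, mul_zero, ite_mul, zero_mul]
    rw [Finset.sum_comm]
    simp
  rw [h1, Finset.mul_sum, ← Finset.add_sum_erase _ _ (Finset.mem_univ (0 : F)),
    ← Finset.add_sum_erase _ (fun t => traceSum m θ 1 * _) (Finset.mem_univ (0 : F)),
    MulChar.map_zero, zero_mul, mul_zero, zero_add]
  congr 1
  refine Finset.sum_congr rfl fun t ht => ?_
  have := traceSum_mul (m := m) θ (Finset.ne_of_mem_erase ht) 1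
  rw [mul_one] at this
  rw [this]
  ring

theorem traceSum_zero {m : ℕ} {θ : MulChar F ℂ} (h : θ ^ m ≠ 1) : traceSum m θ 0 = 0 := by
  obtain ⟨v, hv⟩ := (MulChar.ne_one_iff).1 h
  have := traceSum_mul (m := m) θ v.ne_zero 0
  rw [mul_zero] at this
  exact eq_zero_of_mul_eq_self_left hv this.symm

theorem sum_symMatrices_mulChar_trace {m : ℕ} (θ χ : MulChar F ℂ) :
    ∑ S ∈ symMatrices F m, θ S.det * χ S.trace =
      if θ ^ m * χ = 1 then traceSum m θ 1 * ((Fintype.card F : ℂ) - 1) else 0 := by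
  rw [sum_symMatrices_eq_traceSum, MulChar.map_zero, mul_zero, zero_add]
  simp only [← MulChar.mul_apply]
  split_ifs with h
  · rw [h, MulChar.sum_one_eq_card_units, Fintype.card_units, Nat.cast_sub Fintype.card_pos,
      Nat.cast_one]
  · rw [MulChar.sum_eq_zero_of_ne_one h, mul_zero]

theorem quadChar_mul_sq_ne_one {θ : MulChar F ℂ} (h : θ ^ 2 ≠ 1) : (quadChar F * θ) ^ 2 ≠ 1 := by
  rwa [mul_pow, quadChar_sq, one_mul]

theorem ne_one_of_sq_ne_one {θ : MulChar F ℂ} (h : θ ^ 2 ≠ 1) : θ ≠ 1 := by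
  rintro rfl
  exact h (one_pow _)

theorem quadChar_mul_quadChar_mul (θ : MulChar F ℂ) : quadChar F * (quadChar F * θ) = θ := by
  rw [← mul_assoc, ← sq, quadChar_sq, one_mul]

/-- The matrix Gauss sum over symmetric matrices. -/
def symGaussSum (m : ℕ) (ψ : AddChar F ℂ) (θ : MulChar F ℂ) : ℂ :=
  ∑ S ∈ symMatrices F m, θ S.det * ψ S.trace

/-- The recursion for symmetric matrices with an additive character: the corner entry splits off a
Gauss sum, and for odd `m` the product of Jacobi and Gauss sum is rewritten as a product of two
Gauss sums. -/
theorem symGaussSum_succ (hF : ringChar F ≠ 2) (m : ℕ) (ψ : AddChar F ℂ) {θ : MulChar F ℂ}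
    (hθ : θ ^ 2 ≠ 1) :
    symGaussSum (m + 1) ψ θ = quadChar F ((-1) ^ (m / 2)) * (Fintype.card F : ℂ) ^ (m / 2) *
      (if Even m then 1 else gaussSum (quadChar F) ψ) * gaussSum θ ψ *
        symGaussSum m ψ (quadChar F * θ) := by
  have h1 := ne_one_of_sq_ne_one (quadChar_mul_sq_ne_one hθ)
  rw [symGaussSum, sum_symMatrices_det_trace hF (ne_one_of_sq_ne_one hθ) (Or.inr hθ), symGaussSum]
  have h2 : ∀ ω : MulChar F ℂ, ∀ t : F, ∑ s, ψ (s + t) * ω s = ψ t * gaussSum ω ψ := by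
    intro ω t
    rw [gaussSum, Finset.mul_sum]
    exact Finset.sum_congr rfl fun s _ => by rw [AddChar.map_add_eq_mul]; ring
  simp only [h2, ← mul_assoc, ← Finset.sum_mul]
  by_cases hm : Even m
  · simp only [if_pos hm]
    ring
  · simp only [if_neg hm]
    linear_combination quadChar F ((-1) ^ (m / 2)) * (Fintype.card F : ℂ) ^ (m / 2) *
      (∑ S ∈ symMatrices F m, (quadChar F * θ) S.det * ψ S.trace) * jacobiSum_mul_nontrivial h1 ψ

/-- Two steps of the recursion produce the factors `gaussSum θ` and `gaussSum (quadChar * θ)`, a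
product that is symmetric under the quadratic twist. -/
theorem symGaussSum_quadChar_mul (hF : ringChar F ≠ 2) {m : ℕ} (hm : Even m) (ψ : AddChar F ℂ)
    {θ : MulChar F ℂ} (hθ : θ ^ 2 ≠ 1) :
    symGaussSum m ψ (quadChar F * θ) = symGaussSum m ψ θ := by
  obtain ⟨k, rfl⟩ := hm
  have hθ' := quadChar_mul_sq_ne_one hθ
  induction k with
  | zero => simp [symGaussSum]
  | succ k ih =>
    have : k + 1 + (k + 1) = k + k + 1 + 1 := by ring
    rw [this, symGaussSum_succ hF _ _ hθ', symGaussSum_succ hF _ _ hθ,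
      quadChar_mul_quadChar_mul, symGaussSum_succ hF _ _ hθ', symGaussSum_succ hF _ _ hθ,
      quadChar_mul_quadChar_mul, ih]
    ring

/-- The matrix Gauss sum is `traceSum m θ 1` times the Gauss sum of `θ^m`. For even `m` the twist
changes neither the matrix Gauss sum nor `θ^m`, and the Gauss sum of `θ^m` is nonzero, so it
cancels. -/
theorem traceSum_quadChar_mul (hF : ringChar F ≠ 2) {m : ℕ} (hm : Even m) {θ : MulChar F ℂ}
    (hθ : θ ^ m ≠ 1) : traceSum m (quadChar F * θ) 1 = traceSum m θ 1 := by
  have hθ2 : θ ^ 2 ≠ 1 := by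
    intro h
    obtain ⟨k, rfl⟩ := hm
    exact hθ (by rw [← two_mul, pow_mul, h, one_pow])
  have hpow : (quadChar F * θ) ^ m = θ ^ m := by
    obtain ⟨k, rfl⟩ := hm
    rw [mul_pow, ← two_mul, pow_mul, quadChar_sq, one_pow, one_mul]
  obtain ⟨ψ, hψ⟩ : ∃ ψ : AddChar F ℂ, ψ.IsPrimitive :=
    ⟨_, (AddChar.FiniteField.primitiveChar_to_Complex_isPrimitive F)⟩
  have h := symGaussSum_quadChar_mul hF hm ψ hθ2
  rw [symGaussSum, symGaussSum, sum_symMatrices_eq_traceSum, sum_symMatrices_eq_traceSum,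
    traceSum_zero hθ, traceSum_zero (by rwa [hpow]), hpow, zero_mul, zero_add, zero_add] at h
  exact mul_right_cancel₀ (gaussSum_ne_zero_of_nontrivial card_ne_zero_complex hθ hψ) h

/-- Evaluation of `traceSum` by a matrix Jacobi sum of lower degree. -/
theorem traceSum_succ (hF : ringChar F ≠ 2) {m : ℕ} {θ : MulChar F ℂ} (hθ : θ ≠ 1)
    (hθ' : m = 0 ∨ θ ^ 2 ≠ 1) :
    traceSum (m + 1) θ 1 =
      quadChar F ((-1) ^ (m / 2)) * (Fintype.card F : ℂ) ^ (m / 2) *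
        (if Even m then 1 else jacobiSum (quadChar F) θ) *
        ∑ Z ∈ symMatrices F m, (quadChar F * θ) Z.det *
          (if Even m then θ else quadChar F * θ) (1 - Z.trace) := by
  rw [traceSum, sum_symMatrices_det_trace hF hθ hθ' fun t => if t = 1 then 1 else 0]
  congr 1
  refine Finset.sum_congr rfl fun Z _ => ?_
  congr 1
  simp [← eq_sub_iff_add_eq]

end MatrixGaussSums

end KM
end

noncomputable section
open Matrix

namespace KM

/-! ### Counting isometries of determinant one -/

theorem exists_det_ne_zero_col_zero {F : Type*} [Field F] {n : ℕ} {u : Fin (n + 1) → F}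
    (hu : u ≠ 0) : ∃ P : Matrix (Fin (n + 1)) (Fin (n + 1)) F, P.det ≠ 0 ∧ ∀ i, P i 0 = u i := by
  obtain ⟨i, hi⟩ := Function.ne_iff.1 hu
  refine ⟨((1 : Matrix _ _ F).updateCol 0 (u ∘ Equiv.swap 0 i)).submatrix (Equiv.swap 0 i) id, ?_,
    ?_⟩
  · rw [det_permute, ← cramer_apply, cramer_one]
    have hi' : u i ≠ 0 := hi
    have : ((Equiv.Perm.sign (Equiv.swap 0 i) : ℤ) : F) ≠ 0 := by
      rcases Int.units_eq_one_or (Equiv.Perm.sign (Equiv.swap 0 i)) with h | h <;> simp [h]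
    simpa [hi'] using this
  · intro j
    simp

/-- Gram–Schmidt with respect to `T`: extend `u` to a basis, project the other vectors off `u`,
which is possible as `T[u] ≠ 0`, and rescale one of them to reach determinant one. The rescaling is
why the size is at least two. -/
theorem exists_orthogonal_completion {F : Type*} [Field F] {n : ℕ}
    {T : Matrix (Fin (n + 2)) (Fin (n + 2)) F} (hT : Tᵀ = T) {u : Fin (n + 2) → F}
    (hu : qform T u ≠ 0) :
    ∃ (V : Matrix (Fin (n + 2)) (Fin (n + 2)) F) (T' : Matrix (Fin (n + 1)) (Fin (n + 1)) F),
      V.det = 1 ∧ (∀ i, V i 0 = u i) ∧ T'ᵀ = T' ∧ Vᵀ * T * V = border (qform T u) 0 0 T' := by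
  have hu0 : u ≠ 0 := by
    rintro rfl
    simp [qform] at hu
  obtain ⟨P, hP, hPu⟩ := exists_det_ne_zero_col_zero hu0
  set s := qform T u with hs
  set A := Pᵀ * T * P with hA
  have hAsymm : Aᵀ = A := by
    simp only [hA, transpose_mul, transpose_transpose, hT, Matrix.mul_assoc]
  have hA00 : A 0 0 = s := by
    rw [hA, conj_apply_zero_zero, hs]
    congr 1
    exact funext hPu
  set b : Fin (n + 1) → F := fun j => A 0 j.succ with hb
  set Z := A.submatrix Fin.succ Fin.succ with hZ
  have hZsymm : Zᵀ = Z := by rw [hZ, transpose_submatrix, hAsymm]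
  have hAb : A = border s b b Z := by
    rw [eq_border A, hA00, border_inj]
    exact ⟨rfl, rfl, funext fun i => congrFun (congrFun hAsymm.symm i.succ) 0, rfl⟩
  -- `N` makes the remaining basis vectors orthogonal to `u`; `D` divides the first of them by `det
  -- P`.
  let D : Matrix (Fin (n + 1)) (Fin (n + 1)) F := diagonal (Pi.mulSingle 0 P.det⁻¹)
  let N : Matrix (Fin (n + 2)) (Fin (n + 2)) F := border 1 (-(s⁻¹ • b)) 0 1
  let E : Matrix (Fin (n + 2)) (Fin (n + 2)) F := border 1 0 0 D
  let T₁ := vecMulVec (-(s⁻¹ • b)) b + Z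
  have hN : Nᵀ * A * N = border s 0 0 T₁ := by
    simp only [N, hAb, transpose_border, border_mul, border_inj]
    simp [T₁, smul_smul, mul_inv_cancel₀ hu]
  have hT₁ : T₁ᵀ = T₁ := by
    have h : (Nᵀ * A * N)ᵀ = Nᵀ * A * N := by
      simp only [transpose_mul, transpose_transpose, hAsymm, Matrix.mul_assoc]
    rw [hN, transpose_border, border_inj] at h
    exact h.2.2.2
  refine ⟨P * N * E, Dᵀ * T₁ * D, ?_, ?_, ?_, ?_⟩
  · rw [det_mul, det_mul, det_border_zero_row, det_border_zero_col, det_one, det_diagonal,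
      Finset.prod_pi_mulSingle']
    simp [hP]
  · intro i
    rw [← hPu, eq_border P]
    simp only [N, E, border_mul]
    refine Fin.cases ?_ (fun i => ?_) i <;> simp
  · simp only [transpose_mul, transpose_transpose, hT₁, Matrix.mul_assoc]
  · have : (P * N * E)ᵀ * T * (P * N * E) = Eᵀ * (Nᵀ * A * N) * E := by
      simp only [hA, transpose_mul, Matrix.mul_assoc]
    rw [this, hN]
    simp [E, transpose_border, border_mul]

section IsometryCount

variable {F : Type*} [Field F] [Fintype F] [DecidableEq F]

/-- The number of `U ∈ SL_n(F)` with `ᵗU T U = S`. -/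
def isomCount {n : ℕ} (T S : Matrix (Fin n) (Fin n) F) : ℂ :=
  ∑ U : SpecialLinearGroup (Fin n) F, if U.1ᵀ * T * U.1 = S then 1 else 0

theorem isomCount_conj {n : ℕ} (T S V : Matrix (Fin n) (Fin n) F) (hV : IsUnit V.det) :
    isomCount (Vᵀ * T * V) (Vᵀ * S * V) = isomCount T S := by
  have hd : V⁻¹.det * V.det = 1 := by rw [← det_mul, nonsing_inv_mul V hV, det_one]
  have h1 := nonsing_inv_mul V hV
  have h2 := mul_nonsing_inv V hV
  have h1' (X : Matrix (Fin n) (Fin n) F) : V⁻¹ * (V * X) = X := by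
    rw [← Matrix.mul_assoc, h1, Matrix.one_mul]
  have h2' (X : Matrix (Fin n) (Fin n) F) : V * (V⁻¹ * X) = X := by
    rw [← Matrix.mul_assoc, h2, Matrix.one_mul]
  let e : SpecialLinearGroup (Fin n) F ≃ SpecialLinearGroup (Fin n) F :=
    { toFun := fun U => ⟨V⁻¹ * U.1 * V, by
        rw [det_mul, det_mul, U.2, mul_one, hd]⟩
      invFun := fun U => ⟨V * U.1 * V⁻¹, by
        rw [det_mul, det_mul, U.2, mul_one, mul_comm, hd]⟩
      left_inv := fun U => by
        apply Subtype.ext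
        simp only [Matrix.mul_assoc, h2', h2, Matrix.mul_one]
      right_inv := fun U => by
        apply Subtype.ext
        simp only [Matrix.mul_assoc, h1', h1, Matrix.mul_one] }
  rw [isomCount, isomCount, ← e.sum_comp]
  refine Finset.sum_congr rfl fun U _ => ?_
  have h3 : (V⁻¹ * U.1 * V)ᵀ * (Vᵀ * T * V) * (V⁻¹ * U.1 * V) = Vᵀ * (U.1ᵀ * T * U.1) * V := by
    have h4 : V⁻¹ᵀ * Vᵀ = 1 := by rw [← transpose_mul, h2, transpose_one]
    have h4' (X : Matrix (Fin n) (Fin n) F) : V⁻¹ᵀ * (Vᵀ * X) = X := by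
      rw [← Matrix.mul_assoc, h4, Matrix.one_mul]
    simp only [transpose_mul, Matrix.mul_assoc, h2', h4']
  have h5 : Vᵀ * (U.1ᵀ * T * U.1) * V = Vᵀ * S * V ↔ U.1ᵀ * T * U.1 = S := by
    have hVu : IsUnit V := (isUnit_iff_isUnit_det V).2 hV
    rw [hVu.mul_left_inj, ((isUnit_transpose (A := V)).2 hVu).mul_right_inj]
  have he : (e U).1 = V⁻¹ * U.1 * V := rfl
  simp only [he, h3, h5]

/-- Once the first column is fixed to be `u`, the matrix `V⁻¹U` fixes the first basis vector, and
orthogonality forces it to be block diagonal. Its lower block is an isometry between the orthogonal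
complements. -/
theorem isomCount_fiber {n : ℕ} {T : Matrix (Fin (n + 2)) (Fin (n + 2)) F}
    {u : Fin (n + 2) → F} {s : F} (hs : s ≠ 0)
    {V : Matrix (Fin (n + 2)) (Fin (n + 2)) F} {T' : Matrix (Fin (n + 1)) (Fin (n + 1)) F}
    (hV : V.det = 1) (hVu : ∀ i, V i 0 = u i) (hVT : Vᵀ * T * V = border s 0 0 T')
    (D : Matrix (Fin (n + 1)) (Fin (n + 1)) F) :
    (∑ U : SpecialLinearGroup (Fin (n + 2)) F,
      if (fun i => U.1 i 0) = u ∧ U.1ᵀ * T * U.1 = border s 0 0 D then (1 : ℂ) else 0) =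
      isomCount T' D := by
  rw [isomCount, Finset.sum_boole, Finset.sum_boole]
  congr 1
  symm
  have hVT' (X Y : Matrix (Fin (n + 2)) (Fin (n + 2)) F) :
      (V * X)ᵀ * T * (V * Y) = Xᵀ * border s 0 0 T' * Y := by
    rw [← hVT, transpose_mul]
    simp only [Matrix.mul_assoc]
  have hVu' : IsUnit V := (isUnit_iff_isUnit_det V).2 (hV ▸ isUnit_one)
  refine Finset.card_bij (fun W _ => ⟨V * border 1 0 0 W.1, by
    rw [det_mul, hV, det_border_zero_row, W.2, one_mul, one_mul]⟩) ?_ ?_ ?_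
  · intro W hW
    simp only [Finset.mem_filter, Finset.mem_univ, true_and] at hW
    refine Finset.mem_filter.2 ⟨Finset.mem_univ _, ?_, ?_⟩
    · funext i
      change (V * border 1 0 0 W.1) i 0 = u i
      rw [← hVu, eq_border V, border_mul]
      refine Fin.cases ?_ (fun i => ?_) i <;> simp
    · change (V * border 1 0 0 W.1)ᵀ * T * (V * border 1 0 0 W.1) = _
      rw [hVT']
      simp [transpose_border, border_mul, hW]
  · intro W _ W' _ h
    have h1 := hVu'.mul_left_cancel (congrArg Subtype.val h)
    rw [border_inj] at h1
    exact Subtype.ext h1.2.2.2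
  · intro U hU
    simp only [Finset.mem_filter, Finset.mem_univ, true_and] at hU
    obtain ⟨hU1, hU2⟩ := hU
    set W := V⁻¹ * U.1 with hW
    have hVW : V * W = U.1 := by
      rw [hW, ← Matrix.mul_assoc, mul_nonsing_inv V (hV ▸ isUnit_one), Matrix.one_mul]
    have hWdet : W.det = 1 := by
      have := congrArg det hVW
      rwa [det_mul, hV, U.2, one_mul] at this
    have hcol : W *ᵥ Pi.single 0 1 = Pi.single 0 1 := by
      apply (Matrix.mulVec_injective_iff_isUnit.2 hVu')
      change V *ᵥ _ = V *ᵥ _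
      rw [mulVec_mulVec, hVW, mulVec_single_one, mulVec_single_one]
      funext i
      exact (congrFun hU1 i).trans (hVu i).symm
    rw [mulVec_single_one] at hcol
    have hW0 : W = border 1 (fun j => W 0 j.succ) 0 (W.submatrix Fin.succ Fin.succ) := by
      rw [eq_border W, border_inj]
      refine ⟨?_, rfl, ?_, rfl⟩
      · simpa using congrFun hcol 0
      · funext i
        simpa using congrFun hcol i.succ
    rw [← hVW, hVT', hW0, transpose_border, border_mul, border_mul, border_inj] at hU2
    -- The off-diagonal row of the target vanishes, which reads `s • r = 0`.
    have hr : (fun j : Fin (n + 1) => W 0 j.succ) = 0 := by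
      have := hU2.2.1
      simp only [one_mul, zero_dotProduct, add_zero, smul_zero] at this
      simpa [hs] using this
    rw [hr] at hW0 hU2
    refine ⟨⟨W.submatrix Fin.succ Fin.succ, ?_⟩, ?_, ?_⟩
    · have := congrArg det hW0
      rw [hWdet, det_border_zero_row, one_mul] at this
      exact this.symm
    · refine Finset.mem_filter.2 ⟨Finset.mem_univ _, ?_⟩
      simpa using hU2.2.2.2
    · apply Subtype.ext
      change V * border 1 0 0 (W.submatrix Fin.succ Fin.succ) = U.1
      rw [← hW0, hVW]

end IsometryCount

end KM
end

/-! ### Orders of special orthogonal groups and the sum over `SL_n`. -/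

noncomputable section
open Matrix

namespace KM

/-- The order of a special orthogonal group of degree `m` over a field with `q` elements, where
`δ` is the value of the quadratic character at the signed discriminant. -/
def isomConst (q : ℂ) (m : ℕ) (δ : ℂ) : ℂ :=
  if Even m then
    q ^ (m ^ 2 - m * (m + 1) / 2) * (1 - δ / q ^ (m / 2)) *
      ∏ e ∈ Finset.Icc 1 ((m - 2) / 2), (1 - 1 / q ^ (2 * e))
  else
    q ^ (m ^ 2 - m * (m + 1) / 2) * ∏ e ∈ Finset.Icc 1 ((m - 1) / 2), (1 - 1 / q ^ (2 * e))

/-- The exponent is `m(m-1)/2`, written with truncated subtraction that never truncates. -/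
theorem isomConst_exponent_succ (m : ℕ) :
    (m + 1) ^ 2 - (m + 1) * (m + 1 + 1) / 2 = (m ^ 2 - m * (m + 1) / 2) + m := by
  obtain ⟨k, hk⟩ := Nat.even_mul_succ_self m
  have h1 : (m + 1) * (m + 1 + 1) = (k + k) + 2 * (m + 1) := by rw [← hk]; ring
  have h2 : m ^ 2 + m = k + k := by rw [← hk]; ring
  have h3 : (m + 1) ^ 2 = m ^ 2 + 2 * m + 1 := by ring
  have h4 : m ≤ k := by
    rcases Nat.eq_zero_or_pos m with rfl | hm
    · omega
    · nlinarith
  rw [h1, hk, h3]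
  omega

/-- The first factor is the number of vectors of a given nonzero length in even dimension `m + 1`.
In odd degree `isomConst` ignores its last argument, so `δ'` is free. -/
theorem isomConst_succ_of_odd {q : ℂ} (hq : q ≠ 0) {m : ℕ} (hm : Odd m) (δ δ' : ℂ) :
    (q ^ (m + 1) * q⁻¹ + δ * q ^ ((m + 1) / 2) * (0 - q⁻¹)) * isomConst q m δ' =
      isomConst q (m + 1) δ := by
  have h1 : ¬ Even m := Nat.not_even_iff_odd.2 hm
  have h2 : Even (m + 1) := hm.add_one
  rw [isomConst, isomConst, if_neg h1, if_pos h2, isomConst_exponent_succ]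
  obtain ⟨k, rfl⟩ := hm
  have h3 : (2 * k + 1 + 1) / 2 = k + 1 := by omega
  have h4 : (2 * k + 1 + 1 - 2) / 2 = k := by omega
  have h5 : (2 * k + 1 - 1) / 2 = k := by omega
  rw [h3, h4, h5]
  field_simp
  ring

/-- The number of vectors is `q^m + δ' q^(m/2)`, and `δ'² = 1` makes it combine with `1 -
δ'/q^(m/2)` to `q^m (1 - q^(-m))`, the next factor of the product. Degree zero is excluded because
there the formula gives `1 - δ'` instead of one. -/
theorem isomConst_succ_of_even {q : ℂ} (hq : q ≠ 0) {m : ℕ} (hm : Even m) (hm0 : m ≠ 0) {δ δ' ε : ℂ}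
    (h : δ' = δ * ε) (hδ' : δ' * δ' = 1) (δ'' : ℂ) :
    (q ^ (m + 1) * q⁻¹ + δ * q ^ ((m + 1) / 2) * ε) * isomConst q m δ' =
      isomConst q (m + 1) δ'' := by
  have h1 : ¬ Even (m + 1) := by simpa [Nat.even_add_one] using hm
  rw [isomConst, isomConst, if_pos hm, if_neg h1, isomConst_exponent_succ]
  obtain ⟨k, rfl⟩ := hm
  obtain ⟨k, rfl⟩ : ∃ j, k = j + 1 := Nat.exists_eq_succ_of_ne_zero (by omega)
  have h2 : (k + 1 + (k + 1)) / 2 = k + 1 := by omega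
  have h3 : (k + 1 + (k + 1) + 1) / 2 = k + 1 := by omega
  have h4 : (k + 1 + (k + 1) - 2) / 2 = k := by omega
  have h5 : (k + 1 + (k + 1) + 1 - 1) / 2 = k + 1 := by omega
  rw [h2, h3, h4, h5, Finset.prod_Icc_succ_top (by omega)]
  have h6 : q ^ (k + 1 + (k + 1)) * (1 - 1 / q ^ (2 * (k + 1))) =
      (q ^ (k + 1 + (k + 1) + 1) * q⁻¹ + δ * q ^ (k + 1) * ε) * (1 - δ' / q ^ (k + 1)) := by
    have h7 : δ * q ^ (k + 1) * ε = δ' * q ^ (k + 1) := by rw [h]; ring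
    rw [h7]
    field_simp
    linear_combination q ^ (3 * k + 4) * hδ'
  rw [pow_add q _ (k + 1 + (k + 1))]
  linear_combination (-(q ^ ((k + 1 + (k + 1)) ^ 2 - (k + 1 + (k + 1)) * (k + 1 + (k + 1) + 1) / 2) *
    ∏ e ∈ Finset.Icc 1 k, (1 - 1 / q ^ (2 * e)))) * h6

section

variable {F : Type*} [Field F] [Fintype F] [DecidableEq F]

/-- Choose the first column `u` among the vectors with `T[u] = d 0`, counted by `sum_ite_qform_eq`.
Each choice leaves an isometry problem on the orthogonal complement, whose determinant is `det T / d
0`, so the hypothesis on determinants is inherited and the count is the same for all `u`. -/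
theorem isomCount_diagonal (hF : ringChar F ≠ 2) {n : ℕ} {T : Matrix (Fin (n + 1)) (Fin (n + 1)) F}
    (hT : Tᵀ = T) {d : Fin (n + 1) → F} (hd : ∀ i, d i ≠ 0) (hdet : T.det = ∏ i, d i) :
    isomCount T (diagonal d) =
      isomConst (Fintype.card F) (n + 1) (quadChar F ((-1) ^ ((n + 1) / 2) * T.det)) := by
  have hq := card_ne_zero_complex (F := F)
  induction n with
  | zero =>
    have h1 : ∀ U : SpecialLinearGroup (Fin (0 + 1)) F, U.1ᵀ * T * U.1 = diagonal d := by
      intro U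
      have hU : U.1 = 1 := by
        ext i j
        have := U.2
        rw [det_fin_one] at this
        fin_cases i; fin_cases j
        simpa using this
      rw [hU, transpose_one, Matrix.one_mul, Matrix.mul_one]
      ext i j
      fin_cases i; fin_cases j
      simpa using hdet
    have h2 : Fintype.card (SpecialLinearGroup (Fin 1) F) = 1 :=
      Fintype.card_eq_one_iff.2 ⟨1, fun y => Subsingleton.elim _ _⟩
    simp [isomCount, h1, isomConst, h2]
  | succ n ih =>
    have hT0 : T.det ≠ 0 := hdet ▸ Finset.prod_ne_zero_iff.2 fun i _ => hd i
    have hdiag : diagonal d = border (d 0) 0 0 (diagonal fun i => d i.succ) := by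
      refine border_ext ?_ (fun j => ?_) (fun i => ?_) fun i j => ?_
      · simp
      · rw [diagonal_apply_ne _ (Fin.succ_ne_zero j).symm]; rfl
      · rw [diagonal_apply_ne _ (Fin.succ_ne_zero i)]; rfl
      · simp [diagonal_apply]
    have hsplit : isomCount T (diagonal d) = ∑ u : Fin (n + 2) → F,
        ∑ U : SpecialLinearGroup (Fin (n + 2)) F,
          if (fun i => U.1 i 0) = u ∧ U.1ᵀ * T * U.1 = border (d 0) 0 0 (diagonal fun i => d i.succ)
          then (1 : ℂ) else 0 := by
      rw [Finset.sum_comm, isomCount, hdiag]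
      refine Finset.sum_congr rfl fun U _ => ?_
      simp [ite_and]
    set q : ℂ := (Fintype.card F : ℂ) with hqdef
    have hδ : quadChar F ((-1) ^ ((n + 1) / 2) * (T.det / d 0)) =
        quadChar F ((-1) ^ ((n + 1) / 2) * T.det) * quadChar F (d 0) := by
      have : T.det / d 0 = T.det * (d 0)⁻¹ := div_eq_mul_inv _ _
      rw [this, ← mul_assoc, map_mul (quadChar F) _ (d 0)⁻¹, ← MulChar.inv_apply', quadChar_inv]
    have hterm : ∀ u : Fin (n + 2) → F, (∑ U : SpecialLinearGroup (Fin (n + 2)) F,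
          if (fun i => U.1 i 0) = u ∧ U.1ᵀ * T * U.1 = border (d 0) 0 0 (diagonal fun i => d i.succ)
          then (1 : ℂ) else 0) =
        (if qform T u = d 0 then 1 else 0) *
          isomConst q (n + 1) (quadChar F ((-1) ^ ((n + 1) / 2) * (T.det / d 0))) := by
      intro u
      split_ifs with hu
      · obtain ⟨V, T', hV, hVu, hT', hVT⟩ := exists_orthogonal_completion hT (hu ▸ hd 0)
        rw [hu] at hVT
        have hdet' : T'.det = T.det / d 0 := by
          have := congrArg det hVT
          rw [det_mul, det_mul, det_transpose, hV, det_border_zero_row, one_mul, mul_one] at this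
          rw [this, mul_div_cancel_left₀ _ (hd 0)]
        rw [isomCount_fiber (hd 0) hV hVu hVT, one_mul, ← hdet']
        refine ih hT' (fun i => hd _) ?_
        rw [hdet', hdet, Fin.prod_univ_succ, mul_div_cancel_left₀ _ (hd 0)]
      · rw [zero_mul]
        refine Finset.sum_eq_zero fun U _ => if_neg ?_
        rintro ⟨rfl, h⟩
        apply hu
        rw [← conj_apply_zero_zero, h]
        rfl
    rw [hsplit, Finset.sum_congr rfl fun u _ => hterm u, ← Finset.sum_mul,
      sum_ite_qform_eq hF T hT hT0, ← hqdef]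
    have hne : (-1 : F) ^ ((n + 1 + 1) / 2) * T.det ≠ 0 :=
      mul_ne_zero (pow_ne_zero _ (neg_ne_zero.2 one_ne_zero)) hT0
    rcases Nat.even_or_odd (n + 1) with hn | hn
    · have h1 : ¬ Even (n + 1 + 1) := by simpa [Nat.even_add_one] using hn
      have h2 : (n + 1 + 1) / 2 = (n + 1) / 2 := by obtain ⟨k, hk⟩ := hn; omega
      rw [reprCorrection, if_neg h1]
      refine isomConst_succ_of_even hq hn (by omega) ?_ ?_ _
      · rw [hδ, h2]
      · rw [hδ, h2.symm]
        linear_combination (quadChar F (d 0) * quadChar F (d 0)) * quadChar_mul_self hne +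
          quadChar_mul_self (hd 0)
    · rw [reprCorrection, if_pos (by exact hn.add_one), if_neg (hd 0)]
      exact isomConst_succ_of_odd hq hn _ _

/-- Conjugating `T` and `S` by a matrix that diagonalizes `S` preserves the count and changes
determinants by a square only. That the answer involves only `det T` reflects the classification of
forms over finite fields by rank and discriminant. -/
theorem isomCount_eq (hF : ringChar F ≠ 2) {n : ℕ} {T S : Matrix (Fin (n + 1)) (Fin (n + 1)) F}
    (hT : Tᵀ = T) (hS : Sᵀ = S) (hT0 : T.det ≠ 0) (h : S.det = T.det) :
    isomCount T S =
      isomConst (Fintype.card F) (n + 1) (quadChar F ((-1) ^ ((n + 1) / 2) * T.det)) := by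
  obtain ⟨V, d, hV, hd⟩ := exists_congr_diagonal (Ring.two_ne_zero hF) S hS
  have hdet : (Vᵀ * T * V).det = ∏ i, d i := by
    rw [← det_diagonal, ← hd, det_mul, det_mul, det_mul, det_mul, h]
  have hdet2 : (Vᵀ * T * V).det = V.det * V.det * T.det := by
    rw [det_mul, det_mul, det_transpose]
    ring
  have hne : ∏ i, d i ≠ 0 := by
    rw [← hdet, hdet2]
    exact mul_ne_zero (mul_ne_zero hV.ne_zero hV.ne_zero) hT0
  rw [← isomCount_conj T S V hV, hd, isomCount_diagonal hF
    (by simp only [transpose_mul, transpose_transpose, hT, Matrix.mul_assoc])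
    (fun i => Finset.prod_ne_zero_iff.1 hne i (Finset.mem_univ i)) hdet, hdet2]
  simp only [map_mul, quadChar_mul_self hV.ne_zero, one_mul]

/-- The sum of `χ(tr T[U])` over `U ∈ SL_n`. -/
def traceCharSum {R : Type*} [CommRing R] [Fintype R] [DecidableEq R] {n : ℕ}
    (T : Matrix (Fin n) (Fin n) R) (χ : MulChar R ℂ) : ℂ :=
  ∑ U : SpecialLinearGroup (Fin n) R, χ (U.1ᵀ * T * U.1).trace

/-- Sort `U` by the matrix `S = T[U]`, which necessarily has the determinant of `T`; all such `S`
have equally many preimages. -/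
theorem traceCharSum_eq (hF : ringChar F ≠ 2) {n : ℕ} {T : Matrix (Fin (n + 1)) (Fin (n + 1)) F}
    (hT : Tᵀ = T) (hT0 : T.det ≠ 0) (χ : MulChar F ℂ) :
    traceCharSum T χ =
      isomConst (Fintype.card F) (n + 1) (quadChar F ((-1) ^ ((n + 1) / 2) * T.det)) *
        ∑ S ∈ symMatrices F (n + 1), (if S.det = T.det then 1 else 0) * χ S.trace := by
  have h1 : traceCharSum T χ = ∑ S ∈ symMatrices F (n + 1), isomCount T S * χ S.trace := by
    simp only [isomCount, Finset.sum_mul, ite_mul, one_mul, zero_mul]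
    rw [Finset.sum_comm, traceCharSum]
    refine Finset.sum_congr rfl fun U _ => ?_
    rw [Finset.sum_ite_eq, if_pos]
    rw [mem_symMatrices]
    simp only [transpose_mul, transpose_transpose, hT, Matrix.mul_assoc]
  rw [h1, Finset.mul_sum]
  refine Finset.sum_congr rfl fun S hS => ?_
  rw [mem_symMatrices] at hS
  split_ifs with h
  · rw [isomCount_eq hF hT hS hT0 h, one_mul]
  · have : isomCount T S = 0 := by
      refine Finset.sum_eq_zero fun U _ => if_neg ?_
      rintro rfl
      apply h
      rw [det_mul, det_mul, det_transpose, U.2, one_mul, mul_one]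
    simp [this]

end

end KM
end

noncomputable section
open Matrix

namespace KM

/-! ### Similitudes of the unit form -/

/-- `J` is an antisymmetric complex structure, so `x + yJ` behaves like the complex number `x + iy`,
of norm `x² + y²`. -/
theorem exists_similitude {F : Type*} [CommRing F] {n : ℕ} (hn : Even n) {a x y : F}
    (h : x ^ 2 + y ^ 2 = a) : ∃ g : Matrix (Fin n) (Fin n) F, g * gᵀ = a • 1 := by
  obtain ⟨k, rfl⟩ := hn
  let e : Fin k ⊕ Fin k ≃ Fin (k + k) := finSumFinEquiv
  let J : Matrix (Fin (k + k)) (Fin (k + k)) F := (Matrix.J (Fin k) F).reindex e e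
  have hJ : Jᵀ = -J := by
    simp only [J, reindex_apply, transpose_submatrix, J_transpose]
    rfl
  have hJ2 : J * J = -1 := by
    simp only [J, reindex_apply, submatrix_mul_equiv, J_squared]
    ext i j
    simp [Matrix.one_apply]
  refine ⟨x • 1 + y • J, ?_⟩
  rw [transpose_add, transpose_smul, transpose_smul, transpose_one, hJ, ← h]
  simp only [Matrix.add_mul, Matrix.mul_add, Matrix.smul_mul, Matrix.mul_smul, Matrix.one_mul,
    Matrix.mul_one, Matrix.mul_neg, hJ2, smul_neg]
  module

/-- Substitute `U ↦ V U g`: the automorphism `V` disappears, and by cyclicity of the trace `g ᵗg =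
a` multiplies the trace by `a`. Only the product of the two determinants has to be one. -/
theorem mul_traceCharSum_of_similitude {R : Type*} [CommRing R] [Fintype R] [DecidableEq R] {n : ℕ}
    {T V g : Matrix (Fin n) (Fin n) R} {a : R} (hV : Vᵀ * T * V = T) (hg : g * gᵀ = a • 1)
    (hdet : V.det * g.det = 1) (χ : MulChar R ℂ) : χ a * traceCharSum T χ = traceCharSum T χ := by
  have hVu : IsUnit V := (isUnit_iff_isUnit_det V).2 (IsUnit.of_mul_eq_one _ hdet)
  have hgu : IsUnit g := (isUnit_iff_isUnit_det g).2
    (IsUnit.of_mul_eq_one V.det (by rw [mul_comm, hdet]))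
  let f : SpecialLinearGroup (Fin n) R → SpecialLinearGroup (Fin n) R := fun U =>
    ⟨V * U.1 * g, by rw [det_mul, det_mul, U.2, mul_one, hdet]⟩
  have hbij : Function.Bijective f := by
    rw [← Finite.injective_iff_bijective]
    intro U U' h
    have := congrArg Subtype.val h
    exact Subtype.ext (hVu.mul_left_cancel (hgu.mul_right_cancel this))
  have hsum := hbij.sum_comp fun U : SpecialLinearGroup (Fin n) R => χ (U.1ᵀ * T * U.1).trace
  rw [traceCharSum, Finset.mul_sum, ← hsum]
  refine Finset.sum_congr rfl fun U _ => ?_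
  have h1 : (V * U.1 * g)ᵀ * T * (V * U.1 * g) = gᵀ * (U.1ᵀ * (Vᵀ * T * V) * U.1 * g) := by
    simp only [transpose_mul, Matrix.mul_assoc]
  have h2 : ((f U).1ᵀ * T * (f U).1).trace = a * (U.1ᵀ * T * U.1).trace := by
    change ((V * U.1 * g)ᵀ * T * (V * U.1 * g)).trace = _
    rw [h1, hV, Matrix.trace_mul_comm, Matrix.mul_assoc, hg, Matrix.mul_smul, Matrix.mul_one,
      trace_smul, smul_eq_mul]
  rw [h2, map_mul]

section PrimeField

variable {p : ℕ} [hp : Fact p.Prime]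

theorem ringChar_zmod_ne_two (h2 : p ≠ 2) : ringChar (ZMod p) ≠ 2 := by
  rwa [ZMod.ringChar_zmod_n]

theorem exists_similitude_det_one {n : ℕ} (hn : 1 ≤ n) {a : ZMod p} (ha : a ^ n = 1) :
    ∃ g : Matrix (Fin n) (Fin n) (ZMod p), g.det = 1 ∧ g * gᵀ = a • 1 := by
  rcases Nat.even_or_odd n with hn' | hn'
  · obtain ⟨x, y, hxy⟩ := ZMod.sq_add_sq p a
    obtain ⟨g, hg⟩ := exists_similitude hn' hxy
    have hd : g.det * g.det = 1 := by
      have := congrArg det hg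
      rwa [det_mul, det_transpose, det_smul, det_one, mul_one, Fintype.card_fin, ha] at this
    -- From `g ᵗg = a` and `a^n = 1` one has `det g = ±1`; `D` is orthogonal of the same determinant
    -- and corrects the sign.
    let D : Matrix (Fin n) (Fin n) (ZMod p) := diagonal (Pi.mulSingle ⟨0, hn⟩ g.det)
    have hD : D * Dᵀ = 1 := by
      rw [diagonal_transpose, diagonal_mul_diagonal']
      have : (Pi.mulSingle ⟨0, hn⟩ g.det : Fin n → ZMod p) * Pi.mulSingle ⟨0, hn⟩ g.det = 1 := by
        rw [← Pi.mulSingle_mul, hd, Pi.mulSingle_one]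
      exact (congrArg diagonal this).trans diagonal_one
    refine ⟨g * D, ?_, ?_⟩
    · rw [det_mul, det_diagonal, Finset.prod_pi_mulSingle']
      simpa using hd
    · rw [transpose_mul, Matrix.mul_assoc, ← Matrix.mul_assoc D, hD, Matrix.one_mul, hg]
  · obtain ⟨k, rfl⟩ := hn'
    -- With `n = 2k + 1` and `a^n = 1`, the scalar `a^(k+1)` is a square root of `a`, and its `n`-th
    -- power is one.
    refine ⟨a ^ (k + 1) • 1, ?_, ?_⟩
    · rw [det_smul, det_one, mul_one, Fintype.card_fin, ← pow_mul, mul_comm, pow_mul, ha, one_pow]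
    · rw [transpose_smul, transpose_one, smul_mul_smul_comm, Matrix.one_mul, ← pow_add]
      congr 1
      have : k + 1 + (k + 1) = 2 * k + 1 + 1 := by ring
      rw [this, pow_succ, ha, one_mul]

/-- Vanishing of the sum when the character is nontrivial on the `n`-torsion. -/
theorem traceCharSum_eq_zero_of_torsion {n : ℕ} (hn : 1 ≤ n) (T : Matrix (Fin n) (Fin n) (ZMod p))
    {χ : MulChar (ZMod p) ℂ} {a : ZMod p} (ha : a ^ n = 1) (hχ : χ a ≠ 1) :
    traceCharSum T χ = 0 := by
  obtain ⟨g, hg1, hg⟩ := exists_similitude_det_one hn ha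
  have := mul_traceCharSum_of_similitude (T := T) (V := 1) (by simp) hg (by simp [hg1]) χ
  exact eq_zero_of_mul_eq_self_left hχ this

/-- A singular `T` has automorphisms of every nonzero determinant, so any similitude `g` can be
used, whatever its determinant. For even `n` every ratio occurs, being a sum of two squares. For odd
`n` scalar matrices give the square ratios, whence the condition on `χ²`; for `n = 1` a singular `T`
is zero. -/
theorem traceCharSum_eq_zero_of_singular {n : ℕ} {T : Matrix (Fin n) (Fin n) (ZMod p)}
    (hT : Tᵀ = T) (hdet : T.det = 0) {χ : MulChar (ZMod p) ℂ} (hχ : χ ≠ 1)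
    (hodd : Odd n → n = 1 ∨ χ ^ 2 ≠ 1) : traceCharSum T χ = 0 := by
  have key : ∀ (g : Matrix (Fin n) (Fin n) (ZMod p)) (a : ZMod p), a ≠ 0 → g * gᵀ = a • 1 →
      χ a ≠ 1 → traceCharSum T χ = 0 := by
    intro g a ha hg hχa
    have hd : g.det ≠ 0 := by
      intro h
      have := congrArg det hg
      rw [det_mul, h, zero_mul, det_smul, det_one, mul_one] at this
      exact pow_ne_zero _ ha this.symm
    obtain ⟨V, hV, hVT⟩ := exists_aut_det_eq hT hdet (g.det)⁻¹
    exact eq_zero_of_mul_eq_self_left hχa (mul_traceCharSum_of_similitude hVT hg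
      (by rw [hV, inv_mul_cancel₀ hd]) χ)
  rcases Nat.even_or_odd n with hn | hn
  · obtain ⟨v, hv⟩ := MulChar.ne_one_iff.1 hχ
    obtain ⟨x, y, hxy⟩ := ZMod.sq_add_sq p (v : ZMod p)
    obtain ⟨g, hg⟩ := exists_similitude hn hxy
    exact key g v v.ne_zero hg hv
  · rcases hodd hn with rfl | h
    · have hT0 : T = 0 := by
        ext i j
        rw [det_fin_one] at hdet
        fin_cases i; fin_cases j
        exact hdet
      simp [traceCharSum, hT0, MulChar.map_zero]
    · obtain ⟨v, hv⟩ := MulChar.ne_one_iff.1 h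
      rw [MulChar.pow_apply_coe, ← map_pow] at hv
      refine key ((v : ZMod p) • 1) _ (pow_ne_zero 2 v.ne_zero) ?_ hv
      rw [transpose_smul, transpose_one, smul_mul_smul_comm, Matrix.one_mul, sq]

/-! ### The local identities -/

theorem mem_torsionChars {N m : ℕ} [NeZero N] {η : DirichletCharacter ℂ N} :
    η ∈ torsionChars N m ↔ η ^ m = 1 := by
  simp [torsionChars]

/-- Detect `det S = d` by the orthogonality relation over all characters `θ`. Scaling `S` kills the
sum of `θ(det S) χ(tr S)` unless `θ^n χ = 1`, that is `θ = (ψη)⁻¹` with `η^n = 1`. Each surviving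
sum carries a factor `p - 1`, which cancels that of the orthogonality relation. -/
theorem sum_det_eq_mulChar_trace {n : ℕ} {χ ψ : DirichletCharacter ℂ p} (hψ : ψ ^ n = χ)
    {d : ZMod p} (hd : d ≠ 0) :
    ∑ S ∈ symMatrices (ZMod p) n, (if S.det = d then (1 : ℂ) else 0) * χ S.trace =
      ∑ η ∈ torsionChars p n, (ψ * η) d * traceSum n (ψ * η)⁻¹ 1 := by
  have hp1 : ((p : ℂ) - 1) ≠ 0 := by
    rw [sub_ne_zero]
    exact_mod_cast hp.out.one_lt.ne'
  have horth : ∀ S : Matrix (Fin n) (Fin n) (ZMod p),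
      ((p : ℂ) - 1) * (if S.det = d then (1 : ℂ) else 0) =
        ∑ θ : DirichletCharacter ℂ p, θ d⁻¹ * θ S.det := by
    intro S
    rw [DirichletCharacter.sum_char_inv_mul_char_eq ℂ (isUnit_iff_ne_zero.2 hd),
      Nat.totient_prime hp.out, Nat.cast_sub hp.out.one_le, Nat.cast_one]
    simp [eq_comm]
  apply mul_left_cancel₀ hp1
  rw [Finset.mul_sum]
  simp only [← mul_assoc, horth, Finset.sum_mul]
  rw [Finset.sum_comm]
  have hθ : ∀ θ : DirichletCharacter ℂ p,
      ∑ S ∈ symMatrices (ZMod p) n, θ d⁻¹ * θ S.det * χ S.trace =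
        if θ ^ n * χ = 1 then θ d⁻¹ * (traceSum n θ 1 * ((p : ℂ) - 1)) else 0 := by
    intro θ
    simp only [mul_assoc, ← Finset.mul_sum]
    rw [sum_symMatrices_mulChar_trace, ZMod.card]
    split_ifs <;> simp
  simp only [hθ]
  rw [← Finset.sum_filter, Finset.mul_sum]
  symm
  refine Finset.sum_bij' (fun η _ => (ψ * η)⁻¹) (fun θ _ => ψ⁻¹ * θ⁻¹) ?_ ?_ ?_ ?_ ?_
  · intro η hη
    rw [mem_torsionChars] at hη
    refine Finset.mem_filter.2 ⟨Finset.mem_univ _, ?_⟩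
    rw [inv_pow, mul_pow, hψ, hη, mul_one, inv_mul_cancel]
  · intro θ hθ
    have := (Finset.mem_filter.1 hθ).2
    rw [mem_torsionChars, mul_pow, inv_pow, inv_pow, hψ, ← mul_inv, mul_comm, this, inv_one]
  · intro η _
    rw [inv_inv, inv_mul_cancel_left]
  · intro θ _
    rw [mul_inv_cancel_left, inv_inv]
  · intro η _
    rw [MulChar.inv_apply', inv_inv]
    ring

theorem jacobiChar_eq_quadChar : jacobiChar p = quadChar (ZMod p) := by
  ext a
  change ((jacobiSym ((a : ZMod p).val : ℤ) p : ℤ) : ℂ) = _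
  rw [quadChar_apply, ← jacobiSym.legendreSym.to_jacobiSym, legendreSym]
  simp

/-- The exponent is shaped for `2k = n - 2` or `n - 1`. As `p` is odd the division by four is exact.
-/
theorem quadChar_neg_one_pow (h2 : p ≠ 2) (k : ℕ) :
    quadChar (ZMod p) ((-1) ^ k) = (-1) ^ (2 * k * (p - 1) / 4) := by
  have hodd : p % 2 = 1 := hp.out.eq_two_or_odd.resolve_left h2
  have h1 : quadChar (ZMod p) (-1) = (-1) ^ (p / 2) := by
    rw [quadChar_apply, quadraticChar_neg_one (ringChar_zmod_ne_two h2), ZMod.card,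
      ZMod.χ₄_eq_neg_one_pow hodd]
    simp
  have h3 : 2 * k * (p - 1) / 4 = p / 2 * k := by
    have : 2 * k * (p - 1) = 4 * (p / 2 * k) := by
      have : p - 1 = 2 * (p / 2) := by omega
      rw [this]
      ring
    omega
  rw [map_pow, h1, h3, pow_mul]

theorem isomConst_one_eq_gammaConst {n : ℕ} :
    isomConst p n (quadChar (ZMod p) ((-1) ^ (n / 2))) = gammaConst n p := by
  have : quadChar (ZMod p) ((-1) ^ (n / 2)) = ((jacobiSym ((-1) ^ (n / 2)) p : ℤ) : ℂ) := by
    rw [quadChar_apply, ← jacobiSym.legendreSym.to_jacobiSym, legendreSym]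
    simp
  rw [isomConst, gammaConst, this]

theorem conj_mulChar {R : Type*} [CommRing R] [Finite R] (θ : MulChar R ℂ) (a : R) :
    (starRingEnd ℂ) (θ a) = θ⁻¹ a := MulChar.star_apply' θ a

theorem conj_jacobiSum (θ ω : MulChar (ZMod p) ℂ) :
    (starRingEnd ℂ) (jacobiSum θ ω) = jacobiSum θ⁻¹ ω⁻¹ := by
  simp only [jacobiSum, map_sum, map_mul, conj_mulChar]

theorem conj_matrixJacobiSum' (m : ℕ) (θ : DirichletCharacter ℂ p) :
    (starRingEnd ℂ) (matrixJacobiSum' m θ) = matrixJacobiSum' m θ⁻¹ := by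
  have h : (jacobiChar p)⁻¹ = jacobiChar p := by rw [jacobiChar_eq_quadChar, quadChar_inv]
  have h' : (jacobiChar p ^ (m - 1))⁻¹ = jacobiChar p ^ (m - 1) := by rw [← inv_pow, h]
  simp only [matrixJacobiSum', matrixJacobiSum, map_sum, map_mul, conj_mulChar, mul_inv, h']

theorem matrixJacobiSum'_eq (m : ℕ) (θ : DirichletCharacter ℂ p) :
    matrixJacobiSum' m θ =
      ∑ Z ∈ symMatrices (ZMod p) m, (if Even m then quadChar (ZMod p) * θ else θ) Z.det *
        θ (1 - Z.trace) := by
  rw [matrixJacobiSum', matrixJacobiSum, jacobiChar_eq_quadChar]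
  refine Finset.sum_congr rfl fun Z _ => ?_
  congr 1
  rcases Nat.even_or_odd m with hm | hm
  · rw [if_pos hm]
    obtain ⟨k, rfl⟩ := hm
    -- In degree zero the exponent `m - 1` truncates to zero, but the empty determinant is one and
    -- the choice of character is immaterial.
    rcases Nat.eq_zero_or_pos k with rfl | hk
    · simp
    · have : k + k - 1 = 2 * (k - 1) + 1 := by omega
      rw [this, pow_succ, pow_mul, quadChar_sq, one_pow, one_mul, mul_comm]
  · rw [if_neg (Nat.not_even_iff_odd.2 hm)]
    obtain ⟨k, rfl⟩ := hm
    rw [Nat.add_sub_cancel, pow_mul, quadChar_sq, one_pow, mul_one]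

/-- Invariance under the quadratic twist is used twice: to bring the trace sum into the shape of the
Jacobi sums of the statement, and to remove the dependence of the group order on `det T`. -/
theorem traceCharSum_of_even (h2 : p ≠ 2) {n : ℕ} (hn : 1 ≤ n) (hev : Even n)
    {χ ψ : DirichletCharacter ℂ p} (hχ : χ ≠ 1) (hψ : ψ ^ n = χ)
    {T : Matrix (Fin n) (Fin n) (ZMod p)} (hT : Tᵀ = T) :
    traceCharSum T χ = (-1 : ℂ) ^ ((n - 2) * (p - 1) / 4) * (p : ℂ) ^ ((n - 2) / 2) *
      gammaConst n p * ∑ η ∈ torsionChars p n,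
        (starRingEnd ℂ) (jacobiSum (ψ * η * jacobiChar p) (jacobiChar p)) *
          (starRingEnd ℂ) (matrixJacobiSum' (n - 1) (ψ * η)) * (ψ * η) T.det := by
  have hF := ringChar_zmod_ne_two h2
  by_cases hdet : T.det = 0
  · rw [traceCharSum_eq_zero_of_singular hT hdet hχ
      (fun h => absurd hev (Nat.not_even_iff_odd.2 h))]
    simp [hdet, MulChar.map_zero]
  obtain ⟨m, rfl⟩ : ∃ m, n = m + 1 := ⟨n - 1, by omega⟩
  have hm : ¬ Even m := by simpa [Nat.even_add_one] using hev
  have hpow : ∀ η ∈ torsionChars p (m + 1), ((ψ * η)⁻¹) ^ (m + 1) ≠ 1 := by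
    intro η hη
    rw [mem_torsionChars] at hη
    rw [inv_pow, mul_pow, hψ, hη, mul_one]
    exact inv_ne_one.2 hχ
  have hA : ∀ η ∈ torsionChars p (m + 1), traceSum (m + 1) (ψ * η)⁻¹ 1 =
      (-1 : ℂ) ^ ((m + 1 - 2) * (p - 1) / 4) * (p : ℂ) ^ ((m + 1 - 2) / 2) *
        ((starRingEnd ℂ) (jacobiSum (ψ * η * jacobiChar p) (jacobiChar p)) *
          (starRingEnd ℂ) (matrixJacobiSum' (m + 1 - 1) (ψ * η))) := by
    intro η hη
    set θ := (ψ * η)⁻¹ with hθ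
    have hθ2 : θ ^ 2 ≠ 1 := by
      intro h
      obtain ⟨k, hk⟩ := hev
      exact hpow η hη (by rw [hk, ← two_mul, pow_mul, h, one_pow])
    -- Replacing `θ` by its twist first makes the recursion return `θ` itself, both on `det Z` and
    -- on `1 - tr Z`, as in the definition of `J_{n-1}(θ)`.
    rw [← traceSum_quadChar_mul hF hev (hpow η hη),
      traceSum_succ hF (ne_one_of_sq_ne_one (quadChar_mul_sq_ne_one hθ2))
        (Or.inr (quadChar_mul_sq_ne_one hθ2)), conj_jacobiSum, conj_matrixJacobiSum',
      matrixJacobiSum'_eq, quadChar_mul_quadChar_mul, jacobiChar_eq_quadChar, mul_inv, quadChar_inv,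
      ← hθ, Nat.add_sub_cancel, quadChar_neg_one_pow h2, ZMod.card, mul_comm θ, jacobiSum_comm]
    obtain ⟨k, hk⟩ := hev
    have h4 : 2 * (m / 2) = m + 1 - 2 := by omega
    have h3 : m / 2 = (m + 1 - 2) / 2 := by omega
    simp only [if_neg hm, h4]
    rw [h3]
    ring
  -- Reindexing by `η ↦ quadChar * η`, a bijection of the `n`-torsion for even `n`, reproduces the
  -- sum with an extra factor `quadChar (det T)`.
  have hS : ∑ S ∈ symMatrices (ZMod p) (m + 1), (if S.det = T.det then (1 : ℂ) else 0) * χ S.trace =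
      quadChar (ZMod p) T.det * ∑ S ∈ symMatrices (ZMod p) (m + 1),
        (if S.det = T.det then (1 : ℂ) else 0) * χ S.trace := by
    rw [sum_det_eq_mulChar_trace hψ hdet, Finset.mul_sum]
    have hmem : ∀ η ∈ torsionChars p (m + 1), quadChar (ZMod p) * η ∈ torsionChars p (m + 1) := by
      intro η hη
      rw [mem_torsionChars] at hη ⊢
      obtain ⟨k, hk⟩ := hev
      rw [mul_pow, hη, mul_one, hk, ← two_mul, pow_mul, quadChar_sq, one_pow]
    symm
    refine Finset.sum_bij' (fun η _ => quadChar (ZMod p) * η) (fun η _ => quadChar (ZMod p) * η)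
      hmem hmem (fun η _ => quadChar_mul_quadChar_mul η) (fun η _ => quadChar_mul_quadChar_mul η) ?_
    intro η hη
    have h5 : ψ * (quadChar (ZMod p) * η) = quadChar (ZMod p) * (ψ * η) := by
      rw [mul_left_comm]
    rw [h5, mul_inv (quadChar (ZMod p)) (ψ * η), quadChar_inv, traceSum_quadChar_mul hF hev (hpow η hη),
      MulChar.mul_apply (quadChar (ZMod p)), mul_assoc]
  rw [traceCharSum_eq hF hT hdet, ← isomConst_one_eq_gammaConst, ZMod.card]
  -- If `quadChar (det T) = -1` the character sum is zero by `hS`, so the discriminant may be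
  -- dropped from the group order in every case.
  have hC : isomConst p (m + 1) (quadChar (ZMod p) ((-1) ^ ((m + 1) / 2) * T.det)) *
      (∑ S ∈ symMatrices (ZMod p) (m + 1), (if S.det = T.det then (1 : ℂ) else 0) * χ S.trace) =
      isomConst p (m + 1) (quadChar (ZMod p) ((-1) ^ ((m + 1) / 2))) *
      ∑ S ∈ symMatrices (ZMod p) (m + 1), (if S.det = T.det then (1 : ℂ) else 0) * χ S.trace := by
    rcases quadChar_eq_or hdet with h | h
    · rw [map_mul, h, mul_one]
    · rw [h] at hS
      have : ∑ S ∈ symMatrices (ZMod p) (m + 1),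
          (if S.det = T.det then (1 : ℂ) else 0) * χ S.trace = 0 := by linear_combination hS / 2
      rw [this, mul_zero, mul_zero]
  rw [hC, sum_det_eq_mulChar_trace hψ hdet, Finset.sum_congr rfl fun η hη => by rw [hA η hη],
    Finset.mul_sum, Finset.mul_sum]
  refine Finset.sum_congr rfl fun η _ => ?_
  ring

theorem traceCharSum_of_odd (h2 : p ≠ 2) {n : ℕ} (hodd : Odd n)
    {χ ψ : DirichletCharacter ℂ p} (hχ : χ ≠ 1) (hχ2 : n = 1 ∨ χ ^ 2 ≠ 1) (hψ : ψ ^ n = χ)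
    {T : Matrix (Fin n) (Fin n) (ZMod p)} (hT : Tᵀ = T) :
    traceCharSum T χ = (-1 : ℂ) ^ ((n - 1) * (p - 1) / 4) * (p : ℂ) ^ ((n - 1) / 2) *
      gammaConst n p * ∑ η ∈ torsionChars p n,
        (starRingEnd ℂ) (matrixJacobiSum' (n - 1) (ψ * η)) * (ψ * η) T.det := by
  have hF := ringChar_zmod_ne_two h2
  by_cases hdet : T.det = 0
  · rw [traceCharSum_eq_zero_of_singular hT hdet hχ (fun _ => hχ2)]
    simp [hdet, MulChar.map_zero]
  obtain ⟨m, rfl⟩ : ∃ m, n = m + 1 := ⟨n - 1, by have := hodd.pos; omega⟩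
  have hm : Even m := by simpa [Nat.odd_add_one] using hodd
  have hA : ∀ η ∈ torsionChars p (m + 1), traceSum (m + 1) (ψ * η)⁻¹ 1 =
      (-1 : ℂ) ^ ((m + 1 - 1) * (p - 1) / 4) * (p : ℂ) ^ ((m + 1 - 1) / 2) *
        (starRingEnd ℂ) (matrixJacobiSum' (m + 1 - 1) (ψ * η)) := by
    intro η hη
    rw [mem_torsionChars] at hη
    have hpow : (ψ * η) ^ (m + 1) = χ := by rw [mul_pow, hψ, hη, mul_one]
    set θ := (ψ * η)⁻¹ with hθ
    have hθ' : θ ^ (m + 1) = χ⁻¹ := by rw [hθ, inv_pow, hpow]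
    have hθ1 : θ ≠ 1 := by
      intro h
      rw [h, one_pow, eq_comm, inv_eq_one] at hθ'
      exact hχ hθ'
    have hθ2 : m = 0 ∨ θ ^ 2 ≠ 1 := by
      refine hχ2.imp (fun h => by omega) fun h h' => h ?_
      rw [← _root_.inv_inj, inv_one, ← inv_pow, ← hθ', ← pow_mul, mul_comm, pow_mul, h', one_pow]
    rw [traceSum_succ hF hθ1 hθ2, conj_matrixJacobiSum', matrixJacobiSum'_eq, ← hθ,
      Nat.add_sub_cancel, quadChar_neg_one_pow h2, ZMod.card]
    have h4 : 2 * (m / 2) = m := Nat.two_mul_div_two_of_even hm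
    simp only [if_pos hm, h4]
    ring
  rw [traceCharSum_eq hF hT hdet, ← isomConst_one_eq_gammaConst, ZMod.card,
    sum_det_eq_mulChar_trace hψ hdet, Finset.sum_congr rfl fun η hη => by rw [hA η hη],
    Finset.mul_sum, Finset.mul_sum]
  -- In odd degree the group order does not depend on the discriminant.
  have hC : ∀ δ δ', isomConst p (m + 1) δ = isomConst p (m + 1) δ' := by
    intro δ δ'
    rw [isomConst, isomConst, if_neg (Nat.not_even_iff_odd.2 hodd),
      if_neg (Nat.not_even_iff_odd.2 hodd)]
  refine Finset.sum_congr rfl fun η _ => ?_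
  rw [hC _ (quadChar (ZMod p) ((-1) ^ ((m + 1) / 2)))]
  ring

end PrimeField

end KM
end

noncomputable section
open Matrix

namespace KM

/-! ### Decomposition along the Chinese remainder theorem -/

section ChineseRemainder

variable {r N : ℕ} [NeZero N] {p : Fin r → ℕ} [∀ i, Fact (p i).Prime]
  (e : ZMod N ≃+* ∀ i, ZMod (p i))

/-- The projection of `ℤ/N` to its factor with index `i`. -/
def crtProj (i : Fin r) : ZMod N →+* ZMod (p i) := (Pi.evalRingHom _ i).comp e.toRingHom

theorem crtProj_apply (i : Fin r) (x : ZMod N) : crtProj e i x = e x i := rfl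

/-- The component with index `i` of a Dirichlet character. -/
def charComp (χ : DirichletCharacter ℂ N) (i : Fin r) : DirichletCharacter ℂ (p i) where
  toFun x := χ (e.symm (Pi.mulSingle i x))
  map_one' := by rw [Pi.mulSingle_one, map_one, map_one]
  map_mul' x y := by rw [Pi.mulSingle_mul, map_mul, map_mul]
  map_nonunit' x hx := by
    apply MulChar.map_nonunit
    intro h
    apply hx
    have := h.map (crtProj e i)
    rwa [crtProj_apply, RingEquiv.apply_symm_apply, Pi.mulSingle_eq_same] at this

theorem charComp_apply (χ : DirichletCharacter ℂ N) (i : Fin r) (x : ZMod (p i)) :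
    charComp e χ i x = χ (e.symm (Pi.mulSingle i x)) := rfl

theorem eq_prod_charComp (χ : DirichletCharacter ℂ N) (x : ZMod N) :
    χ x = ∏ i, charComp e χ i (e x i) := by
  simp only [charComp_apply]
  rw [← map_prod, ← map_prod, Finset.univ_prod_mulSingle, RingEquiv.symm_apply_apply]

/-- The Dirichlet character with given components. -/
def charOfComps (θ : ∀ i, DirichletCharacter ℂ (p i)) : DirichletCharacter ℂ N where
  toFun x := ∏ i, θ i (e x i)
  map_one' := by simp
  map_mul' x y := by simp [Finset.prod_mul_distrib]
  map_nonunit' x hx := by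
    by_contra h
    apply hx
    have h1 : ∀ i, IsUnit (e x i) := by
      intro i
      by_contra hi
      exact h (Finset.prod_eq_zero (Finset.mem_univ i) ((θ i).map_nonunit hi))
    have := (Pi.isUnit_iff.2 h1).map e.symm
    rwa [RingEquiv.symm_apply_apply] at this

theorem charComp_charOfComps (θ : ∀ i, DirichletCharacter ℂ (p i)) (i : Fin r) :
    charComp e (charOfComps e θ) i = θ i := by
  ext a
  rw [charComp_apply]
  change ∏ j, θ j (e (e.symm _) j) = _
  rw [RingEquiv.apply_symm_apply, Finset.prod_eq_single i]
  · rw [Pi.mulSingle_eq_same]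
  · intro j _ hj
    rw [Pi.mulSingle_eq_of_ne hj, map_one]
  · simp

theorem charComp_mul (χ ψ : DirichletCharacter ℂ N) (i : Fin r) :
    charComp e (χ * ψ) i = charComp e χ i * charComp e ψ i := by
  ext a
  simp only [charComp_apply, MulChar.mul_apply]

theorem charComp_one (i : Fin r) : charComp e (1 : DirichletCharacter ℂ N) i = 1 := by
  have h := charComp_mul e 1 1 i
  rwa [mul_one, left_eq_mul] at h

theorem charComp_pow (χ : DirichletCharacter ℂ N) (i : Fin r) (n : ℕ) :
    charComp e (χ ^ n) i = charComp e χ i ^ n := by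
  induction n with
  | zero => rw [pow_zero, pow_zero, charComp_one]
  | succ n ih => rw [pow_succ, pow_succ, charComp_mul, ih]

theorem charComp_ext {χ ψ : DirichletCharacter ℂ N}
    (h : ∀ i, charComp e χ i = charComp e ψ i) : χ = ψ := by
  ext a
  rw [eq_prod_charComp e, eq_prod_charComp e]
  exact Finset.prod_congr rfl fun i _ => by rw [h]

theorem charComp_eq_of_apply {χ : DirichletCharacter ℂ N} {θ : ∀ i, DirichletCharacter ℂ (p i)}
    (h : ∀ x, χ x = ∏ i, θ i (e x i)) (i : Fin r) : charComp e χ i = θ i := by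
  have : χ = charOfComps e θ := by
    ext a
    exact h a
  rw [this, charComp_charOfComps]

theorem sum_pi_eq_prod {κ : Fin r → Type*} [∀ i, Fintype (κ i)] (f : ∀ i, κ i → ℂ) :
    ∑ x : ∀ i, κ i, ∏ i, f i (x i) = ∏ i, ∑ y, f i y := by
  rw [Finset.prod_univ_sum, Fintype.piFinset_univ]

theorem sum_torsionChars_eq_prod (n : ℕ) (f : ∀ i, DirichletCharacter ℂ (p i) → ℂ) :
    ∑ η ∈ torsionChars N n, ∏ i, f i (charComp e η i) =
      ∏ i, ∑ η ∈ torsionChars (p i) n, f i η := by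
  rw [Finset.prod_univ_sum]
  refine Finset.sum_bij' (fun η _ => charComp e η) (fun θ _ => charOfComps e θ) ?_ ?_ ?_ ?_ ?_
  · intro η hη
    rw [mem_torsionChars] at hη
    rw [Fintype.mem_piFinset]
    intro i
    rw [mem_torsionChars, ← charComp_pow, hη, charComp_one]
  · intro θ hθ
    rw [Fintype.mem_piFinset] at hθ
    rw [mem_torsionChars]
    refine charComp_ext e fun i => ?_
    rw [charComp_pow, charComp_charOfComps, charComp_one]
    exact mem_torsionChars.1 (hθ i)
  · intro η _
    exact charComp_ext e fun i => charComp_charOfComps e _ i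
  · intro θ _
    exact funext fun i => charComp_charOfComps e _ i
  · intro η _
    rfl

theorem jacobiSum_eq_prod (χ ψ : DirichletCharacter ℂ N) :
    jacobiSum χ ψ = ∏ i, jacobiSum (charComp e χ i) (charComp e ψ i) := by
  simp only [jacobiSum]
  rw [← sum_pi_eq_prod, ← e.toEquiv.sum_comp]
  refine Finset.sum_congr rfl fun x _ => ?_
  rw [eq_prod_charComp e χ, eq_prod_charComp e ψ, ← Finset.prod_mul_distrib]
  refine Finset.prod_congr rfl fun i _ => ?_
  rw [map_sub, map_one]
  rfl

/-- Matrices over `ℤ/N` and families of matrices over the factors. -/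
def matrixCrt (m : ℕ) :
    Matrix (Fin m) (Fin m) (ZMod N) ≃ ∀ i, Matrix (Fin m) (Fin m) (ZMod (p i)) where
  toFun A i := A.map (crtProj e i)
  invFun B := Matrix.of fun a b => e.symm fun i => B i a b
  left_inv A := by
    ext a b
    exact e.symm_apply_apply _
  right_inv B := by
    funext i
    ext a b
    exact congrFun (e.apply_symm_apply _) i

theorem matrixCrt_apply {m : ℕ} (A : Matrix (Fin m) (Fin m) (ZMod N)) (i : Fin r) :
    matrixCrt e m A i = A.map (crtProj e i) := rfl

theorem det_matrixCrt {m : ℕ} (A : Matrix (Fin m) (Fin m) (ZMod N)) (i : Fin r) :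
    (matrixCrt e m A i).det = e A.det i :=
  ((crtProj e i).map_det A).symm

theorem trace_matrixCrt {m : ℕ} (A : Matrix (Fin m) (Fin m) (ZMod N)) (i : Fin r) :
    (matrixCrt e m A i).trace = e A.trace i := by
  rw [← crtProj_apply, matrixCrt_apply, Matrix.trace, Matrix.trace, map_sum]
  rfl

theorem transpose_matrixCrt {m : ℕ} (A : Matrix (Fin m) (Fin m) (ZMod N)) :
    Aᵀ = A ↔ ∀ i, (matrixCrt e m A i)ᵀ = matrixCrt e m A i := by
  rw [← (matrixCrt e m).injective.eq_iff, funext_iff]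
  rfl

theorem matrixJacobiSum_eq_prod (m : ℕ) (χ ψ : DirichletCharacter ℂ N) :
    matrixJacobiSum m χ ψ = ∏ i, matrixJacobiSum m (charComp e χ i) (charComp e ψ i) := by
  simp only [matrixJacobiSum, Finset.sum_filter]
  rw [← sum_pi_eq_prod, ← (matrixCrt e m).sum_comp]
  refine Finset.sum_congr rfl fun A _ => ?_
  rw [Finset.prod_ite_zero]
  simp only [Finset.mem_univ, true_imp_iff, ← transpose_matrixCrt e A]
  split_ifs
  · rw [eq_prod_charComp e χ, eq_prod_charComp e ψ, ← Finset.prod_mul_distrib]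
    refine Finset.prod_congr rfl fun i _ => ?_
    rw [det_matrixCrt, trace_matrixCrt, map_sub, map_one]
    rfl
  · rfl

/-- `SL_n(ℤ/N)` is the product of the groups `SL_n(F_p)`, and `χ` is the product of its components.
-/
theorem traceCharSum_eq_prod {n : ℕ} (T : Matrix (Fin n) (Fin n) (ZMod N))
    (χ : DirichletCharacter ℂ N) :
    traceCharSum T χ = ∏ i, traceCharSum (matrixCrt e n T i) (charComp e χ i) := by
  simp only [traceCharSum]
  rw [← sum_pi_eq_prod fun i (U : SpecialLinearGroup (Fin n) (ZMod (p i))) =>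
    charComp e χ i (U.1ᵀ * matrixCrt e n T i * U.1).trace]
  let f : SpecialLinearGroup (Fin n) (ZMod N) → ∀ i, SpecialLinearGroup (Fin n) (ZMod (p i)) :=
    fun U i => ⟨matrixCrt e n U.1 i, by rw [det_matrixCrt, U.2, map_one]; rfl⟩
  have hf : Function.Bijective f := by
    constructor
    · intro U U' h
      apply Subtype.ext
      apply (matrixCrt e n).injective
      funext i
      exact congrArg Subtype.val (congrFun h i)
    · intro V
      refine ⟨⟨(matrixCrt e n).symm fun i => (V i).1, ?_⟩, ?_⟩
      · apply e.injective
        funext i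
        rw [← det_matrixCrt, Equiv.apply_symm_apply, (V i).2, map_one]
        rfl
      · funext i
        apply Subtype.ext
        exact congrFun ((matrixCrt e n).apply_symm_apply fun i => (V i).1) i
  rw [← hf.sum_comp]
  refine Finset.sum_congr rfl fun U _ => ?_
  rw [eq_prod_charComp e χ]
  refine Finset.prod_congr rfl fun i _ => ?_
  rw [← trace_matrixCrt]
  simp only [f, matrixCrt_apply, Matrix.map_mul, transpose_map]

theorem jacobiSym_prod_right {ι : Type*} (s : Finset ι) (q : ι → ℕ) (hq : ∀ i ∈ s, q i ≠ 0)
    (a : ℤ) : jacobiSym a (∏ i ∈ s, q i) = ∏ i ∈ s, jacobiSym a (q i) := by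
  classical
  induction s using Finset.induction_on with
  | empty => simp
  | insert i s hi ih =>
    rw [Finset.prod_insert hi, Finset.prod_insert hi, jacobiSym.mul_right' _ (hq i (by simp))
      (Finset.prod_ne_zero_iff.2 fun j hj => hq j (by simp [hj])),
      ih fun j hj => hq j (by simp [hj])]

theorem charComp_jacobiChar (hN : N = ∏ i, p i) (i : Fin r) :
    charComp e (jacobiChar N) i = jacobiChar (p i) := by
  refine charComp_eq_of_apply e (θ := fun i => jacobiChar (p i)) (fun x => ?_) i
  change ((jacobiSym ((x : ZMod N).val : ℤ) N : ℤ) : ℂ) =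
    ∏ i, ((jacobiSym ((e x i).val : ℤ) (p i) : ℤ) : ℂ)
  rw [← Int.cast_prod]
  congr 1
  rw [(congrArg (jacobiSym _) hN).trans
    (jacobiSym_prod_right _ _ (fun i _ => (Fact.out (p := (p i).Prime)).ne_zero) _)]
  refine Finset.prod_congr rfl fun i _ => ?_
  have h : e x i = ((x.val : ℕ) : ZMod (p i)) := by
    conv_lhs => rw [← ZMod.natCast_zmod_val x]
    rw [← crtProj_apply, map_natCast]
  have h2 : (((x.val : ℕ) : ZMod (p i)).val : ℤ) = (x.val : ℤ) % (p i : ℤ) := by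
    rw [ZMod.val_natCast, Int.natCast_mod]
  rw [h, h2, ← jacobiSym.mod_left]

theorem matrixJacobiSum'_eq_prod (hN : N = ∏ i, p i) (m : ℕ) (χ : DirichletCharacter ℂ N) :
    matrixJacobiSum' m χ = ∏ i, matrixJacobiSum' m (charComp e χ i) := by
  rw [matrixJacobiSum', matrixJacobiSum_eq_prod e]
  refine Finset.prod_congr rfl fun i _ => ?_
  rw [charComp_mul, charComp_pow, charComp_jacobiChar e hN, matrixJacobiSum']

theorem traceCharSum_even (hN : N = ∏ i, p i) (h2 : ∀ i, p i ≠ 2) {n : ℕ} (hn : 1 ≤ n)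
    (hev : Even n) {χ ψ : DirichletCharacter ℂ N} (hχ : ∀ i, charComp e χ i ≠ 1) (hψ : ψ ^ n = χ)
    {T : Matrix (Fin n) (Fin n) (ZMod N)} (hT : Tᵀ = T) :
    traceCharSum T χ = (∏ i, (-1 : ℂ) ^ ((n - 2) * (p i - 1) / 4) * (p i : ℂ) ^ ((n - 2) / 2) *
      gammaConst n (p i)) * ∑ η ∈ torsionChars N n,
        (starRingEnd ℂ) (jacobiSum (ψ * η * jacobiChar N) (jacobiChar N)) *
          (starRingEnd ℂ) (matrixJacobiSum' (n - 1) (ψ * η)) * (ψ * η) T.det := by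
  have hT' := (transpose_matrixCrt e T).1 hT
  have hψ' : ∀ i, charComp e ψ i ^ n = charComp e χ i := fun i => by rw [← charComp_pow, hψ]
  rw [traceCharSum_eq_prod e, Finset.prod_congr rfl fun i _ =>
    traceCharSum_of_even (h2 i) hn hev (hχ i) (hψ' i) (hT' i), Finset.prod_mul_distrib,
    ← sum_torsionChars_eq_prod e n]
  congr 1
  refine Finset.sum_congr rfl fun η _ => ?_
  rw [Finset.prod_mul_distrib, Finset.prod_mul_distrib, jacobiSum_eq_prod e,
    matrixJacobiSum'_eq_prod e hN, eq_prod_charComp e, map_prod, map_prod]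
  simp only [charComp_mul, charComp_jacobiChar e hN, det_matrixCrt]

theorem traceCharSum_odd (hN : N = ∏ i, p i) (h2 : ∀ i, p i ≠ 2) {n : ℕ}
    (hodd : Odd n) {χ ψ : DirichletCharacter ℂ N} (hχ : ∀ i, charComp e χ i ≠ 1)
    (hχ2 : n = 1 ∨ ∀ i, charComp e (χ ^ 2) i ≠ 1) (hψ : ψ ^ n = χ)
    {T : Matrix (Fin n) (Fin n) (ZMod N)} (hT : Tᵀ = T) :
    traceCharSum T χ = (∏ i, (-1 : ℂ) ^ ((n - 1) * (p i - 1) / 4) * (p i : ℂ) ^ ((n - 1) / 2) *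
      gammaConst n (p i)) * ∑ η ∈ torsionChars N n,
          (starRingEnd ℂ) (matrixJacobiSum' (n - 1) (ψ * η)) * (ψ * η) T.det := by
  have hT' := (transpose_matrixCrt e T).1 hT
  have hψ' : ∀ i, charComp e ψ i ^ n = charComp e χ i := fun i => by rw [← charComp_pow, hψ]
  have hχ2' : ∀ i, n = 1 ∨ charComp e χ i ^ 2 ≠ 1 := fun i =>
    hχ2.imp id fun h => by rw [← charComp_pow]; exact h i
  rw [traceCharSum_eq_prod e, Finset.prod_congr rfl fun i _ =>
    traceCharSum_of_odd (h2 i) hodd (hχ i) (hχ2' i) (hψ' i) (hT' i), Finset.prod_mul_distrib,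
    ← sum_torsionChars_eq_prod e n]
  congr 1
  refine Finset.sum_congr rfl fun η _ => ?_
  rw [Finset.prod_mul_distrib, matrixJacobiSum'_eq_prod e hN, eq_prod_charComp e, map_prod]
  simp only [charComp_mul, det_matrixCrt]

/-- If the component at `p i` were trivial, `χ` would factor through `N / p i`, which is smaller
than its conductor `N`. -/
theorem charComp_ne_one_of_isPrimitive (hN : N = ∏ i, p i) {χ : DirichletCharacter ℂ N}
    (hχ : χ.IsPrimitive) (i : Fin r) : charComp e χ i ≠ 1 := by
  intro h
  have hp := Fact.out (p := (p i).Prime)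
  have hdvd : N / p i ∣ N := Nat.div_dvd_of_dvd (hN ▸ Finset.dvd_prod_of_mem p (Finset.mem_univ i))
  have hft : χ.FactorsThrough (N / p i) := by
    rw [DirichletCharacter.factorsThrough_iff_ker_unitsMap hdvd]
    intro u hu
    rw [MonoidHom.mem_ker] at hu ⊢
    have hu1 : ((u : ZMod N).val : ZMod (N / p i)) = 1 := by
      have := congrArg Units.val hu
      rw [ZMod.unitsMap_val, Units.val_one] at this
      rw [ZMod.natCast_val]
      exact this
    have hj : ∀ j, j ≠ i → e u j = 1 := by
      intro j hj
      have h1 : e u j = (((u : ZMod N).val : ℕ) : ZMod (p j)) := by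
        conv_lhs => rw [← ZMod.natCast_zmod_val (u : ZMod N)]
        rw [← crtProj_apply, map_natCast]
      have h2 : p j ∣ N / p i := by
        rw [hN, ← Finset.mul_prod_erase _ _ (Finset.mem_univ i), Nat.mul_div_cancel_left _ hp.pos]
        exact Finset.dvd_prod_of_mem p (Finset.mem_erase.2 ⟨hj, Finset.mem_univ j⟩)
      have := congrArg (ZMod.castHom h2 (ZMod (p j))) hu1
      rwa [map_natCast, map_one, ← h1] at this
    rw [Units.ext_iff, MulChar.coe_toUnitHom, Units.val_one, eq_prod_charComp e,
      Finset.prod_eq_one]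
    intro j _
    by_cases hij : j = i
    · subst hij
      rw [h, MulChar.one_apply]
      exact Pi.isUnit_iff.1 (u.isUnit.map e) j
    · rw [hj j hij, map_one]
  have hle := Nat.sInf_le (show N / p i ∈ χ.conductorSet from hft)
  have : χ.conductor = N := hχ
  have hlt : N / p i < N := Nat.div_lt_self (NeZero.pos N) hp.one_lt
  exact absurd (lt_of_le_of_lt hle hlt) this.ge.not_gt

/-- A Dirichlet character is an `n`-th power if it is trivial on the `n`-torsion. -/
theorem exists_pow_eq_of_torsion {n : ℕ} {χ : DirichletCharacter ℂ N}
    (h : ∀ m : (ZMod N)ˣ, m ^ n = 1 → χ m = 1) : ∃ ψ : DirichletCharacter ℂ N, ψ ^ n = χ := by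
  -- By duality between subgroups of `(ℤ/N)ˣ` and of its character group, it suffices that `χ` kills
  -- the annihilator of the group `X` of `n`-th powers. A unit killed by all `ψ^n` has trivial
  -- `n`-th power because characters separate points.
  let X : Subgroup (MulChar (ZMod N) ℂ) := (powMonoidHom n : MulChar (ZMod N) ℂ →* _).range
  have hmem : ∀ m : (ZMod N)ˣ,
      m ∈ (MulChar.subgroupOrderIsoSubgroupMulChar (ZMod N) ℂ).symm (OrderDual.toDual X) →
        m ^ n = 1 := by
    intro m hm
    rw [MulChar.mem_subgroupOrderIsoSubgroupMulChar_symm_iff] at hm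
    by_contra hne
    have hne' : ((m : ZMod N) ^ n) ≠ 1 := by
      intro h'
      exact hne (Units.ext (by simpa using h'))
    obtain ⟨ψ, hψ⟩ := MulChar.exists_apply_ne_one_of_hasEnoughRootsOfUnity (ZMod N) ℂ hne'
    apply hψ
    rw [map_pow, ← MulChar.pow_apply_coe]
    exact hm _ ⟨ψ, rfl⟩
  have : χ ∈ ((MulChar.subgroupOrderIsoSubgroupMulChar (ZMod N) ℂ)
      ((MulChar.subgroupOrderIsoSubgroupMulChar (ZMod N) ℂ).symm (OrderDual.toDual X))).ofDual := by
    rw [MulChar.mem_subgroupOrderIsoSubgroupMulChar_iff]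
    exact fun m hm => h m (hmem m hm)
  rw [OrderIso.apply_symm_apply] at this
  obtain ⟨ψ, hψ⟩ := this
  exact ⟨ψ, hψ⟩

theorem exists_int_modEq {a b : ℤ} (h : IsCoprime a b) (x y : ℤ) :
    ∃ m : ℤ, m ≡ x [ZMOD a] ∧ m ≡ y [ZMOD b] := by
  obtain ⟨u, v, huv⟩ := h
  refine ⟨y * (u * a) + x * (v * b), ?_, ?_⟩
  · refine (Int.modEq_iff_dvd.2 ⟨(x - y) * u, ?_⟩)
    linear_combination (-x) * huv
  · refine (Int.modEq_iff_dvd.2 ⟨(y - x) * v, ?_⟩)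
    linear_combination (-y) * huv

/-- As `N` is squarefree, the integer `m` chosen in `primeComponent` reduces to `a` at `p i` and to
one at the other primes, which is how `charComp` embeds `a`. -/
theorem primeComponent_eq_charComp (hinj : Function.Injective p) (hN : N = ∏ i, p i)
    (χ : DirichletCharacter ℂ N) (i : Fin r) {a : ℤ} (ha : IsUnit (a : ZMod (p i))) :
    primeComponent χ (p i) a = charComp e χ i a := by
  have hp := fun j => Fact.out (p := (p j).Prime)
  have hNi : N = p i * ∏ j ∈ Finset.univ.erase i, p j := by
    rw [hN, Finset.mul_prod_erase _ _ (Finset.mem_univ i)]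
  have hcop : Nat.Coprime (p i) (∏ j ∈ Finset.univ.erase i, p j) := by
    refine Nat.Coprime.prod_right fun j hj => ?_
    exact (Nat.coprime_primes (hp i) (hp j)).2 fun h => (Finset.ne_of_mem_erase hj) (hinj h).symm
  have hfac : N.factorization (p i) = 1 := by
    have hne : (∏ j ∈ Finset.univ.erase i, p j) ≠ 0 :=
      Finset.prod_ne_zero_iff.2 fun j _ => (hp j).ne_zero
    rw [hNi, Nat.factorization_mul (hp i).ne_zero hne, Finsupp.add_apply,
      (hp i).factorization_self, Nat.factorization_eq_zero_of_not_dvd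
      fun h => (hp i).one_lt.ne' ?_]
    exact Nat.Coprime.eq_one_of_dvd hcop h
  have hdiv : N / p i = ∏ j ∈ Finset.univ.erase i, p j := by
    rw [hNi, Nat.mul_div_cancel_left _ (hp i).pos]
  have hcond : IsCoprime a (p i : ℤ) ∧
      ∃ m : ℤ, m ≡ a [ZMOD ((p i ^ N.factorization (p i) : ℕ) : ℤ)] ∧
        m ≡ 1 [ZMOD ((N / p i ^ N.factorization (p i) : ℕ) : ℤ)] := by
    refine ⟨(ZMod.coe_int_isUnit_iff_isCoprime _ _).1 ha |>.symm, ?_⟩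
    rw [hfac, pow_one, hdiv]
    exact exists_int_modEq (Nat.isCoprime_iff_coprime.2 hcop) _ _
  rw [primeComponent, dif_pos hcond]
  obtain ⟨h1, h2⟩ := hcond.2.choose_spec
  set m := hcond.2.choose
  rw [hfac, pow_one] at h1 h2
  rw [eq_prod_charComp e, Finset.prod_eq_single i]
  · rw [← crtProj_apply, map_intCast]
    congr 1
    exact (ZMod.intCast_eq_intCast_iff _ _ _).2 h1
  · intro j _ hj
    have hd : (p j : ℤ) ∣ ((N / p i : ℕ) : ℤ) := by
      rw [hdiv]
      exact_mod_cast Finset.dvd_prod_of_mem p (Finset.mem_erase.2 ⟨hj, Finset.mem_univ j⟩)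
    have h3 : ((m : ℤ) : ZMod (p j)) = ((1 : ℤ) : ZMod (p j)) :=
      (ZMod.intCast_eq_intCast_iff _ _ _).2 (h2.of_dvd hd)
    rw [← crtProj_apply, map_intCast, h3, Int.cast_one, map_one]
  · simp

end ChineseRemainder

end KM
end

noncomputable section
open Matrix

namespace KM

/-! ### Surjectivity of reduction modulo `N` on special linear groups -/

-- The classical identity `diag(a, a⁻¹) = w(a) w(-1)`, where `w(b) = x(b) y(-b⁻¹) x(b)` is a product
-- of upper and lower elementary matrices.
open SpecialLinearGroup in
theorem diag2n_eq_prod_transvection {F ι : Type*} [Field F] [Fintype ι] [DecidableEq ι] {i j : ι}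
    (hij : i ≠ j) {a : F} (ha : a ≠ 0) :
    diag2n hij a ha = transvection hij a * transvection hij.symm (-a⁻¹) * transvection hij a *
      (transvection hij (-1) * transvection hij.symm 1 * transvection hij (-1)) := by
  apply Subtype.ext
  have hneg : ∀ (k l : ι) (c : F), (single k l (-c) : Matrix ι ι F) = -single k l c := by
    intro k l c
    ext x y
    simp only [single_apply, Matrix.neg_apply]
    split_ifs <;> simp
  have h1 : ∀ b : F, b ≠ 0 → (transvection hij b * transvection hij.symm (-b⁻¹) *
      transvection hij b).1 = 1 - single i i 1 - single j j 1 + single i j b - single j i b⁻¹ := by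
    intro b hb
    simp only [Matrix.SpecialLinearGroup.coe_mul, transvection_coe, Matrix.add_mul, Matrix.mul_add, 
      Matrix.mul_one, single_mul_single_same,
      single_mul_single_of_ne _ _ _ _ hij.symm, add_zero,
      hneg, mul_neg, neg_mul, mul_inv_cancel₀ hb, inv_mul_cancel₀ hb, one_mul]
    abel
  have h2 := h1 (-1) (by simp)
  simp only [inv_neg, inv_one, neg_neg] at h2
  rw [Matrix.SpecialLinearGroup.coe_mul _ (_ * _), h1 a ha, h2, diag2n_coe]
  ext k l
  simp only [Matrix.sub_mul, Matrix.mul_sub, Matrix.add_mul, Matrix.mul_add, Matrix.one_mul,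
    single_mul_single_same, single_mul_single_of_ne _ _ _ _ hij,
    single_mul_single_of_ne _ _ _ _ hij.symm, add_zero,
    sub_zero, mul_one, mul_neg]
  by_cases hkl : k = l
  · subst hkl
    by_cases hk : k = i
    · subst hk
      simp [hij.symm]
    · by_cases hk' : k = j
      · subst hk'
        simp [hij, hij.symm]
      · simp [hk, hk', Ne.symm hk, Ne.symm hk']
  · by_cases hk : k = i
    · subst hk
      by_cases hl : l = j
      · subst hl; simp [hij, hij.symm]
      · simp [hkl, Ne.symm hl]
    · by_cases hk' : k = j
      · subst hk'
        by_cases hl : l = i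
        · subst hl; simp [hij, hij.symm]
        · simp [hkl, Ne.symm hl, hij]
      · simp [Ne.symm hk, Ne.symm hk', hkl]

theorem specialLinearGroup_induction_transvection {F ι : Type*} [Field F] [Fintype ι]
    [DecidableEq ι] [Nontrivial ι] (H : Subgroup (SpecialLinearGroup ι F))
    (h : ∀ (i j : ι) (hij : i ≠ j) (c : F), SpecialLinearGroup.transvection hij c ∈ H)
    (A : SpecialLinearGroup ι F) : A ∈ H := by
  refine SpecialLinearGroup.diagonal_transvection_induction' (· ∈ H) A (fun i j hij c hc => ?_) h
    fun _ _ => H.mul_mem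
  rw [diag2n_eq_prod_transvection hij hc]
  exact H.mul_mem (H.mul_mem (H.mul_mem (h _ _ _ _) (h _ _ _ _)) (h _ _ _ _))
    (H.mul_mem (H.mul_mem (h _ _ _ _) (h _ _ _ _)) (h _ _ _ _))

section

variable {r N : ℕ} [NeZero N] {p : Fin r → ℕ} [∀ i, Fact (p i).Prime]

theorem map_transvection {R S ι : Type*} [CommRing R] [CommRing S] [Fintype ι] [DecidableEq ι]
    (f : R →+* S) {i j : ι} (hij : i ≠ j) (c : R) :
    SpecialLinearGroup.map f (SpecialLinearGroup.transvection hij c) =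
      SpecialLinearGroup.transvection hij (f c) := by
  apply Subtype.ext
  ext k l
  simp [SpecialLinearGroup.transvection_coe, Matrix.one_apply, Matrix.single_apply, apply_ite f]

/-- Elementary matrices lift to `ℤ` entry by entry. By the Chinese remainder theorem the entry can
be chosen to vanish at all primes but one, so the image contains every transvection of each factor
`SL_n(F_p)`, and these generate the factor. -/
theorem specialLinearGroup_map_surjective (e : ZMod N ≃+* ∀ i, ZMod (p i)) (n : ℕ) :
    Function.Surjective (SpecialLinearGroup.map (n := Fin n) (Int.castRingHom (ZMod N))) := by
  -- For `n ≤ 1` there are no transvections, but the groups are trivial.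
  rcases subsingleton_or_nontrivial (Fin n) with hn | hn
  · exact fun U => ⟨1, Subsingleton.elim _ _⟩
  let Φ : SpecialLinearGroup (Fin n) (ZMod N) →* ∀ i, SpecialLinearGroup (Fin n) (ZMod (p i)) :=
    MonoidHom.pi fun i => SpecialLinearGroup.map (crtProj e i)
  have hΦ : Function.Injective Φ := by
    intro U U' h
    apply Subtype.ext
    apply (matrixCrt e n).injective
    funext i
    exact congrArg Subtype.val (congrFun h i)
  let H := (SpecialLinearGroup.map (n := Fin n) (Int.castRingHom (ZMod N))).range.map Φ
  have hH : ∀ i (A : SpecialLinearGroup (Fin n) (ZMod (p i))), Pi.mulSingle i A ∈ H := by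
    intro i A
    have := specialLinearGroup_induction_transvection
      (H.comap (MonoidHom.mulSingle (fun i => SpecialLinearGroup (Fin n) (ZMod (p i))) i))
      (fun a b hab c => ?_) A
    · exact this
    · refine ⟨_, ⟨SpecialLinearGroup.transvection hab
        ((e.symm (Pi.single i c)).val : ℤ), rfl⟩, ?_⟩
      have hc : Int.castRingHom (ZMod N) ((e.symm (Pi.single i c)).val : ℤ) =
          e.symm (Pi.single i c) := by simp
      rw [map_transvection, hc]
      funext j
      change SpecialLinearGroup.map (crtProj e j) _ = (Pi.mulSingle i (SpecialLinearGroup.transvection hab c) :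
        ∀ i, SpecialLinearGroup (Fin n) (ZMod (p i))) j
      rw [map_transvection, crtProj_apply, RingEquiv.apply_symm_apply]
      by_cases hj : j = i
      · subst hj
        rw [Pi.single_eq_same, Pi.mulSingle_eq_same]
      · rw [Pi.single_eq_of_ne hj, Pi.mulSingle_eq_of_ne hj,
          SpecialLinearGroup.transvection_coeff_zero]
  intro U
  have hU : Φ U ∈ H := Subgroup.pi_mem_of_mulSingle_mem _ fun i => hH i _
  obtain ⟨_, ⟨V, rfl⟩, hV⟩ := hU
  exact ⟨V, hΦ hV⟩

end

end KM
end

noncomputable section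
open Matrix

namespace KM

/-! ### Bounds for Fourier coefficients -/

-- The coefficient is the inner product of a continuous function on the torus with one of the
-- orthonormal monomials. It is bounded by the `L²` norm, hence by the supremum norm as the measure
-- has mass one.
open UnitAddTorus MeasureTheory in
theorem norm_coeff_le_of_hasSum_exp {d ι : Type*} [Fintype d] {a : ι → ℂ} {κ : ι → d → ℤ}
    (hκ : Function.Injective κ) (ha : Summable a) {B : ℝ} (hB : 0 ≤ B)
    (h : ∀ x : d → ℝ, (∀ i, x i ∈ Set.Ioc (0 : ℝ) 1) → ∀ S,
      HasSum (fun t => a t * Complex.exp (2 * Real.pi * Complex.I * ∑ j, (κ t j : ℂ) * (x j : ℂ))) S →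
      ‖S‖ ≤ B) (t₀ : ι) : ‖a t₀‖ ≤ B := by
  classical
  let μ : Measure (UnitAddTorus d) := Measure.pi fun _ => AddCircle.haarAddCircle
  let b : (d → ℤ) → Lp ℂ 2 μ := fun k => ContinuousMap.toLp (E := ℂ) 2 μ ℂ (mFourier k)
  have hb : Orthonormal ℂ b := orthonormal_mFourier
  have hs : Summable fun t => a t • (mFourier (κ t) : C(UnitAddTorus d, ℂ)) := by
    refine Summable.of_norm ?_
    simpa only [norm_smul, mFourier_norm, mul_one] using ha.norm
  obtain ⟨f, hf⟩ := hs
  have hfB : ‖f‖ ≤ B := by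
    refine (ContinuousMap.norm_le _ hB).2 fun x => ?_
    have hx := (ContinuousMap.evalCLM ℂ x).hasSum hf
    -- Every point of the torus is represented in the cube `(0, 1]^d`, where the bound is assumed.
    choose y hy using fun i => (AddCircle.coe_image_Ioc_eq (1 : ℝ) 0).ge (Set.mem_univ (x i))
    refine h y (fun i => by simpa using (hy i).1) _ ?_
    have hx' : ∀ t, a t * Complex.exp (2 * Real.pi * Complex.I * ∑ j, (κ t j : ℂ) * (y j : ℂ)) =
        ContinuousMap.evalCLM ℂ x (a t • (mFourier (κ t) : C(UnitAddTorus d, ℂ))) := by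
      intro t
      simp only [ContinuousMap.evalCLM_apply, ContinuousMap.smul_apply, mFourier,
        ContinuousMap.coe_mk, smul_eq_mul]
      congr 1
      rw [Finset.mul_sum, Complex.exp_sum]
      refine Finset.prod_congr rfl fun j _ => ?_
      rw [← (hy j).2, fourier_coe_apply]
      congr 1
      push_cast
      ring
    rw [funext hx']
    exact hx
  have h1 := (ContinuousMap.toLp (E := ℂ) 2 μ ℂ).hasSum hf
  have h2 := (innerSL ℂ (b (κ t₀))).hasSum h1
  have h3 : ∀ t, innerSL ℂ (b (κ t₀)) (ContinuousMap.toLp (E := ℂ) 2 μ ℂ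
        (a t • (mFourier (κ t) : C(UnitAddTorus d, ℂ)))) = if t = t₀ then a t₀ else 0 := by
    intro t
    have h4 := (orthonormal_iff_ite.1 hb) (κ t₀) (κ t)
    rw [map_smul, map_smul, innerSL_apply_apply]
    change _ • inner ℂ _ (b (κ t)) = _
    rw [h4]
    by_cases ht : t = t₀
    · simp [ht]
    · simp [ht, hκ.ne (Ne.symm ht)]
  simp only [h3] at h2
  rw [← h2.unique (hasSum_ite_eq t₀ (a t₀)), innerSL_apply_apply]
  refine (norm_inner_le_norm _ _).trans ?_
  rw [hb.1, one_mul]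
  refine (ContinuousLinearMap.le_opNorm _ _).trans ?_
  have h7 : ‖ContinuousMap.toLp (E := ℂ) 2 μ ℂ‖ ≤ 1 := by
    refine (ContinuousMap.toLp_norm_le (p := 2) (E := ℂ) (𝕜 := ℂ) (μ := μ)).trans ?_
    simp [measureUnivNNReal]
  calc _ ≤ 1 * ‖f‖ := by gcongr
    _ ≤ B := by simpa using hfB

end KM
end

noncomputable section
open Matrix

namespace KM

/-! ### Half-integral matrices -/

/-- Upper triangular `B` works. The form `B + Bᵀ` gives access to integral arithmetic: invariance
under `SL_n(ℤ)`, reduction modulo `N` and the parity of the determinant. -/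
theorem isHalfIntegral_iff {n : ℕ} {T : Matrix (Fin n) (Fin n) ℝ} :
    IsHalfIntegral T ↔ ∃ B : Matrix (Fin n) (Fin n) ℤ, (2 : ℝ) • T = (B + Bᵀ).map Int.cast := by
  constructor
  · rintro ⟨hs, hd, ho⟩
    choose d hd using hd
    choose b hb using ho
    refine ⟨Matrix.of fun i j => if i = j then d i else if i < j then b i j else 0, ?_⟩
    ext i j
    have hij : T i j = T j i := by rw [← hs.apply]
    rcases lt_trichotomy i j with h | h | h
    · simp [h, h.ne, h.ne', h.not_gt, hb]
    · subst h
      simp [hd, two_mul]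
    · simp [h, h.ne, h.ne', h.not_gt, ← hb, hij]
  · rintro ⟨B, hB⟩
    have h2 : ∀ i j, 2 * T i j = (B i j : ℝ) + B j i := fun i j => by
      simpa using congrFun (congrFun hB i) j
    refine ⟨?_, fun i => ⟨B i i, ?_⟩, fun i j => ⟨B i j + B j i, ?_⟩⟩
    · ext i j
      have h3 := h2 i j
      have h4 := h2 j i
      simp only [transpose_apply]
      linarith
    · linarith [h2 i i]
    · push_cast
      exact h2 i j

theorem map_intCast_mul_real {l m n : Type*} [Fintype m] (A : Matrix l m ℤ) (B : Matrix m n ℤ) :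
    (A * B).map (Int.cast : ℤ → ℝ) = A.map (Int.cast : ℤ → ℝ) * B.map (Int.cast : ℤ → ℝ) :=
  Matrix.map_mul (f := Int.castRingHom ℝ)

theorem toComplex_mul {n : ℕ} (A B : Matrix (Fin n) (Fin n) ℤ) :
    toComplex (A * B) = toComplex A * toComplex B :=
  Matrix.map_mul (f := Int.castRingHom ℂ)

theorem toComplex_one {n : ℕ} : toComplex (1 : Matrix (Fin n) (Fin n) ℤ) = 1 :=
  Matrix.map_one _ Int.cast_zero Int.cast_one

theorem toComplex_zero {n : ℕ} : toComplex (0 : Matrix (Fin n) (Fin n) ℤ) = 0 :=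
  Matrix.map_zero _ Int.cast_zero

theorem toComplex_transpose {n : ℕ} (A : Matrix (Fin n) (Fin n) ℤ) :
    toComplex Aᵀ = (toComplex A)ᵀ := rfl

theorem toComplex_det {n : ℕ} (A : Matrix (Fin n) (Fin n) ℤ) : (toComplex A).det = (A.det : ℂ) :=
  ((Int.castRingHom ℂ).map_det A).symm

theorem two_smul_act {n : ℕ} {T : Matrix (Fin n) (Fin n) ℝ} {B : Matrix (Fin n) (Fin n) ℤ}
    (hB : (2 : ℝ) • T = (B + Bᵀ).map Int.cast) (U : SpecialLinearGroup (Fin n) ℤ) :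
    (2 : ℝ) • act T U = (U.1ᵀ * B * U.1 + (U.1ᵀ * B * U.1)ᵀ).map Int.cast := by
  have h : U.1ᵀ * B * U.1 + (U.1ᵀ * B * U.1)ᵀ = U.1ᵀ * (B + Bᵀ) * U.1 := by
    simp only [transpose_mul, transpose_transpose, Matrix.mul_add, Matrix.add_mul, Matrix.mul_assoc]
  have hc : ∀ A : Matrix (Fin n) (Fin n) ℝ, (2 : ℝ) • (Aᵀ * T * A) = Aᵀ * ((2 : ℝ) • T) * A := by
    intro A
    rw [Matrix.mul_smul, Matrix.smul_mul]
  rw [h, map_intCast_mul_real, map_intCast_mul_real, ← hB, act, hc]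
  rfl

theorem IsHalfIntegral.act {n : ℕ} {T : Matrix (Fin n) (Fin n) ℝ} (hT : IsHalfIntegral T)
    (U : SpecialLinearGroup (Fin n) ℤ) : IsHalfIntegral (act T U) := by
  obtain ⟨B, hB⟩ := isHalfIntegral_iff.1 hT
  exact isHalfIntegral_iff.2 ⟨_, two_smul_act hB U⟩

theorem det_map_intCast {n : ℕ} (U : SpecialLinearGroup (Fin n) ℤ) :
    (U.1.map (Int.cast : ℤ → ℝ)).det = 1 := by
  have := (Int.castRingHom ℝ).map_det U.1
  rw [U.2] at this
  simpa using this.symm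

theorem det_act {n : ℕ} (T : Matrix (Fin n) (Fin n) ℝ) (U : SpecialLinearGroup (Fin n) ℤ) :
    (act T U).det = T.det := by
  simp [act, det_mul, det_transpose, det_map_intCast]

theorem posSemidef_act {n : ℕ} {T : Matrix (Fin n) (Fin n) ℝ} (hT : T.PosSemidef)
    (U : SpecialLinearGroup (Fin n) ℤ) : (act T U).PosSemidef := by
  simpa [act, conjTranspose_eq_transpose_of_trivial] using
    hT.conjTranspose_mul_mul_same (U.1.map (Int.cast : ℤ → ℝ))

theorem posDef_act {n : ℕ} {T : Matrix (Fin n) (Fin n) ℝ} (hT : T.PosDef)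
    (U : SpecialLinearGroup (Fin n) ℤ) : (act T U).PosDef := by
  have h := hT.conjTranspose_mul_mul_same (B := U.1.map (Int.cast : ℤ → ℝ))
    (mulVec_injective_of_isUnit ((isUnit_iff_isUnit_det _).2 (by simp [det_map_intCast])))
  simpa [act, conjTranspose_eq_transpose_of_trivial] using h

/-- The action of `SL_n(ℤ)` on positive semi-definite half-integral matrices. -/
def actSemi {n : ℕ} (T : SemiHalf n) (U : SpecialLinearGroup (Fin n) ℤ) : SemiHalf n :=
  ⟨act T.1 U, T.2.1.act U, posSemidef_act T.2.2 U⟩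

/-- The action of `SL_n(ℤ)` on positive definite half-integral matrices. -/
def actPos {n : ℕ} (T : PosHalf n) (U : SpecialLinearGroup (Fin n) ℤ) : PosHalf n :=
  ⟨act T.1 U, T.2.1.act U, posDef_act T.2.2 U⟩

/-- The action of a fixed matrix as a permutation. -/
def actSemiEquiv {n : ℕ} (U : SpecialLinearGroup (Fin n) ℤ) : SemiHalf n ≃ SemiHalf n where
  toFun T := actSemi T U
  invFun T := actSemi T U⁻¹
  left_inv T := Subtype.ext <| by simp [actSemi, ← act_mul, act_one]
  right_inv T := Subtype.ext <| by simp [actSemi, ← act_mul, act_one]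

/-! ### Fourier expansions -/

/-- The point `X + iY`. -/
def complexPoint {n : ℕ} (X Y : Matrix (Fin n) (Fin n) ℝ) : Matrix (Fin n) (Fin n) ℂ :=
  X.map Complex.ofReal + Complex.I • Y.map Complex.ofReal

theorem complexPoint_mem {n : ℕ} {X Y : Matrix (Fin n) (Fin n) ℝ} (hX : Xᵀ = X) (hY : Y.PosDef) :
    complexPoint X Y ∈ siegelUpperHalfSpace n := by
  have hY' : Yᵀ = Y := by simpa [conjTranspose_eq_transpose_of_trivial] using hY.isHermitian.eq
  constructor
  · simp [Matrix.IsSymm, complexPoint, ← transpose_map, hX, hY']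
  · convert hY
    ext i j
    simp [complexPoint]

theorem map_im_complexPoint {n : ℕ} (X Y : Matrix (Fin n) (Fin n) ℝ) :
    (complexPoint X Y).map Complex.im = Y := by
  ext i j
  simp [complexPoint]

theorem complexPoint_re_im {n : ℕ} (Z : Matrix (Fin n) (Fin n) ℂ) :
    complexPoint (Z.map Complex.re) (Z.map Complex.im) = Z := by
  ext i j
  simp [complexPoint, mul_comm Complex.I, Complex.re_add_im]

theorem fourierExp_complexPoint {n : ℕ} (T X Y : Matrix (Fin n) (Fin n) ℝ) :
    fourierExp T (complexPoint X Y) = Complex.exp (2 * Real.pi * Complex.I * ((T * X).trace : ℝ)) *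
      Real.exp (-2 * Real.pi * (T * Y).trace) := by
  have h : ∀ A : Matrix (Fin n) (Fin n) ℝ,
      (T.map Complex.ofReal * A.map Complex.ofReal).trace = ((T * A).trace : ℂ) := by
    intro A
    simp [Matrix.trace, Matrix.mul_apply]
  rw [fourierExp, complexPoint, Matrix.mul_add, Matrix.mul_smul, trace_add, trace_smul, h, h,
    Complex.ofReal_exp, ← Complex.exp_add]
  congr 1
  push_cast
  rw [smul_eq_mul]
  linear_combination (2 * Real.pi * ((T * Y).trace : ℂ)) * Complex.I_mul_I

theorem norm_fourierExp {n : ℕ} (T : Matrix (Fin n) (Fin n) ℝ) (Z : Matrix (Fin n) (Fin n) ℂ) :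
    ‖fourierExp T Z‖ = Real.exp (-2 * Real.pi * (T * Z.map Complex.im).trace) := by
  conv_lhs => rw [← complexPoint_re_im Z]
  rw [fourierExp_complexPoint, norm_mul, Complex.norm_real, Real.norm_eq_abs, Real.abs_exp]
  have : (2 * Real.pi * Complex.I * ((T * Z.map Complex.re).trace : ℝ) : ℂ) =
      ((2 * Real.pi * (T * Z.map Complex.re).trace : ℝ) : ℂ) * Complex.I := by push_cast; ring
  rw [this, Complex.norm_exp_ofReal_mul_I, one_mul]

theorem norm_coeff_mul_exp_le {n : ℕ} (d : SemiHalf n → ℂ) (Y : Matrix (Fin n) (Fin n) ℝ)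
    {B : ℝ} (hB : 0 ≤ B)
    (h : ∀ X : Matrix (Fin n) (Fin n) ℝ, Xᵀ = X → (∀ i j, |X i j| ≤ 2) →
      ∃ S, HasSum (fun T : SemiHalf n => d T * fourierExp T.1 (complexPoint X Y)) S ∧ ‖S‖ ≤ B)
    (T₀ : SemiHalf n) : ‖d T₀‖ * Real.exp (-2 * Real.pi * (T₀.1 * Y).trace) ≤ B := by
  have key := norm_coeff_le_of_hasSum_exp (d := Fin n × Fin n)
    (a := fun T : SemiHalf n => d T * (Real.exp (-2 * Real.pi * (T.1 * Y).trace) : ℂ))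
    (κ := fun T ij => ⌊2 * T.1 ij.1 ij.2⌋) (B := B) ?_ ?_ hB ?_ T₀
  · rwa [norm_mul, Complex.norm_real, Real.norm_eq_abs, Real.abs_exp] at key
  · intro T T' hTT
    apply Subtype.ext
    ext i j
    obtain ⟨b, hb⟩ := T.2.1.2.2 i j
    obtain ⟨b', hb'⟩ := T'.2.1.2.2 i j
    have := congrFun hTT (i, j)
    simp only [hb, hb', Int.floor_intCast] at this
    subst this
    linarith
  · obtain ⟨S, hS, -⟩ := h 0 (by simp) (by simp)
    refine hS.summable.congr fun T => ?_
    simp [fourierExp_complexPoint]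
  · intro x hx S hS
    -- Parametrizing real parts as `A + Aᵀ` with a free matrix `A` turns `tr(TX)` into `∑ 2 T_ij
    -- x_ij`, with integral frequencies `2 T_ij` that determine `T`. Entries of `A` in `(0, 1]`
    -- account for the bound two.
    let A : Matrix (Fin n) (Fin n) ℝ := Matrix.of fun i j => x (j, i)
    obtain ⟨S', hS', hB'⟩ := h (A + Aᵀ) (by simp [add_comm]) (fun i j => by
      have h1 := hx (i, j)
      have h2 := hx (j, i)
      simp only [Set.mem_Ioc] at h1 h2
      simp only [A, Matrix.add_apply, transpose_apply, Matrix.of_apply]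
      rw [abs_le]
      constructor <;> linarith)
    suffices S = S' by rw [this]; exact hB'
    refine hS.unique ?_
    convert hS' using 2 with T
    rw [fourierExp_complexPoint, mul_assoc, mul_comm (Complex.exp _)]
    congr 3
    have h1 : (T.1 * (A + Aᵀ)).trace = 2 * (T.1 * A).trace := by
      have h2 : (T.1 * Aᵀ).trace = (T.1 * A).trace := by
        rw [← trace_transpose, transpose_mul, transpose_transpose, T.2.1.1.eq, trace_mul_comm]
      rw [Matrix.mul_add, trace_add, h2]
      ring
    rw [h1]
    simp only [Matrix.trace, Matrix.mul_apply, diag_apply, A, Matrix.of_apply, Finset.mul_sum,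
      Fintype.sum_prod_type, Complex.ofReal_sum]
    refine Finset.sum_congr rfl fun i _ => Finset.sum_congr rfl fun j _ => ?_
    obtain ⟨b, hb⟩ := T.2.1.2.2 i j
    rw [← mul_assoc, hb, Int.floor_intCast]
    have hb' : (2 : ℂ) * (T.1 i j : ℂ) = b := by exact_mod_cast congrArg Complex.ofReal hb
    push_cast
    linear_combination (-(2 * Real.pi * Complex.I * (x (i, j) : ℂ))) * hb'

/-! ### Invariance of the Fourier coefficients -/

namespace SiegelModularForm

variable {n k : ℕ} (F : SiegelModularForm n k)

theorem hasSum_coeff {Z : Matrix (Fin n) (Fin n) ℂ} (hZ : Z ∈ siegelUpperHalfSpace n) :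
    HasSum (fun T : SemiHalf n => F.coeff T * fourierExp T.1 Z) (F.toFun Z) :=
  F.fourier.choose_spec Z hZ

theorem toFun_conj (U : SpecialLinearGroup (Fin n) ℤ) {Z : Matrix (Fin n) (Fin n) ℂ}
    (hZ : Z ∈ siegelUpperHalfSpace n) :
    F.toFun (toComplex U.1 * Z * (toComplex U.1)ᵀ) = F.toFun Z := by
  have hU : U.1 * U⁻¹.1 = 1 := by
    rw [← Matrix.SpecialLinearGroup.coe_mul, mul_inv_cancel, Matrix.SpecialLinearGroup.coe_one]
  have hM : fromBlocks U.1 0 0 (U⁻¹.1)ᵀ ∈ symplecticGroup (Fin n) ℤ := by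
    rw [SymplecticGroup.fromBlocks_mem_iff]
    refine ⟨by simp, by simp, ?_⟩
    rw [← transpose_mul, transpose_zero, Matrix.zero_mul, sub_zero, ← Matrix.SpecialLinearGroup.coe_mul,
      inv_mul_cancel, Matrix.SpecialLinearGroup.coe_one, transpose_one]
  have h := F.automorphic _ hM Z hZ
  have hi : (toComplex (U⁻¹.1)ᵀ)⁻¹ = (toComplex U.1)ᵀ := by
    apply inv_eq_left_inv
    rw [← toComplex_transpose, ← toComplex_mul, ← transpose_mul,
      ← Matrix.SpecialLinearGroup.coe_mul, inv_mul_cancel, Matrix.SpecialLinearGroup.coe_one,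
      transpose_one, toComplex_one]
  have hd : (toComplex (U⁻¹.1)ᵀ).det = 1 := by
    rw [toComplex_det, det_transpose, U⁻¹.2, Int.cast_one]
  simpa only [toBlocks_fromBlocks₁₁, toBlocks_fromBlocks₁₂, toBlocks_fromBlocks₂₁,
    toBlocks_fromBlocks₂₂, toComplex_zero, Matrix.zero_mul, add_zero, zero_add, hi, hd, one_pow, one_mul]
    using h

/-- Uniqueness of Fourier coefficients applied to `F(U Z ᵗU) = F(Z)`; no automorphy factor appears
since `det U = 1`. -/
theorem coeff_actSemi (T : SemiHalf n) (U : SpecialLinearGroup (Fin n) ℤ) :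
    F.coeff (actSemi T U) = F.coeff T := by
  have key : ∀ S : SemiHalf n, F.coeff ((actSemiEquiv U).symm S) - F.coeff S = 0 := by
    intro S
    -- Here `Y` is the identity matrix and `le_rfl` sets the bound `B` to zero: the difference of
    -- the two expansions sums to zero everywhere.
    have h := norm_coeff_mul_exp_le
      (fun S => F.coeff ((actSemiEquiv U).symm S) - F.coeff S) 1 le_rfl ?_ S
    · have h1 := norm_nonneg (F.coeff ((actSemiEquiv U).symm S) - F.coeff S)
      have h2 := Real.exp_pos (-2 * Real.pi * (S.1 * 1).trace)
      rw [← norm_eq_zero]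
      nlinarith
    · intro X hX _
      have hZ := complexPoint_mem hX PosDef.one
      set Z := complexPoint X 1
      have hU : (toComplex U.1)ᵀ = (U.1.map (Int.cast : ℤ → ℝ))ᵀ.map Complex.ofReal := by
        ext; simp [toComplex]
      have hU' : toComplex U.1 = (U.1.map (Int.cast : ℤ → ℝ)).map Complex.ofReal := by
        ext; simp [toComplex]
      have hm : ∀ A B : Matrix (Fin n) (Fin n) ℝ, (A * B).map Complex.ofReal =
          A.map Complex.ofReal * B.map Complex.ofReal := fun A B =>
        Matrix.map_mul (f := Complex.ofRealHom)
      have hZ' : toComplex U.1 * Z * (toComplex U.1)ᵀ ∈ siegelUpperHalfSpace n := by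
        constructor
        · have := hZ.1.eq
          simp [Matrix.IsSymm, Matrix.transpose_mul, this, Matrix.mul_assoc]
        · have e : (toComplex U.1 * Z * (toComplex U.1)ᵀ).map Complex.im =
              U.1.map (Int.cast : ℤ → ℝ) * Z.map Complex.im * (U.1.map (Int.cast : ℤ → ℝ))ᵀ := by
            ext i j
            simp [toComplex, Matrix.mul_apply, Finset.sum_mul]
          rw [e]
          have hu : IsUnit (U.1.map (Int.cast : ℤ → ℝ)) :=
            (isUnit_iff_isUnit_det _).2 (by simp [det_map_intCast])
          simpa [conjTranspose_eq_transpose_of_trivial] using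
            hZ.2.mul_mul_conjTranspose_same (B := U.1.map (Int.cast : ℤ → ℝ))
              (vecMul_injective_of_isUnit hu)
      have h1 := F.hasSum_coeff hZ'
      rw [F.toFun_conj U hZ] at h1
      have h2 : ∀ T : SemiHalf n, fourierExp T.1 (toComplex U.1 * Z * (toComplex U.1)ᵀ) =
          fourierExp (actSemiEquiv U T).1 Z := by
        intro T
        rw [fourierExp, fourierExp]
        congr 2
        change _ = ((act T.1 U).map Complex.ofReal * Z).trace
        rw [act, hm, hm, ← hU, ← hU', ← Matrix.mul_assoc, trace_mul_comm]
        simp only [Matrix.mul_assoc]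
      simp only [h2] at h1
      rw [← (actSemiEquiv U).symm.hasSum_iff] at h1
      refine ⟨0, ?_, by simp⟩
      have h3 := h1.sub (F.hasSum_coeff hZ)
      rw [sub_self] at h3
      have h5 : ∀ S : SemiHalf n, (F.coeff ((actSemiEquiv U).symm S) - F.coeff S) * fourierExp S.1 Z =
          ((fun T => F.coeff T * fourierExp (actSemiEquiv U T).1 Z) ∘ (actSemiEquiv U).symm) S -
            F.coeff S * fourierExp S.1 Z := by
        intro S
        rw [Function.comp_apply, (actSemiEquiv U).apply_symm_apply, sub_mul]
      rw [funext h5]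
      exact h3
  have := key (actSemi T U)
  have h4 : (actSemiEquiv U).symm (actSemi T U) = T := (actSemiEquiv U).symm_apply_apply T
  rw [h4] at this
  exact (sub_eq_zero.1 this).symm

end SiegelModularForm

end KM
end

noncomputable section
open Matrix

namespace KM

/-! ### Reduction theory of positive definite quadratic forms -/

/-- A minimum up to a factor two replaces an attained minimum in both reduction arguments, so a
positive lower bound suffices and no discreteness is needed. -/
theorem exists_forall_le_two_mul {ι : Type*} [Nonempty ι] (f : ι → ℝ) {b : ℝ} (hb : 0 < b)
    (h : ∀ i, b ≤ f i) : ∃ i, ∀ j, f i ≤ 2 * f j := by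
  have hbdd : BddBelow (Set.range f) := ⟨b, by rintro _ ⟨i, rfl⟩; exact h i⟩
  have hpos : 0 < iInf f := hb.trans_le (le_ciInf h)
  obtain ⟨i, hi⟩ := exists_lt_of_ciInf_lt (show iInf f < 2 * iInf f by linarith)
  exact ⟨i, fun j => hi.le.trans (by linarith [ciInf_le hbdd j])⟩

theorem qform_single {R ι : Type*} [CommRing R] [Fintype ι] [DecidableEq ι] (S : Matrix ι ι R) (i : ι) :
    qform S (Pi.single i 1) = S i i := by
  simp [qform]

theorem qform_pos {n : ℕ} {Y : Matrix (Fin n) (Fin n) ℝ} (hY : Y.PosDef) {x : Fin n → ℝ}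
    (hx : x ≠ 0) : 0 < qform Y x :=
  hY.dotProduct_mulVec_pos hx

theorem transpose_eq_of_posDef {n : ℕ} {Y : Matrix (Fin n) (Fin n) ℝ} (hY : Y.PosDef) : Yᵀ = Y := by
  simpa [conjTranspose_eq_transpose_of_trivial] using hY.isHermitian.eq

theorem posDef_of_qform_pos {n : ℕ} {Y : Matrix (Fin n) (Fin n) ℝ} (hY : Yᵀ = Y)
    (h : ∀ x, x ≠ 0 → 0 < qform Y x) : Y.PosDef :=
  PosDef.of_dotProduct_mulVec_pos
    (by simpa [IsHermitian, conjTranspose_eq_transpose_of_trivial] using hY)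
    fun x hx => h x hx

theorem qform_act {n : ℕ} (Y : Matrix (Fin n) (Fin n) ℝ) (U : SpecialLinearGroup (Fin n) ℤ)
    (x : Fin n → ℝ) : qform (act Y U) x = qform Y (U.1.map Int.cast *ᵥ x) :=
  qform_conj _ _ _

theorem exists_mul_sum_sq_le_qform {n : ℕ} {Y : Matrix (Fin n) (Fin n) ℝ} (hY : Y.PosDef) :
    ∃ b > 0, ∀ x, b * ∑ i, x i ^ 2 ≤ qform Y x := by
  obtain ⟨V, d, hV, hd⟩ := exists_congr_diagonal two_ne_zero Y (transpose_eq_of_posDef hY)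
  have hVi : Function.Injective V.mulVec :=
    mulVec_injective_of_isUnit ((isUnit_iff_isUnit_det _).2 hV)
  have hdpos : ∀ i, 0 < d i := by
    intro i
    have h1 : qform (Vᵀ * Y * V) (Pi.single i 1) = d i := by
      rw [hd, qform_single, diagonal_apply_eq]
    rw [← h1, qform_conj]
    refine qform_pos hY fun h => ?_
    have := hVi (h.trans (mulVec_zero V).symm)
    simpa using congrFun this i
  -- The constant from Cauchy–Schwarz, `(∑ V_ij y_j)² ≤ (∑ V_ij²/d_j)(∑ d_j y_j²)`. It is zero in
  -- degree zero, hence `K + 1` below.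
  let K := ∑ i, ∑ j, V i j ^ 2 / d j
  have hK : 0 ≤ K := Finset.sum_nonneg fun i _ => Finset.sum_nonneg fun j _ =>
    div_nonneg (sq_nonneg _) (hdpos j).le
  refine ⟨1 / (K + 1), by positivity, fun x => ?_⟩
  obtain ⟨y, rfl⟩ : ∃ y, x = V *ᵥ y :=
    ⟨V⁻¹ *ᵥ x, by rw [mulVec_mulVec, mul_nonsing_inv _ hV, one_mulVec]⟩
  rw [← qform_conj, hd, qform_diagonal, one_div, inv_mul_le_iff₀ (by positivity)]
  have hq : 0 ≤ ∑ j, d j * y j ^ 2 :=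
    Finset.sum_nonneg fun j _ => mul_nonneg (hdpos j).le (sq_nonneg _)
  have h1 : ∑ i, (V *ᵥ y) i ^ 2 ≤ K * ∑ j, d j * y j ^ 2 := by
    rw [Finset.sum_mul]
    refine Finset.sum_le_sum fun i _ => ?_
    refine Finset.sum_sq_le_sum_mul_sum_of_sq_le_mul Finset.univ (r := fun j => V i j * y j)
      (fun j _ => div_nonneg (sq_nonneg _) (hdpos j).le)
      (fun j _ => mul_nonneg (hdpos j).le (sq_nonneg _)) fun j _ => ?_
    have := (hdpos j).ne'
    refine le_of_eq ?_
    field_simp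
  nlinarith

theorem qform_border {m : ℕ} (a : ℝ) (b : Fin m → ℝ) (W : Matrix (Fin m) (Fin m) ℝ)
    (x : Fin (m + 1) → ℝ) :
    qform ((border 1 b 0 1)ᵀ * border a 0 0 W * border 1 b 0 1) x =
      a * (x 0 + b ⬝ᵥ Fin.tail x) ^ 2 + qform W (Fin.tail x) := by
  rw [qform_conj]
  simp only [qform, dotProduct, mulVec, Fin.sum_univ_succ, border_zero_zero, border_zero_succ,
    border_succ_zero, border_succ_succ, Pi.zero_apply, zero_mul, add_zero, zero_add, one_mul,
    Finset.sum_const_zero, Matrix.one_apply, ite_mul, Finset.sum_ite_eq, Finset.mem_univ, if_true,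
    Fin.tail]
  ring

theorem det_border_conj {m : ℕ} (a : ℝ) (b : Fin m → ℝ) (W : Matrix (Fin m) (Fin m) ℝ) :
    ((border 1 b 0 1)ᵀ * border a 0 0 W * border 1 b 0 1).det = a * W.det := by
  rw [det_mul, det_mul, det_transpose, det_border_zero_col, det_border_zero_col]
  simp

/-- Completing the square. -/
theorem exists_border_conj {m : ℕ} {Y : Matrix (Fin (m + 1)) (Fin (m + 1)) ℝ} (hY : Y.PosDef) :
    ∃ (b : Fin m → ℝ) (W : Matrix (Fin m) (Fin m) ℝ), W.PosDef ∧
      Y = (border 1 b 0 1)ᵀ * border (Y 0 0) 0 0 W * border 1 b 0 1 := by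
  have hs := transpose_eq_of_posDef hY
  have ha : 0 < Y 0 0 := hY.diag_pos
  let b : Fin m → ℝ := fun j => Y 0 j.succ / Y 0 0
  let W : Matrix (Fin m) (Fin m) ℝ := Matrix.of fun i j => Y i.succ j.succ - Y 0 0 * (b i * b j)
  have hYW : Y = (border 1 b 0 1)ᵀ * border (Y 0 0) 0 0 W * border 1 b 0 1 := by
    rw [transpose_border, border_mul, border_mul]
    refine border_ext ?_ (fun j => ?_) (fun i => ?_) fun i j => ?_
    · simp
    · simp [b]
      field_simp
    · simp [b, W]
      rw [mul_div_cancel₀ _ ha.ne']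
      exact congrFun (congrFun hs 0) i.succ
    · simp [vecMulVec_apply, W]
  refine ⟨b, W, ?_, hYW⟩
  refine posDef_of_qform_pos ?_ fun x hx => ?_
  · ext i j
    have := congrFun (congrFun hs i.succ) j.succ
    simp only [transpose_apply] at this
    simp [W, this, mul_comm (b i)]
  · have h := qform_pos hY (x := Fin.cons (-(b ⬝ᵥ x)) x) fun h => hx (by
      funext i
      simpa using congrFun h i.succ)
    rw [hYW, qform_border] at h
    simpa using h

/-- Integral column operations on a bordered matrix. -/
def borderSL {m : ℕ} (t : Fin m → ℤ) (U : SpecialLinearGroup (Fin m) ℤ) :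
    SpecialLinearGroup (Fin (m + 1)) ℤ :=
  ⟨border 1 t 0 U.1, by rw [det_border_zero_col, U.2, one_mul]⟩

/-- In the coordinates of the completed square, `U` reduces the complement `W` while `t` translates
the row `b`; the two can be adjusted independently and `a` stays fixed. -/
theorem act_border {m : ℕ} (a : ℝ) (b : Fin m → ℝ) (W : Matrix (Fin m) (Fin m) ℝ) (t : Fin m → ℤ)
    (U : SpecialLinearGroup (Fin m) ℤ) :
    act ((border 1 b 0 1)ᵀ * border a 0 0 W * border 1 b 0 1) (borderSL t U) =
      (border 1 (fun j => (t j : ℝ) + (b ᵥ* U.1.map Int.cast) j) 0 1)ᵀ * border a 0 0 (act W U) *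
        border 1 (fun j => (t j : ℝ) + (b ᵥ* U.1.map Int.cast) j) 0 1 := by
  have h1 : (borderSL t U).1.map (Int.cast : ℤ → ℝ) =
      border 1 (fun j => (t j : ℝ)) 0 (U.1.map Int.cast) := by
    refine border_ext ?_ (fun j => ?_) (fun i => ?_) fun i j => ?_ <;> simp [borderSL]
  have h2 : border a 0 0 (act W U) = (border 1 0 0 (U.1.map (Int.cast : ℤ → ℝ)))ᵀ *
      border a 0 0 W * border 1 0 0 (U.1.map (Int.cast : ℤ → ℝ)) := by
    simp [transpose_border, border_mul, act]
  have h3 : border 1 b 0 1 * border 1 (fun j => (t j : ℝ)) 0 (U.1.map (Int.cast : ℤ → ℝ)) =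
      border 1 0 0 (U.1.map (Int.cast : ℤ → ℝ)) *
        border 1 (fun j => (t j : ℝ) + (b ᵥ* U.1.map Int.cast) j) 0 1 := by
    simp only [border_mul]
    refine border_ext ?_ (fun j => ?_) (fun i => ?_) fun i j => ?_ <;> simp
  rw [act, h1, h2]
  simp only [Matrix.mul_assoc]
  rw [h3]
  simp only [← Matrix.mul_assoc, ← transpose_mul]
  simp only [Matrix.mul_assoc]
  rw [h3, transpose_mul]

/-- Two transvections send `e_0` to `e_0 + e_j` and then to `e_j`. This makes every diagonal entry a
corner entry of an equivalent form, comparable with the minimal one. -/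
theorem exists_mulVec_single {m : ℕ} (j : Fin m) : ∃ P : SpecialLinearGroup (Fin (m + 1)) ℤ,
    P.1.map (Int.cast : ℤ → ℝ) *ᵥ Pi.single 0 1 = Pi.single j.succ 1 := by
  have h : j.succ ≠ (0 : Fin (m + 1)) := Fin.succ_ne_zero j
  refine ⟨SpecialLinearGroup.transvection h.symm (-1) * SpecialLinearGroup.transvection h 1, ?_⟩
  rw [Matrix.SpecialLinearGroup.coe_mul, map_intCast_mul_real, ← mulVec_mulVec]
  have h1 : ∀ (k l : Fin (m + 1)) (hkl : k ≠ l) (c : ℤ) (x : Fin (m + 1) → ℝ),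
      (SpecialLinearGroup.transvection hkl c).1.map (Int.cast : ℤ → ℝ) *ᵥ x =
        x + Pi.single k (c * x l) := by
    intro k l hkl c x
    rw [SpecialLinearGroup.transvection_coe]
    ext i
    simp [Matrix.mulVec, dotProduct, Matrix.one_apply, Matrix.single_apply, add_mul,
      Finset.sum_add_distrib, Pi.single_apply, ite_and, eq_comm]
  rw [h1, h1]
  ext i
  refine Fin.cases ?_ (fun i => ?_) i
  · simp [h, h.symm]
  · simp [Pi.single_apply, Fin.succ_inj]

/-- The corner entry is the value of the form at the first column of `V`, a nonzero integral vector.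
-/
theorem act_zero_zero_pos {m : ℕ} {Y : Matrix (Fin (m + 1)) (Fin (m + 1)) ℝ} (hY : Y.PosDef) :
    ∃ b > 0, ∀ V : SpecialLinearGroup (Fin (m + 1)) ℤ, b ≤ act Y V 0 0 := by
  obtain ⟨b, hb, h⟩ := exists_mul_sum_sq_le_qform hY
  refine ⟨b, hb, fun V => ?_⟩
  rw [← qform_single (act Y V) 0, qform_act]
  refine le_trans ?_ (h _)
  have h1 : V.1.map (Int.cast : ℤ → ℝ) *ᵥ Pi.single 0 1 = fun i => (V.1 i 0 : ℝ) := by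
    ext i; simp
  rw [h1]
  obtain ⟨i, hi⟩ : ∃ i, V.1 i 0 ≠ 0 := by
    by_contra! hc
    have := det_eq_zero_of_column_eq_zero 0 hc
    rw [V.2] at this
    exact one_ne_zero this
  have h2 : (1 : ℝ) ≤ (V.1 i 0 : ℝ) ^ 2 := by
    have : (1 : ℤ) ≤ V.1 i 0 ^ 2 := by
      have := sq_pos_of_ne_zero hi
      omega
    exact_mod_cast this
  have h3 := Finset.single_le_sum (f := fun i => (V.1 i 0 : ℝ) ^ 2) (fun i _ => sq_nonneg _)
    (Finset.mem_univ i)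
  nlinarith

/-- The induction step of reduction: since `|β j| ≤ 1/2` and `a ≤ 4 w j`, expanding the completed
square costs only a constant. With `P = ∑ w_j x_j²`, the cross terms give `a s² ≤ 2a(s + β·x)² +
2mP` and the diagonal terms at most `2P`, whence the denominator `2m + 2`. -/
theorem reduced_step {m : ℕ} {a c : ℝ} (ha : 0 < a) (hc : 0 < c) {β : Fin m → ℝ}
    (hβ : ∀ j, |β j| ≤ 1 / 2) {w : Fin m → ℝ} (hw : ∀ j, a ≤ 4 * w j) (x : Fin m → ℝ) (s q : ℝ)
    (hq : c * ∑ j, w j * x j ^ 2 ≤ q) :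
    min (1 / 2) (c / (2 * m + 2)) * (a * s ^ 2 + ∑ j, (a * β j ^ 2 + w j) * x j ^ 2) ≤
      a * (s + β ⬝ᵥ x) ^ 2 + q := by
  set P := ∑ j, w j * x j ^ 2
  set δ := min (1 / 2) (c / (2 * m + 2)) with hδ
  have hδ0 : 0 < δ := lt_min (by norm_num) (by positivity)
  have hδ1 : δ ≤ 1 / 2 := min_le_left _ _
  have hδ2 : δ * (2 * m + 2) ≤ c := by
    rw [← le_div_iff₀ (by positivity)]
    exact min_le_right _ _
  have hβ2 : ∀ j, β j ^ 2 ≤ 1 / 4 := fun j => by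
    have := abs_le.1 (hβ j)
    nlinarith [this.1, this.2]
  have h1 : ∑ j, (a * β j ^ 2 + w j) * x j ^ 2 ≤ 2 * P := by
    rw [Finset.mul_sum]
    refine Finset.sum_le_sum fun j _ => ?_
    rw [← mul_assoc]
    refine mul_le_mul_of_nonneg_right ?_ (sq_nonneg _)
    nlinarith [hw j, hβ2 j]
  have h2 : a * ∑ j, x j ^ 2 ≤ 4 * P := by
    rw [Finset.mul_sum, Finset.mul_sum]
    refine Finset.sum_le_sum fun j _ => ?_
    rw [← mul_assoc]
    exact mul_le_mul_of_nonneg_right (hw j) (sq_nonneg _)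
  have h3 : (β ⬝ᵥ x) ^ 2 ≤ (m / 4) * ∑ j, x j ^ 2 := by
    refine (Finset.sum_mul_sq_le_sq_mul_sq _ _ _).trans ?_
    refine mul_le_mul_of_nonneg_right ?_ (Finset.sum_nonneg fun _ _ => sq_nonneg _)
    refine (Finset.sum_le_card_nsmul _ _ (1 / 4) fun j _ => hβ2 j).trans ?_
    simp
    linarith
  have h4 : s ^ 2 ≤ 2 * (s + β ⬝ᵥ x) ^ 2 + 2 * (β ⬝ᵥ x) ^ 2 := by
    nlinarith [sq_nonneg (s + 2 * β ⬝ᵥ x)]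
  have hP : 0 ≤ P := Finset.sum_nonneg fun j _ =>
    mul_nonneg (by linarith [hw j]) (sq_nonneg _)
  have h5 : a * s ^ 2 ≤ 2 * (a * (s + β ⬝ᵥ x) ^ 2) + 2 * m * P := by
    have h6 : a * (β ⬝ᵥ x) ^ 2 ≤ m * P := by
      calc a * (β ⬝ᵥ x) ^ 2 ≤ a * ((m / 4) * ∑ j, x j ^ 2) := by gcongr
        _ = (m / 4) * (a * ∑ j, x j ^ 2) := by ring
        _ ≤ (m / 4) * (4 * P) := by gcongr
        _ = m * P := by ring
    nlinarith
  have h7 : 0 ≤ a * (s + β ⬝ᵥ x) ^ 2 := by positivity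
  calc δ * (a * s ^ 2 + ∑ j, (a * β j ^ 2 + w j) * x j ^ 2)
      ≤ δ * (2 * (a * (s + β ⬝ᵥ x) ^ 2) + (2 * m + 2) * P) := by
        refine mul_le_mul_of_nonneg_left ?_ hδ0.le
        linarith
    _ = 2 * δ * (a * (s + β ⬝ᵥ x) ^ 2) + δ * (2 * m + 2) * P := by ring
    _ ≤ 1 * (a * (s + β ⬝ᵥ x) ^ 2) + c * P := by
        have h8 : 2 * δ * (a * (s + β ⬝ᵥ x) ^ 2) ≤ 1 * (a * (s + β ⬝ᵥ x) ^ 2) :=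
          mul_le_mul_of_nonneg_right (by linarith) h7
        exact add_le_add h8 (mul_le_mul_of_nonneg_right hδ2 hP)
    _ ≤ _ := by linarith

/-- Hermite–Minkowski reduction by induction on the degree: make the corner `a` almost minimal,
complete the square, reduce the complement and round the row to `|β j| ≤ 1/2`. Almost-minimality
gives `a ≤ 2(aβ_j² + w_j)`, hence `a ≤ 4 w_j`. Then each new diagonal entry is at most `2 w_j`,
which explains `2^m`. -/
theorem exists_reduced (n : ℕ) : ∃ C > 0, ∃ c > 0, ∀ Y : Matrix (Fin n) (Fin n) ℝ, Y.PosDef →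
    ∃ U : SpecialLinearGroup (Fin n) ℤ, ∏ i, act Y U i i ≤ C * Y.det ∧
      ∀ x, c * ∑ i, act Y U i i * x i ^ 2 ≤ qform (act Y U) x := by
  induction n with
  | zero =>
    refine ⟨1, one_pos, 1, one_pos, fun Y _ => ⟨1, by simp, fun x => by simp [qform]⟩⟩
  | succ m ih =>
    obtain ⟨C, hC, c, hc, h⟩ := ih
    refine ⟨2 ^ m * C, by positivity, min (1 / 2) (c / (2 * m + 2)),
      lt_min (by norm_num) (by positivity), fun Y hY => ?_⟩
    obtain ⟨b₀, hb₀, hlow⟩ := act_zero_zero_pos hY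
    obtain ⟨V, hV⟩ := exists_forall_le_two_mul _ hb₀ hlow
    have hYV := posDef_act hY V
    obtain ⟨b, W, hW, hdec⟩ := exists_border_conj hYV
    have ha : 0 < act Y V 0 0 := hYV.diag_pos
    set a := act Y V 0 0
    obtain ⟨U, hU1, hU2⟩ := h W hW
    let t : Fin m → ℤ := fun j => -round ((b ᵥ* U.1.map Int.cast) j)
    let β : Fin m → ℝ := fun j => (t j : ℝ) + (b ᵥ* U.1.map Int.cast) j
    have hβ : ∀ j, |β j| ≤ 1 / 2 := by
      intro j
      have := abs_sub_round ((b ᵥ* U.1.map (Int.cast : ℤ → ℝ)) j)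
      simp only [β, t, Int.cast_neg]
      rwa [neg_add_eq_sub]
    have hS : act Y (V * borderSL t U) =
        (border 1 β 0 1)ᵀ * border a 0 0 (act W U) * border 1 β 0 1 := by
      rw [act_mul, hdec]
      exact act_border a b W t U
    set w : Fin m → ℝ := fun j => act W U j j
    have hq : ∀ x, qform (act Y (V * borderSL t U)) x =
        a * (x 0 + β ⬝ᵥ Fin.tail x) ^ 2 + qform (act W U) (Fin.tail x) := fun x => by
      rw [hS, qform_border]
    have h0 : act Y (V * borderSL t U) 0 0 = a := by
      rw [← qform_single (act Y _) 0, hq]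
      have : Fin.tail (Pi.single 0 1 : Fin (m + 1) → ℝ) = 0 := by
        ext i; simp [Fin.tail]
      simp [this, qform]
    have hs : ∀ j : Fin m, act Y (V * borderSL t U) j.succ j.succ = a * β j ^ 2 + w j := by
      intro j
      rw [← qform_single (act Y _) j.succ, hq]
      have : Fin.tail (Pi.single j.succ 1 : Fin (m + 1) → ℝ) = Pi.single j 1 := by
        ext i; simp [Fin.tail, Pi.single_apply, Fin.succ_inj]
      rw [this, qform_single]
      simp [Fin.succ_ne_zero, w]
    have hmin : ∀ j, a ≤ 2 * (a * β j ^ 2 + w j) := by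
      intro j
      obtain ⟨P, hP⟩ := exists_mulVec_single j
      have h1 : act Y (V * borderSL t U * P) 0 0 = a * β j ^ 2 + w j := by
        rw [← hs j, act_mul, ← qform_single (act _ P) 0, qform_act, hP, qform_single]
      rw [← h1]
      exact hV _
    have hβ2 : ∀ j, β j ^ 2 ≤ 1 / 4 := fun j => by
      have := abs_le.1 (hβ j)
      nlinarith [this.1, this.2]
    have hw : ∀ j, a ≤ 4 * w j := fun j => by nlinarith [hmin j, hβ2 j]
    refine ⟨V * borderSL t U, ?_, fun x => ?_⟩
    · have hdet : Y.det = a * W.det := by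
        rw [← det_act Y V, hdec, det_border_conj]
      rw [Fin.prod_univ_succ, h0, hdet]
      simp only [hs]
      calc a * ∏ j, (a * β j ^ 2 + w j) ≤ a * ∏ j, (2 * w j) := by
            gcongr with j _
            · intro j _
              nlinarith [hw j, sq_nonneg (β j)]
            · nlinarith [hw j, hβ2 j]
        _ = 2 ^ m * (a * ∏ j, w j) := by
            rw [Finset.prod_mul_distrib]
            simp
            ring
        _ ≤ 2 ^ m * (a * (C * W.det)) := by gcongr
        _ = 2 ^ m * C * (a * W.det) := by ring
    · rw [Fin.sum_univ_succ, h0, hq]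
      simp only [hs]
      exact reduced_step ha hc hβ hw (Fin.tail x) (x 0) _ (hU2 _)

/-- Monotonicity of the determinant on positive definite matrices. -/
theorem det_le_det_of_posSemidef_sub {n : ℕ} {A B : Matrix (Fin n) (Fin n) ℝ} (hA : A.PosDef)
    (hAB : ∀ x, qform A x ≤ qform B x) (hB : Bᵀ = B) : A.det ≤ B.det := by
  obtain ⟨V, d, hV, hd⟩ := exists_congr_diagonal two_ne_zero A (transpose_eq_of_posDef hA)
  have hVi : Function.Injective V.mulVec :=
    mulVec_injective_of_isUnit ((isUnit_iff_isUnit_det _).2 hV)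
  have hdpos : ∀ i, 0 < d i := by
    intro i
    have h1 : qform (Vᵀ * A * V) (Pi.single i 1) = d i := by
      rw [hd, qform_single, diagonal_apply_eq]
    rw [← h1, qform_conj]
    refine qform_pos hA fun h => ?_
    have := hVi (h.trans (mulVec_zero V).symm)
    simpa using congrFun this i
  -- `R` normalizes `A` to the identity. In these coordinates `B` dominates the identity, so its
  -- eigenvalues are at least one.
  let R := V * diagonal fun i => (√(d i))⁻¹
  have hR : Rᵀ * A * R = 1 := by
    have : Rᵀ * A * R = (diagonal fun i => (√(d i))⁻¹) * (Vᵀ * A * V) *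
        diagonal fun i => (√(d i))⁻¹ := by
      simp only [R, transpose_mul, diagonal_transpose, Matrix.mul_assoc]
    rw [this, hd, diagonal_mul_diagonal, diagonal_mul_diagonal, ← diagonal_one]
    congr 1
    ext i
    have h1 := Real.sq_sqrt (hdpos i).le
    have h2 := Real.sqrt_pos.2 (hdpos i)
    field_simp
    linarith
  have hRdet : R.det ^ 2 * A.det = 1 := by
    have := congrArg det hR
    rw [det_mul, det_mul, det_transpose, det_one] at this
    linear_combination this
  let M := Rᵀ * B * R
  have hM : M.IsHermitian := by
    simp [IsHermitian, M, conjTranspose_eq_transpose_of_trivial, transpose_mul, hB,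
      Matrix.mul_assoc]
  have hMx : ∀ x, x ⬝ᵥ x ≤ qform M x := by
    intro x
    have h1 : x ⬝ᵥ x = qform (Rᵀ * A * R) x := by rw [hR, qform, one_mulVec]
    rw [h1, qform_conj, qform_conj]
    exact hAB _
  have heig : ∀ i, 1 ≤ hM.eigenvalues i := by
    intro i
    rw [hM.eigenvalues_eq]
    have h1 := hMx (hM.eigenvectorBasis i)
    have h2 : (hM.eigenvectorBasis i : Fin n → ℝ) ⬝ᵥ hM.eigenvectorBasis i = 1 := by
      have := hM.eigenvectorBasis.orthonormal.1 i
      have h3 := EuclideanSpace.real_norm_sq_eq (hM.eigenvectorBasis i)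
      rw [this] at h3
      simp only [dotProduct, ← pow_two]
      rw [← h3, one_pow]
    rw [h2] at h1
    simpa [qform] using h1
  have hdetM : 1 ≤ M.det := by
    rw [hM.det_eq_prod_eigenvalues]
    exact Finset.one_le_prod fun i _ => by simpa using heig i
  have : M.det = R.det ^ 2 * B.det := by
    simp only [M, det_mul, det_transpose]
    ring
  have hR2 : 0 < R.det ^ 2 := by
    have := hA.det_pos
    by_contra hcon
    nlinarith
  rw [this, ← hRdet] at hdetM
  exact le_of_mul_le_mul_left hdetM hR2

end KM
end

noncomputable section
open Matrix

namespace KM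

/-! ### The action of the symplectic group on the upper half space -/

variable {n : ℕ}

/-- The numerator `AZ + B`. -/
def num (M : Matrix (Fin n ⊕ Fin n) (Fin n ⊕ Fin n) ℤ) (Z : Matrix (Fin n) (Fin n) ℂ) :
    Matrix (Fin n) (Fin n) ℂ :=
  toComplex M.toBlocks₁₁ * Z + toComplex M.toBlocks₁₂

/-- The denominator `CZ + D`. -/
def den (M : Matrix (Fin n ⊕ Fin n) (Fin n ⊕ Fin n) ℤ) (Z : Matrix (Fin n) (Fin n) ℂ) :
    Matrix (Fin n) (Fin n) ℂ :=
  toComplex M.toBlocks₂₁ * Z + toComplex M.toBlocks₂₂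

/-- The fractional linear transformation `(AZ + B)(CZ + D)⁻¹`. -/
def moebius (M : Matrix (Fin n ⊕ Fin n) (Fin n ⊕ Fin n) ℤ) (Z : Matrix (Fin n) (Fin n) ℂ) :
    Matrix (Fin n) (Fin n) ℂ :=
  num M Z * (den M Z)⁻¹

theorem SiegelModularForm.toFun_moebius {k : ℕ} (F : SiegelModularForm n k)
    {M : Matrix (Fin n ⊕ Fin n) (Fin n ⊕ Fin n) ℤ} (hM : M ∈ symplecticGroup (Fin n) ℤ)
    {Z : Matrix (Fin n) (Fin n) ℂ} (hZ : Z ∈ siegelUpperHalfSpace n) :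
    F.toFun (moebius M Z) = (den M Z).det ^ k * F.toFun Z :=
  F.automorphic M hM Z hZ

theorem toComplex_add (A B : Matrix (Fin n) (Fin n) ℤ) :
    toComplex (A + B) = toComplex A + toComplex B := by
  ext; simp [toComplex]

theorem toComplex_sub (A B : Matrix (Fin n) (Fin n) ℤ) :
    toComplex (A - B) = toComplex A - toComplex B := by
  ext; simp [toComplex]

section symplectic

variable {M : Matrix (Fin n ⊕ Fin n) (Fin n ⊕ Fin n) ℤ}

theorem symplectic_relations (hM : M ∈ symplecticGroup (Fin n) ℤ) :
    M.toBlocks₁₁ᵀ * M.toBlocks₂₁ = M.toBlocks₂₁ᵀ * M.toBlocks₁₁ ∧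
    M.toBlocks₁₂ᵀ * M.toBlocks₂₂ = M.toBlocks₂₂ᵀ * M.toBlocks₁₂ ∧
    M.toBlocks₁₁ᵀ * M.toBlocks₂₂ - M.toBlocks₂₁ᵀ * M.toBlocks₁₂ = 1 := by
  rw [← fromBlocks_toBlocks M] at hM
  exact SymplecticGroup.fromBlocks_mem_iff.1 hM

theorem symplectic_relations' (hM : M ∈ symplecticGroup (Fin n) ℤ) :
    M.toBlocks₂₁ * M.toBlocks₂₂ᵀ = M.toBlocks₂₂ * M.toBlocks₂₁ᵀ ∧
    M.toBlocks₁₁ * M.toBlocks₂₂ᵀ - M.toBlocks₁₂ * M.toBlocks₂₁ᵀ = 1 := by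
  have h := SymplecticGroup.transpose_mem hM
  rw [← fromBlocks_toBlocks M, fromBlocks_transpose] at h
  have := SymplecticGroup.fromBlocks_mem_iff.1 h
  simp only [transpose_transpose] at this
  exact this.2

/-- The basic identity of the symplectic action: `W = Z` gives the symmetry of the image point, and
`W = Zᴴ` its imaginary part and the invertibility of the denominator. -/
theorem den_transpose_mul_num_sub (hM : M ∈ symplecticGroup (Fin n) ℤ)
    {W Z : Matrix (Fin n) (Fin n) ℂ} (hW : Wᵀ = W) :
    (den M W)ᵀ * num M Z - (num M W)ᵀ * den M Z = Z - W := by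
  obtain ⟨h1, h2, h3⟩ := symplectic_relations hM
  have e1 := congrArg toComplex h1
  have e2 := congrArg toComplex h2
  have e3 := congrArg toComplex h3
  have e4 := congrArg (fun A => toComplex Aᵀ) h3
  simp only [transpose_sub, transpose_mul, transpose_transpose, toComplex_mul, toComplex_sub,
    toComplex_one, toComplex_transpose, transpose_one] at e1 e2 e3 e4
  simp only [den, num, transpose_add, transpose_mul, hW]
  set A := toComplex M.toBlocks₁₁
  set B := toComplex M.toBlocks₁₂
  set C := toComplex M.toBlocks₂₁
  set D := toComplex M.toBlocks₂₂
  have : (W * Cᵀ + Dᵀ) * (A * Z + B) - (W * Aᵀ + Bᵀ) * (C * Z + D) =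
      W * (Cᵀ * A - Aᵀ * C) * Z - W * (Aᵀ * D - Cᵀ * B) + (Dᵀ * A - Bᵀ * C) * Z +
        (Dᵀ * B - Bᵀ * D) := by noncomm_ring
  rw [this, e1, e2, e3, e4]
  simp
  abel

end symplectic

theorem star_dotProduct_map_mulVec {Y : Matrix (Fin n) (Fin n) ℝ} (hY : Yᵀ = Y) (v : Fin n → ℂ) :
    star v ⬝ᵥ (Y.map Complex.ofReal *ᵥ v) =
      ((qform Y (fun i => (v i).re) + qform Y (fun i => (v i).im) : ℝ) : ℂ) := by
  have hs : ∀ i j, Y j i = Y i j := fun i j => congrFun (congrFun hY i) j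
  have h1 : ∑ i, ∑ j, (v i).im * (Y i j * (v j).re) = ∑ i, ∑ j, (v i).re * (Y i j * (v j).im) := by
    rw [Finset.sum_comm]
    refine Finset.sum_congr rfl fun i _ => Finset.sum_congr rfl fun j _ => ?_
    rw [hs]
    ring
  simp only [qform, dotProduct, mulVec, Finset.mul_sum]
  apply Complex.ext
  · simp [Finset.sum_add_distrib, Complex.mul_re, Complex.mul_im]
  · simp [Finset.sum_add_distrib, Complex.mul_re, Complex.mul_im, h1]

theorem sub_conjTranspose {Z : Matrix (Fin n) (Fin n) ℂ} (hZ : Zᵀ = Z) :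
    Z - Zᴴ = (2 * Complex.I) • (Z.map Complex.im).map Complex.ofReal := by
  ext i j
  have : Z j i = Z i j := congrFun (congrFun hZ i) j
  apply Complex.ext <;> simp [this, two_mul]
  ring

theorem transpose_eq_of_mem {Z : Matrix (Fin n) (Fin n) ℂ} (hZ : Z ∈ siegelUpperHalfSpace n) :
    Zᵀ = Z := hZ.1.eq

theorem conjTranspose_toComplex (A : Matrix (Fin n) (Fin n) ℤ) :
    (toComplex A)ᴴ = (toComplex A)ᵀ := by
  ext; simp [toComplex]

theorem den_conj (M : Matrix (Fin n ⊕ Fin n) (Fin n ⊕ Fin n) ℤ) {Z : Matrix (Fin n) (Fin n) ℂ}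
    (hZ : Zᵀ = Z) : (den M Zᴴ)ᵀ = (den M Z)ᴴ := by
  simp only [den, transpose_add, transpose_mul, conjTranspose_add, conjTranspose_mul,
    conjTranspose_toComplex]
  rw [← conjTranspose_transpose_eq_transpose_conjTranspose, hZ]

theorem num_conj (M : Matrix (Fin n ⊕ Fin n) (Fin n ⊕ Fin n) ℤ) {Z : Matrix (Fin n) (Fin n) ℂ}
    (hZ : Zᵀ = Z) : (num M Zᴴ)ᵀ = (num M Z)ᴴ := by
  simp only [num, transpose_add, transpose_mul, conjTranspose_add, conjTranspose_mul,
    conjTranspose_toComplex]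
  rw [← conjTranspose_transpose_eq_transpose_conjTranspose, hZ]

section symplectic

variable {M : Matrix (Fin n ⊕ Fin n) (Fin n ⊕ Fin n) ℤ} {Z : Matrix (Fin n) (Fin n) ℂ}

theorem den_conjTranspose_mul_num_sub (hM : M ∈ symplecticGroup (Fin n) ℤ)
    (hZ : Z ∈ siegelUpperHalfSpace n) :
    (den M Z)ᴴ * num M Z - (num M Z)ᴴ * den M Z =
      (2 * Complex.I) • (Z.map Complex.im).map Complex.ofReal := by
  have hZt := transpose_eq_of_mem hZ
  have hW : (Zᴴ)ᵀ = Zᴴ := by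
    rw [← conjTranspose_transpose_eq_transpose_conjTranspose, hZt]
  rw [← den_conj M hZt, ← num_conj M hZt, den_transpose_mul_num_sub hM hW, sub_conjTranspose hZt]

theorem star_dotProduct_im_mulVec_eq_zero (hZ : Z ∈ siegelUpperHalfSpace n) {v : Fin n → ℂ}
    (h : star v ⬝ᵥ ((Z.map Complex.im).map Complex.ofReal *ᵥ v) = 0) : v = 0 := by
  rw [star_dotProduct_map_mulVec (transpose_eq_of_posDef hZ.2)] at h
  norm_cast at h
  have hp := hZ.2.posSemidef
  have h1 : ∀ x : Fin n → ℝ, 0 ≤ qform (Z.map Complex.im) x := fun x =>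
    hp.dotProduct_mulVec_nonneg x
  have h2 := h1 fun i => (v i).re
  have h3 := h1 fun i => (v i).im
  have h4 : (fun i => (v i).re) = 0 := by
    by_contra hc
    linarith [qform_pos hZ.2 hc]
  have h5 : (fun i => (v i).im) = 0 := by
    by_contra hc
    linarith [qform_pos hZ.2 hc]
  funext i
  exact Complex.ext (congrFun h4 i) (congrFun h5 i)

/-- A kernel vector `v` of `CZ + D` would satisfy `v* Y v = 0` with `Y` the positive definite
imaginary part. -/
theorem isUnit_det_den (hM : M ∈ symplecticGroup (Fin n) ℤ) (hZ : Z ∈ siegelUpperHalfSpace n) :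
    IsUnit (den M Z).det := by
  rw [isUnit_iff_ne_zero]
  intro h0
  obtain ⟨v, hv, hv0⟩ := exists_mulVec_eq_zero_iff.2 h0
  have h := congrArg (fun A => star v ⬝ᵥ (A *ᵥ v)) (den_conjTranspose_mul_num_sub hM hZ)
  have h1 : star v ᵥ* (den M Z)ᴴ = 0 := by rw [← star_mulVec, hv0, star_zero]
  simp only [sub_mulVec, ← mulVec_mulVec, hv0, mulVec_zero, sub_zero, smul_mulVec,
    dotProduct_smul] at h
  rw [dotProduct_mulVec, h1, zero_dotProduct, eq_comm, smul_eq_zero] at h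
  refine hv (star_dotProduct_im_mulVec_eq_zero hZ (h.resolve_left ?_))
  simp

theorem moebius_sub_conjTranspose (hM : M ∈ symplecticGroup (Fin n) ℤ)
    (hZ : Z ∈ siegelUpperHalfSpace n) :
    moebius M Z - (moebius M Z)ᴴ =
      (2 * Complex.I) • (((den M Z)⁻¹)ᴴ * (Z.map Complex.im).map Complex.ofReal * (den M Z)⁻¹) := by
  have hu := isUnit_det_den hM hZ
  have h := den_conjTranspose_mul_num_sub hM hZ
  have h1 : ((den M Z)⁻¹)ᴴ * (den M Z)ᴴ = 1 := by
    rw [← conjTranspose_mul, mul_nonsing_inv _ hu, conjTranspose_one]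
  have h2 : den M Z * (den M Z)⁻¹ = 1 := mul_nonsing_inv _ hu
  calc moebius M Z - (moebius M Z)ᴴ = ((den M Z)⁻¹)ᴴ * (den M Z)ᴴ * num M Z * (den M Z)⁻¹ -
        ((den M Z)⁻¹)ᴴ * (num M Z)ᴴ * (den M Z * (den M Z)⁻¹) := by
          rw [h1, h2, moebius, conjTranspose_mul, Matrix.one_mul, Matrix.mul_one]
    _ = ((den M Z)⁻¹)ᴴ * ((den M Z)ᴴ * num M Z - (num M Z)ᴴ * den M Z) * (den M Z)⁻¹ := by
          simp only [Matrix.mul_sub, Matrix.sub_mul, Matrix.mul_assoc]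
    _ = _ := by rw [h, Matrix.mul_smul, Matrix.smul_mul]

theorem transpose_moebius (hM : M ∈ symplecticGroup (Fin n) ℤ) (hZ : Z ∈ siegelUpperHalfSpace n) :
    (moebius M Z)ᵀ = moebius M Z := by
  have hu := isUnit_det_den hM hZ
  have h := den_transpose_mul_num_sub hM (Z := Z) (transpose_eq_of_mem hZ)
  rw [sub_self, sub_eq_zero] at h
  have h1 : ((den M Z)⁻¹)ᵀ * (den M Z)ᵀ = 1 := by
    rw [← transpose_mul, mul_nonsing_inv _ hu, transpose_one]
  have h2 : den M Z * (den M Z)⁻¹ = 1 := mul_nonsing_inv _ hu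
  calc (moebius M Z)ᵀ = ((den M Z)⁻¹)ᵀ * ((num M Z)ᵀ * den M Z) * (den M Z)⁻¹ := by
        rw [Matrix.mul_assoc, Matrix.mul_assoc, h2, Matrix.mul_one, moebius, transpose_mul]
    _ = moebius M Z := by
        rw [← h, ← Matrix.mul_assoc, h1, Matrix.one_mul, moebius]

theorem moebius_mem (hM : M ∈ symplecticGroup (Fin n) ℤ) (hZ : Z ∈ siegelUpperHalfSpace n) :
    moebius M Z ∈ siegelUpperHalfSpace n := by
  have ht := transpose_moebius hM hZ
  have hu := isUnit_det_den hM hZ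
  refine ⟨ht, ?_⟩
  have hY : ((moebius M Z).map Complex.im)ᵀ = (moebius M Z).map Complex.im := by
    rw [← transpose_map, ht]
  refine posDef_of_qform_pos hY fun x hx => ?_
  have h := moebius_sub_conjTranspose hM hZ
  rw [sub_conjTranspose ht] at h
  have h' := smul_right_injective _ (show (2 * Complex.I) ≠ 0 by simp) h
  let v : Fin n → ℂ := (den M Z)⁻¹ *ᵥ fun i => (x i : ℂ)
  have h1 : ((qform ((moebius M Z).map Complex.im) x : ℝ) : ℂ) =
      star v ⬝ᵥ ((Z.map Complex.im).map Complex.ofReal *ᵥ v) := by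
    have h2 := star_dotProduct_map_mulVec hY fun i => (x i : ℂ)
    have h3 : qform ((moebius M Z).map Complex.im) (fun i => ((x i : ℂ)).im) = 0 := by
      simp only [Complex.ofReal_im]
      simp [qform, dotProduct]
    simp only [h3, add_zero, Complex.ofReal_re] at h2
    rw [← h2, h', ← mulVec_mulVec, ← mulVec_mulVec, dotProduct_mulVec, ← star_mulVec]
  rw [star_dotProduct_map_mulVec (transpose_eq_of_posDef hZ.2), Complex.ofReal_inj] at h1
  have hv : v ≠ 0 := by
    intro hv
    apply hx
    have h4 : den M Z *ᵥ v = fun i => (x i : ℂ) := by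
      rw [mulVec_mulVec, mul_nonsing_inv _ hu, one_mulVec]
    rw [hv, mulVec_zero] at h4
    funext i
    have := congrFun h4 i
    simpa using this.symm
  have hp := hZ.2.posSemidef
  have h5 : ∀ x : Fin n → ℝ, 0 ≤ qform (Z.map Complex.im) x := fun x =>
    hp.dotProduct_mulVec_nonneg x
  rw [h1]
  refine lt_of_le_of_ne (add_nonneg (h5 _) (h5 _)) fun h6 => hv ?_
  apply star_dotProduct_im_mulVec_eq_zero hZ
  rw [star_dotProduct_map_mulVec (transpose_eq_of_posDef hZ.2), ← h6, Complex.ofReal_zero]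

theorem num_mul (M' : Matrix (Fin n ⊕ Fin n) (Fin n ⊕ Fin n) ℤ)
    (hM : M ∈ symplecticGroup (Fin n) ℤ) (hZ : Z ∈ siegelUpperHalfSpace n) :
    num (M' * M) Z = num M' (moebius M Z) * den M Z := by
  have hu := isUnit_det_den hM hZ
  have e : M' * M = fromBlocks (M'.toBlocks₁₁ * M.toBlocks₁₁ + M'.toBlocks₁₂ * M.toBlocks₂₁)
      (M'.toBlocks₁₁ * M.toBlocks₁₂ + M'.toBlocks₁₂ * M.toBlocks₂₂)
      (M'.toBlocks₂₁ * M.toBlocks₁₁ + M'.toBlocks₂₂ * M.toBlocks₂₁)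
      (M'.toBlocks₂₁ * M.toBlocks₁₂ + M'.toBlocks₂₂ * M.toBlocks₂₂) := by
    conv_lhs => rw [← fromBlocks_toBlocks M', ← fromBlocks_toBlocks M, fromBlocks_multiply]
  rw [num, e, toBlocks_fromBlocks₁₁, toBlocks_fromBlocks₁₂, num, moebius, Matrix.add_mul,
    Matrix.mul_assoc, Matrix.mul_assoc, nonsing_inv_mul _ hu, Matrix.mul_one, num, den]
  simp only [toComplex_add, toComplex_mul, Matrix.mul_add, Matrix.add_mul, Matrix.mul_assoc]
  abel

theorem den_mul (M' : Matrix (Fin n ⊕ Fin n) (Fin n ⊕ Fin n) ℤ)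
    (hM : M ∈ symplecticGroup (Fin n) ℤ) (hZ : Z ∈ siegelUpperHalfSpace n) :
    den (M' * M) Z = den M' (moebius M Z) * den M Z := by
  have hu := isUnit_det_den hM hZ
  have e : M' * M = fromBlocks (M'.toBlocks₁₁ * M.toBlocks₁₁ + M'.toBlocks₁₂ * M.toBlocks₂₁)
      (M'.toBlocks₁₁ * M.toBlocks₁₂ + M'.toBlocks₁₂ * M.toBlocks₂₂)
      (M'.toBlocks₂₁ * M.toBlocks₁₁ + M'.toBlocks₂₂ * M.toBlocks₂₁)
      (M'.toBlocks₂₁ * M.toBlocks₁₂ + M'.toBlocks₂₂ * M.toBlocks₂₂) := by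
    conv_lhs => rw [← fromBlocks_toBlocks M', ← fromBlocks_toBlocks M, fromBlocks_multiply]
  rw [den, e, toBlocks_fromBlocks₂₁, toBlocks_fromBlocks₂₂, den, moebius, Matrix.add_mul,
    Matrix.mul_assoc, Matrix.mul_assoc, nonsing_inv_mul _ hu, Matrix.mul_one, num, den]
  simp only [toComplex_add, toComplex_mul, Matrix.mul_add, Matrix.add_mul, Matrix.mul_assoc]
  abel

theorem moebius_mul (M' : Matrix (Fin n ⊕ Fin n) (Fin n ⊕ Fin n) ℤ)
    (hM : M ∈ symplecticGroup (Fin n) ℤ) (hZ : Z ∈ siegelUpperHalfSpace n) :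
    moebius (M' * M) Z = moebius M' (moebius M Z) := by
  have hu := isUnit_det_den hM hZ
  rw [moebius, num_mul M' hM hZ, den_mul M' hM hZ, Matrix.mul_inv_rev, Matrix.mul_assoc,
    ← Matrix.mul_assoc (den M Z), mul_nonsing_inv _ hu, Matrix.one_mul]
  rfl

end symplectic

end KM
end

noncomputable section
open Matrix

namespace KM

variable {n : ℕ}

/-! ### Generators of the symplectic group -/

/-- The translation `Z ↦ Z + S`. -/
def translation (S : Matrix (Fin n) (Fin n) ℤ) : Matrix (Fin n ⊕ Fin n) (Fin n ⊕ Fin n) ℤ :=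
  fromBlocks 1 S 0 1

theorem translation_mem {S : Matrix (Fin n) (Fin n) ℤ} (hS : Sᵀ = S) :
    translation S ∈ symplecticGroup (Fin n) ℤ := by
  rw [translation, SymplecticGroup.fromBlocks_mem_iff]
  simp [hS]

theorem den_translation (S : Matrix (Fin n) (Fin n) ℤ) (Z : Matrix (Fin n) (Fin n) ℂ) :
    den (translation S) Z = 1 := by
  simp [den, translation, toComplex_zero, toComplex_one]

theorem moebius_translation (S : Matrix (Fin n) (Fin n) ℤ) (Z : Matrix (Fin n) (Fin n) ℂ) :
    moebius (translation S) Z = Z + toComplex S := by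
  rw [moebius, den_translation, inv_one, Matrix.mul_one]
  simp [num, translation, toComplex_one]

/-- The transformation `Z ↦ ᵗU Z U`. -/
def conjugation (U : SpecialLinearGroup (Fin n) ℤ) : Matrix (Fin n ⊕ Fin n) (Fin n ⊕ Fin n) ℤ :=
  fromBlocks U.1ᵀ 0 0 U⁻¹.1

theorem coe_mul_inv (U : SpecialLinearGroup (Fin n) ℤ) : U.1 * U⁻¹.1 = 1 := by
  rw [← Matrix.SpecialLinearGroup.coe_mul, mul_inv_cancel, Matrix.SpecialLinearGroup.coe_one]

theorem conjugation_mem (U : SpecialLinearGroup (Fin n) ℤ) :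
    conjugation U ∈ symplecticGroup (Fin n) ℤ := by
  rw [conjugation, SymplecticGroup.fromBlocks_mem_iff]
  simp only [transpose_transpose, coe_mul_inv, Matrix.mul_zero, transpose_zero, Matrix.zero_mul,
    sub_zero, and_self]

theorem det_den_conjugation (U : SpecialLinearGroup (Fin n) ℤ) (Z : Matrix (Fin n) (Fin n) ℂ) :
    (den (conjugation U) Z).det = 1 := by
  simp only [den, conjugation, toBlocks_fromBlocks₂₁, toBlocks_fromBlocks₂₂, toComplex_zero,
    Matrix.zero_mul, zero_add]
  rw [toComplex_det, U⁻¹.2, Int.cast_one]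

theorem moebius_conjugation (U : SpecialLinearGroup (Fin n) ℤ) (Z : Matrix (Fin n) (Fin n) ℂ) :
    moebius (conjugation U) Z = (toComplex U.1)ᵀ * Z * toComplex U.1 := by
  have h : (toComplex U⁻¹.1)⁻¹ = toComplex U.1 := by
    apply inv_eq_left_inv
    rw [← toComplex_mul, coe_mul_inv, toComplex_one]
  simp only [moebius, num, den, conjugation, toBlocks_fromBlocks₁₁, toBlocks_fromBlocks₁₂,
    toBlocks_fromBlocks₂₁, toBlocks_fromBlocks₂₂, toComplex_zero, h, toComplex_transpose,
    Matrix.zero_mul, zero_add, add_zero]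

theorem map_im_conj (U : SpecialLinearGroup (Fin n) ℤ) (Z : Matrix (Fin n) (Fin n) ℂ) :
    ((toComplex U.1)ᵀ * Z * toComplex U.1).map Complex.im = act (Z.map Complex.im) U := by
  ext i j
  simp [act, toComplex, Matrix.mul_apply, Finset.sum_mul]

/-- The partial inversion at the `i`-th coordinate. -/
def inversion (i : Fin n) : Matrix (Fin n ⊕ Fin n) (Fin n ⊕ Fin n) ℤ :=
  fromBlocks (1 - single i i 1) (-single i i 1) (single i i 1) (1 - single i i 1)

theorem inversion_mem (i : Fin n) : inversion i ∈ symplecticGroup (Fin n) ℤ := by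
  rw [inversion, SymplecticGroup.fromBlocks_mem_iff]
  simp [Matrix.sub_mul, Matrix.mul_sub]

theorem det_den_inversion (i : Fin n) (Z : Matrix (Fin n) (Fin n) ℂ) :
    (den (inversion i) Z).det = Z i i := by
  have h : den (inversion i) Z = (1 : Matrix (Fin n) (Fin n) ℂ).updateRow i (Z i) := by
    ext k l
    by_cases hk : k = i
    · subst hk
      simp [den, inversion, toComplex, Matrix.mul_apply, single_apply, Matrix.one_apply]
    · simp [den, inversion, toComplex, Matrix.mul_apply, Matrix.one_apply,
        updateRow_ne hk, Ne.symm hk]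
  rw [h, ← cramer_transpose_apply, transpose_one, cramer_one]
  rfl

/-! ### Reduction of points of the upper half space -/

/-- Siegel's reduction: almost minimize `|det(CZ + D)|`, Minkowski-reduce the imaginary part by a
unimodular conjugation, and round the real part by a translation. The last two steps do not change
`|det(CZ + D)|`. -/
theorem exists_symplectic_reduced (n : ℕ) : ∃ c > 0, ∀ Z ∈ siegelUpperHalfSpace n, ∀ b > 0,
    (∀ M ∈ symplecticGroup (Fin n) ℤ, b ≤ ‖(den M Z).det‖ ^ 2) →
    ∃ M ∈ symplecticGroup (Fin n) ℤ,
      ∀ x, c * ∑ i, x i ^ 2 ≤ qform ((moebius M Z).map Complex.im) x := by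
  obtain ⟨C, hC, c, hc, hred⟩ := exists_reduced n
  refine ⟨c / 2, by positivity, fun Z hZ b hb hbd => ?_⟩
  have : Nonempty (symplecticGroup (Fin n) ℤ) := ⟨1⟩
  obtain ⟨⟨M, hM⟩, hmin⟩ := exists_forall_le_two_mul
    (fun M : symplecticGroup (Fin n) ℤ => ‖(den M.1 Z).det‖ ^ 2) hb fun M => hbd M.1 M.2
  have hmin' : ∀ M' ∈ symplecticGroup (Fin n) ℤ,
      ‖(den M Z).det‖ ^ 2 ≤ 2 * ‖(den M' Z).det‖ ^ 2 := fun M' hM' => hmin ⟨M', hM'⟩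
  have hZ1 := moebius_mem hM hZ
  obtain ⟨U, -, hU⟩ := hred _ hZ1.2
  have hM1 : conjugation U * M ∈ symplecticGroup (Fin n) ℤ := mul_mem (conjugation_mem U) hM
  have hZ2 := moebius_mem hM1 hZ
  let S : Matrix (Fin n) (Fin n) ℤ := Matrix.of fun i j =>
    -round (moebius (conjugation U * M) Z i j).re
  have hS : Sᵀ = S := by
    ext i j
    have : moebius (conjugation U * M) Z j i = moebius (conjugation U * M) Z i j :=
      congrFun (congrFun (transpose_eq_of_mem hZ2) i) j
    simp [S, this]
  have hM2 : translation S * (conjugation U * M) ∈ symplecticGroup (Fin n) ℤ :=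
    mul_mem (translation_mem hS) hM1
  have hd2 : (den (translation S * (conjugation U * M)) Z).det = (den M Z).det := by
    rw [den_mul _ hM1 hZ, den_translation, Matrix.one_mul, den_mul _ hM hZ, det_mul,
      det_den_conjugation, one_mul]
  have hm2 : moebius (translation S * (conjugation U * M)) Z =
      moebius (conjugation U * M) Z + toComplex S := by
    rw [moebius_mul _ hM1 hZ, moebius_translation]
  have him : (moebius (translation S * (conjugation U * M)) Z).map Complex.im =
      act ((moebius M Z).map Complex.im) U := by
    rw [hm2, moebius_mul _ hM hZ, moebius_conjugation, ← map_im_conj]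
    ext i j
    simp [toComplex]
  refine ⟨_, hM2, fun x => ?_⟩
  -- Composing with the partial inversion at `i` multiplies the denominator by `z_ii`, so
  -- almost-minimality gives `|z_ii|² ≥ 1/2`; with `|Re z_ii| ≤ 1/2` this leaves `Im z_ii ≥ 1/2`.
  have hdiag : ∀ i, 1 / 2 ≤ act ((moebius M Z).map Complex.im) U i i := by
    intro i
    have h1 := hmin' _ (mul_mem (inversion_mem i) hM2)
    rw [den_mul _ hM2 hZ, det_mul, det_den_inversion, hd2, norm_mul, mul_pow] at h1
    have h2 : 0 < ‖(den M Z).det‖ ^ 2 := hb.trans_le (hbd M hM)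
    set z := moebius (translation S * (conjugation U * M)) Z i i with hz
    have h3 : 1 ≤ 2 * ‖z‖ ^ 2 := by
      by_contra! hcon
      nlinarith
    have h4 : |z.re| ≤ 1 / 2 := by
      have := abs_sub_round (moebius (conjugation U * M) Z i i).re
      rw [hz, hm2]
      simpa [toComplex, S, ← sub_eq_add_neg] using this
    have h5 : z.im = act ((moebius M Z).map Complex.im) U i i := by
      rw [← him]
      rfl
    rw [← h5]
    have h6 : 0 < z.im := by
      rw [h5]
      exact (posDef_act hZ1.2 U).diag_pos
    rw [← Complex.normSq_eq_norm_sq, Complex.normSq_apply] at h3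
    have h7 := abs_le.1 h4
    nlinarith [h7.1, h7.2]
  rw [him]
  refine le_trans ?_ (hU x)
  rw [div_mul_eq_mul_div, mul_div_assoc, Finset.sum_div]
  refine mul_le_mul_of_nonneg_left (Finset.sum_le_sum fun i _ => ?_) hc.le
  nlinarith [hdiag i, sq_nonneg (x i)]

/-! ### A lower bound for the denominators -/

theorem sum_mulVec_sq_le {X : Matrix (Fin n) (Fin n) ℝ} {b : ℝ} (hX : ∀ i j, |X i j| ≤ b)
    (w : Fin n → ℝ) : (X *ᵥ w) ⬝ᵥ (X *ᵥ w) ≤ (n * b) ^ 2 * (w ⬝ᵥ w) := by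
  have h : ∀ i, (X *ᵥ w) i * (X *ᵥ w) i ≤ (n * b ^ 2) * (w ⬝ᵥ w) := by
    intro i
    have h1 := Finset.sum_mul_sq_le_sq_mul_sq Finset.univ (X i) w
    have h2 : ∑ j, X i j ^ 2 ≤ n * b ^ 2 := by
      refine (Finset.sum_le_card_nsmul _ _ (b ^ 2) fun j _ => ?_).trans (by simp)
      exact sq_le_sq' (by linarith [(abs_le.1 (hX i j)).1]) (abs_le.1 (hX i j)).2
    have h3 : (w ⬝ᵥ w) = ∑ j, w j ^ 2 := by simp [dotProduct, pow_two]
    rw [h3, ← pow_two]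
    refine h1.trans ?_
    exact mul_le_mul_of_nonneg_right h2 (Finset.sum_nonneg fun _ _ => sq_nonneg _)
  refine (Finset.sum_le_card_nsmul _ _ _ fun i _ => h i).trans (le_of_eq ?_)
  simp
  ring

theorem qform_mul_transpose (C : Matrix (Fin n) (Fin n) ℝ) (v : Fin n → ℝ) :
    qform (C * Cᵀ) v = (Cᵀ *ᵥ v) ⬝ᵥ (Cᵀ *ᵥ v) := by
  rw [qform, ← mulVec_mulVec, dotProduct_mulVec, ← mulVec_transpose]

/-- `AᵗD - BᵗC = 1` excludes a common kernel vector of `ᵗC` and `ᵗD`, so the Gram matrix is positive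
definite; being integral, it has determinant at least one. -/
theorem one_le_det_gram {M : Matrix (Fin n ⊕ Fin n) (Fin n ⊕ Fin n) ℤ}
    (hM : M ∈ symplecticGroup (Fin n) ℤ) {C D : Matrix (Fin n) (Fin n) ℝ}
    (hC : C = M.toBlocks₂₁.map Int.cast) (hD : D = M.toBlocks₂₂.map Int.cast) :
    (C * Cᵀ + D * Dᵀ).PosDef ∧ 1 ≤ (C * Cᵀ + D * Dᵀ).det := by
  have hpos : (C * Cᵀ + D * Dᵀ).PosDef := by
    refine posDef_of_qform_pos (by simp [transpose_add, transpose_mul]) fun v hv => ?_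
    have h1 : qform (C * Cᵀ + D * Dᵀ) v =
        (Cᵀ *ᵥ v) ⬝ᵥ (Cᵀ *ᵥ v) + (Dᵀ *ᵥ v) ⬝ᵥ (Dᵀ *ᵥ v) := by
      rw [← qform_mul_transpose, ← qform_mul_transpose, qform, add_mulVec, dotProduct_add]
      rfl
    have h2 : ∀ w : Fin n → ℝ, 0 ≤ w ⬝ᵥ w := fun w =>
      Finset.sum_nonneg fun i _ => mul_self_nonneg _
    rw [h1]
    refine lt_of_le_of_ne (add_nonneg (h2 _) (h2 _)) fun h3 => hv ?_
    have h4 : Cᵀ *ᵥ v = 0 := dotProduct_self_eq_zero.1 (by linarith [h2 (Cᵀ *ᵥ v), h2 (Dᵀ *ᵥ v)])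
    have h5 : Dᵀ *ᵥ v = 0 := dotProduct_self_eq_zero.1 (by linarith [h2 (Cᵀ *ᵥ v), h2 (Dᵀ *ᵥ v)])
    have h6 := congrArg (fun A : Matrix (Fin n) (Fin n) ℤ => A.map (Int.cast : ℤ → ℝ))
      (symplectic_relations' hM).2
    have h7 : (M.toBlocks₁₁ * M.toBlocks₂₂ᵀ - M.toBlocks₁₂ * M.toBlocks₂₁ᵀ).map (Int.cast : ℤ → ℝ) =
        M.toBlocks₁₁.map (Int.cast : ℤ → ℝ) * Dᵀ - M.toBlocks₁₂.map (Int.cast : ℤ → ℝ) * Cᵀ := by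
      rw [hC, hD, ← transpose_map, ← transpose_map, ← map_intCast_mul_real, ← map_intCast_mul_real]
      ext
      simp
    have h8 : (1 : Matrix (Fin n) (Fin n) ℤ).map (Int.cast : ℤ → ℝ) = 1 :=
      Matrix.map_one _ Int.cast_zero Int.cast_one
    simp only [h7, h8] at h6
    rw [← one_mulVec v, ← h6, sub_mulVec, ← mulVec_mulVec, ← mulVec_mulVec, h4, h5, mulVec_zero,
      mulVec_zero, sub_zero]
  refine ⟨hpos, ?_⟩
  have h1 : C * Cᵀ + D * Dᵀ = (M.toBlocks₂₁ * M.toBlocks₂₁ᵀ + M.toBlocks₂₂ * M.toBlocks₂₂ᵀ).map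
      (Int.cast : ℤ → ℝ) := by
    rw [hC, hD, ← transpose_map, ← transpose_map, ← map_intCast_mul_real, ← map_intCast_mul_real]
    ext
    simp
  have h2 := hpos.det_pos
  have h3 := (Int.castRingHom ℝ).map_det
    (M.toBlocks₂₁ * M.toBlocks₂₁ᵀ + M.toBlocks₂₂ * M.toBlocks₂₂ᵀ)
  rw [h1] at h2 ⊢
  have h4 : ((M.toBlocks₂₁ * M.toBlocks₂₁ᵀ + M.toBlocks₂₂ * M.toBlocks₂₂ᵀ).map
      (Int.cast : ℤ → ℝ)).det =
      ((M.toBlocks₂₁ * M.toBlocks₂₁ᵀ + M.toBlocks₂₂ * M.toBlocks₂₂ᵀ).det : ℝ) := h3.symm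
  rw [h4] at h2 ⊢
  exact_mod_cast h2

/-- With `P = CX + D`, symmetry of `PᵗC` gives `|det(CZ + D)|² = det(PᵗP + ε² CᵗC)`. This form
dominates a multiple of `CᵗC + DᵗD`, whose determinant is at least one. The bound is uniform in `M`.
-/
theorem le_norm_det_den_sq {M : Matrix (Fin n ⊕ Fin n) (Fin n ⊕ Fin n) ℤ}
    (hM : M ∈ symplecticGroup (Fin n) ℤ) {X : Matrix (Fin n) (Fin n) ℝ} (hXs : Xᵀ = X)
    (hX : ∀ i j, |X i j| ≤ 2) {ε : ℝ} (hε : 0 < ε) (hε1 : ε ≤ 1) :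
    (ε ^ 2 / (8 * n ^ 2 + 2)) ^ n ≤
      ‖(den M (complexPoint X (ε • (1 : Matrix (Fin n) (Fin n) ℝ)))).det‖ ^ 2 := by
  set C := M.toBlocks₂₁.map (Int.cast : ℤ → ℝ) with hC
  set D := M.toBlocks₂₂.map (Int.cast : ℤ → ℝ) with hD
  obtain ⟨hG, hGdet⟩ := one_le_det_gram hM hC hD
  set P := C * X + D with hP
  let S := P * Pᵀ + ε ^ 2 • (C * Cᵀ)
  have hCD : C * Dᵀ = D * Cᵀ := by
    rw [hC, hD, ← transpose_map, ← transpose_map, ← map_intCast_mul_real, ← map_intCast_mul_real,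
      (symplectic_relations' hM).1]
  have hPC : P * Cᵀ = C * Pᵀ := by
    rw [hP, transpose_add, transpose_mul, hXs, Matrix.add_mul, Matrix.mul_add, hCD, Matrix.mul_assoc]
  have hmap : ∀ A B : Matrix (Fin n) (Fin n) ℝ, (A * B).map Complex.ofReal =
      A.map Complex.ofReal * B.map Complex.ofReal := fun A B =>
    Matrix.map_mul (f := Complex.ofRealHom)
  have hden : den M (complexPoint X (ε • (1 : Matrix (Fin n) (Fin n) ℝ))) = P.map Complex.ofReal +
      (Complex.I * ε) • C.map Complex.ofReal := by
    have h1 : toComplex M.toBlocks₂₁ = C.map Complex.ofReal := by ext; simp [toComplex, hC]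
    have h2 : toComplex M.toBlocks₂₂ = D.map Complex.ofReal := by ext; simp [toComplex, hD]
    have h3 : (ε • (1 : Matrix (Fin n) (Fin n) ℝ)).map Complex.ofReal = (ε : ℂ) • 1 := by
      ext i j
      by_cases hij : i = j <;> simp [hij]
    have h4 : P.map Complex.ofReal = C.map Complex.ofReal * X.map Complex.ofReal +
        D.map Complex.ofReal := by
      rw [← hmap]; ext; simp [hP]
    rw [den, h1, h2, complexPoint, h3, h4, Matrix.mul_add, smul_smul, Matrix.mul_smul,
      Matrix.mul_one]
    abel
  have hconj : ∀ A : Matrix (Fin n) (Fin n) ℝ, (A.map Complex.ofReal)ᴴ = Aᵀ.map Complex.ofReal := by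
    intro A; ext; simp
  have hSeq : den M (complexPoint X (ε • (1 : Matrix (Fin n) (Fin n) ℝ))) *
      (den M (complexPoint X (ε • (1 : Matrix (Fin n) (Fin n) ℝ))))ᴴ = S.map Complex.ofReal := by
    have h1 : S.map Complex.ofReal = P.map Complex.ofReal * Pᵀ.map Complex.ofReal +
        ((ε : ℂ) ^ 2) • (C.map Complex.ofReal * Cᵀ.map Complex.ofReal) := by
      rw [← hmap, ← hmap]; ext; simp [S]
    have h2 : P.map Complex.ofReal * Cᵀ.map Complex.ofReal =
        C.map Complex.ofReal * Pᵀ.map Complex.ofReal := by rw [← hmap, ← hmap, hPC]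
    rw [hden, conjTranspose_add, conjTranspose_smul, hconj, hconj, h1, Matrix.add_mul,
      Matrix.mul_add, Matrix.mul_add, Matrix.smul_mul, Matrix.smul_mul, Matrix.mul_smul,
      Matrix.mul_smul, h2, smul_smul]
    have h3 : star (Complex.I * (ε : ℂ)) = -(Complex.I * ε) := by simp
    have h4 : Complex.I * (ε : ℂ) * -(Complex.I * ε) = (ε : ℂ) ^ 2 := by
      linear_combination (-(ε : ℂ) ^ 2) * Complex.I_mul_I
    rw [h3, h4, neg_smul]
    abel
  have hdet : ‖(den M (complexPoint X (ε • (1 : Matrix (Fin n) (Fin n) ℝ)))).det‖ ^ 2 = S.det := by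
    have h1 := congrArg det hSeq
    have h2 : (S.map Complex.ofReal).det = (S.det : ℂ) := (Complex.ofRealHom.map_det S).symm
    rw [det_mul, det_conjTranspose, h2] at h1
    have h3 := Complex.mul_conj (den M (complexPoint X (ε • (1 : Matrix (Fin n) (Fin n) ℝ)))).det
    rw [← Complex.normSq_eq_norm_sq]
    exact_mod_cast h3.symm.trans h1
  rw [hdet]
  -- From `ᵗDv = ᵗPv - XᵗCv` and `|Xw|² ≤ (2n)²|w|²` one gets `|ᵗCv|² + |ᵗDv|² ≤ 2|ᵗPv|² + (8n² +
  -- 1)|ᵗCv|²`.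
  set K : ℝ := 8 * n ^ 2 + 2 with hK
  have hK0 : 0 < K := by positivity
  have hK2 : 2 ≤ K := by rw [hK]; nlinarith [sq_nonneg (n : ℝ)]
  have hδ : 0 < ε ^ 2 / K := by positivity
  have hle : ∀ v, qform ((ε ^ 2 / K) • (C * Cᵀ + D * Dᵀ)) v ≤ qform S v := by
    intro v
    have h1 : qform ((ε ^ 2 / K) • (C * Cᵀ + D * Dᵀ)) v =
        (ε ^ 2 / K) * ((Cᵀ *ᵥ v) ⬝ᵥ (Cᵀ *ᵥ v) + (Dᵀ *ᵥ v) ⬝ᵥ (Dᵀ *ᵥ v)) := by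
      rw [← qform_mul_transpose, ← qform_mul_transpose, qform, smul_mulVec, dotProduct_smul,
        add_mulVec, dotProduct_add]
      rfl
    have h2 : qform S v = (Pᵀ *ᵥ v) ⬝ᵥ (Pᵀ *ᵥ v) + ε ^ 2 * ((Cᵀ *ᵥ v) ⬝ᵥ (Cᵀ *ᵥ v)) := by
      rw [← qform_mul_transpose, ← qform_mul_transpose, qform, add_mulVec, dotProduct_add,
        smul_mulVec, dotProduct_smul]
      rfl
    rw [h1, h2]
    have h3 : Dᵀ *ᵥ v = Pᵀ *ᵥ v - X *ᵥ (Cᵀ *ᵥ v) := by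
      rw [hP, transpose_add, transpose_mul, hXs, add_mulVec, ← mulVec_mulVec]
      abel
    have h4 := sum_mulVec_sq_le hX (Cᵀ *ᵥ v)
    have h5 : (Dᵀ *ᵥ v) ⬝ᵥ (Dᵀ *ᵥ v) ≤ 2 * ((Pᵀ *ᵥ v) ⬝ᵥ (Pᵀ *ᵥ v)) +
        2 * ((X *ᵥ (Cᵀ *ᵥ v)) ⬝ᵥ (X *ᵥ (Cᵀ *ᵥ v))) := by
      rw [h3]
      simp only [dotProduct, Finset.mul_sum, ← Finset.sum_add_distrib, Pi.sub_apply]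
      refine Finset.sum_le_sum fun i _ => ?_
      nlinarith [sq_nonneg ((Pᵀ *ᵥ v) i + (X *ᵥ (Cᵀ *ᵥ v)) i)]
    have h6 : ∀ w : Fin n → ℝ, 0 ≤ w ⬝ᵥ w := fun w =>
      Finset.sum_nonneg fun i _ => mul_self_nonneg _
    have hp := h6 (Pᵀ *ᵥ v)
    have hc := h6 (Cᵀ *ᵥ v)
    set p := (Pᵀ *ᵥ v) ⬝ᵥ (Pᵀ *ᵥ v)
    set c := (Cᵀ *ᵥ v) ⬝ᵥ (Cᵀ *ᵥ v)
    rw [div_mul_eq_mul_div, div_le_iff₀ hK0]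
    have hε2 : ε ^ 2 ≤ 1 := by nlinarith
    have h7 : c + (Dᵀ *ᵥ v) ⬝ᵥ (Dᵀ *ᵥ v) ≤ 2 * p + K * c := by
      rw [hK]
      nlinarith
    calc ε ^ 2 * (c + (Dᵀ *ᵥ v) ⬝ᵥ (Dᵀ *ᵥ v)) ≤ ε ^ 2 * (2 * p + K * c) := by gcongr
      _ = ε ^ 2 * (2 * p) + K * (ε ^ 2 * c) := by ring
      _ ≤ 1 * (K * p) + K * (ε ^ 2 * c) := by gcongr
      _ = _ := by ring
  have hpos : ((ε ^ 2 / K) • (C * Cᵀ + D * Dᵀ)).PosDef := hG.smul hδ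
  have hSs : Sᵀ = S := by
    simp only [S, transpose_add, transpose_mul, transpose_smul, transpose_transpose]
  have := det_le_det_of_posSemidef_sub hpos hle hSs
  rw [det_smul, Fintype.card_fin] at this
  refine le_trans ?_ this
  exact le_mul_of_one_le_right (by positivity) hGdet

end KM
end

noncomputable section
open Matrix

namespace KM

variable {n : ℕ}

/-! ### Polynomial growth of the Fourier coefficients -/

theorem trace_mul_nonneg_of_posSemidef {T R : Matrix (Fin n) (Fin n) ℝ} (hT : T.PosSemidef)
    (hR : R.PosSemidef) : 0 ≤ (T * R).trace := by
  have hTs : Tᵀ = T := by simpa [conjTranspose_eq_transpose_of_trivial] using hT.isHermitian.eq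
  obtain ⟨V, d, hV, hd⟩ := exists_congr_diagonal two_ne_zero T hTs
  have hdn : ∀ i, 0 ≤ d i := by
    intro i
    have h1 : qform (Vᵀ * T * V) (Pi.single i 1) = d i := by
      rw [hd, qform_single, diagonal_apply_eq]
    rw [← h1, qform_conj]
    exact hT.dotProduct_mulVec_nonneg _
  have h1 : T = (V⁻¹)ᵀ * diagonal d * V⁻¹ := by
    rw [← hd]
    have h2 : (V⁻¹)ᵀ * Vᵀ = 1 := by rw [← transpose_mul, mul_nonsing_inv _ hV, transpose_one]
    calc T = ((V⁻¹)ᵀ * Vᵀ) * T * (V * V⁻¹) := by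
          rw [h2, mul_nonsing_inv _ hV, Matrix.one_mul, Matrix.mul_one]
      _ = _ := by simp only [Matrix.mul_assoc]
  have h2 : (T * R).trace = ∑ i, d i * (V⁻¹ * R * (V⁻¹)ᵀ) i i := by
    rw [h1, Matrix.mul_assoc, Matrix.mul_assoc, trace_mul_comm, Matrix.mul_assoc]
    simp [Matrix.trace, diagonal_mul]
  rw [h2]
  refine Finset.sum_nonneg fun i _ => mul_nonneg (hdn i) ?_
  have h3 := hR.mul_mul_conjTranspose_same V⁻¹
  rw [conjTranspose_eq_transpose_of_trivial] at h3
  exact h3.diag_nonneg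

namespace SiegelModularForm

variable {k : ℕ} (F : SiegelModularForm n k)

/-- When the imaginary part is at least `c`, the expansion is dominated term by term by its absolute
values at the point `ic`. -/
theorem exists_norm_le {c : ℝ} (hc : 0 < c) : ∃ B, 0 ≤ B ∧ ∀ Z ∈ siegelUpperHalfSpace n,
    (∀ x, c * ∑ i, x i ^ 2 ≤ qform (Z.map Complex.im) x) → ‖F.toFun Z‖ ≤ B := by
  have hZ0 : complexPoint 0 (c • (1 : Matrix (Fin n) (Fin n) ℝ)) ∈ siegelUpperHalfSpace n :=
    complexPoint_mem transpose_zero (PosDef.one.smul hc)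
  have hs := (F.hasSum_coeff hZ0).summable.norm
  refine ⟨∑' T, ‖F.coeff T * fourierExp T.1
    (complexPoint 0 (c • (1 : Matrix (Fin n) (Fin n) ℝ)))‖,
    tsum_nonneg fun T => norm_nonneg _, fun Z hZ hY => ?_⟩
  refine (F.hasSum_coeff hZ).norm_le_of_bounded hs.hasSum fun T => ?_
  rw [norm_mul, norm_mul, norm_fourierExp, norm_fourierExp, map_im_complexPoint]
  refine mul_le_mul_of_nonneg_left (Real.exp_le_exp.2 ?_) (norm_nonneg _)
  have hR : (Z.map Complex.im - c • (1 : Matrix (Fin n) (Fin n) ℝ)).PosSemidef := by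
    refine PosSemidef.of_dotProduct_mulVec_nonneg ?_ fun x => ?_
    · exact hZ.2.isHermitian.sub (PosDef.one.smul hc).isHermitian
    · have := hY x
      simp only [star_trivial, sub_mulVec, dotProduct_sub, smul_mulVec, one_mulVec,
        dotProduct_smul, smul_eq_mul, sub_nonneg]
      refine le_trans (le_of_eq ?_) this
      simp [dotProduct, pow_two]
  have h := trace_mul_nonneg_of_posSemidef T.2.2 hR
  rw [Matrix.mul_sub, trace_sub, sub_nonneg] at h
  have hpi : -2 * Real.pi ≤ 0 := by linarith [Real.pi_pos]
  exact mul_le_mul_of_nonpos_left h hpi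

/-- Hecke's argument: evaluate at imaginary part `1/tr T`, where the exponential factor is the
constant `exp(-2π)`. There Siegel reduction bounds `|F|` by a bounded value times `|det(CZ +
D)|^(-k)`, which is polynomial in `tr T`. -/
theorem exists_norm_coeff_le : ∃ C, 0 ≤ C ∧ ∃ A : ℕ, ∀ T : SemiHalf n, 1 ≤ T.1.trace →
    ‖F.coeff T‖ ≤ C * T.1.trace ^ A := by
  obtain ⟨c, hc, hred⟩ := exists_symplectic_reduced n
  obtain ⟨B, hB, hbound⟩ := F.exists_norm_le hc
  set K : ℝ := 8 * n ^ 2 + 2 with hK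
  have hK1 : 1 ≤ K := by rw [hK]; nlinarith [sq_nonneg (n : ℝ)]
  refine ⟨Real.exp (2 * Real.pi) * (B * (K ^ n) ^ k), by positivity, 2 * n * k, fun T hT => ?_⟩
  set t := T.1.trace
  have ht : 0 < t := by linarith
  set ε := t⁻¹ with hε
  have hε0 : 0 < ε := inv_pos.2 ht
  have hε1 : ε ≤ 1 := inv_le_one_of_one_le₀ hT
  have key := norm_coeff_mul_exp_le F.coeff (ε • (1 : Matrix (Fin n) (Fin n) ℝ))
    (B := B * (K ^ n) ^ k * t ^ (2 * n * k)) (by positivity) ?_ T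
  · rw [Matrix.mul_smul, Matrix.mul_one, trace_smul, smul_eq_mul, hε, inv_mul_cancel₀ ht.ne',
      mul_one, ← le_div_iff₀ (Real.exp_pos _)] at key
    refine key.trans (le_of_eq ?_)
    rw [div_eq_mul_inv, ← Real.exp_neg]
    ring_nf
  · intro X hX hXb
    have hZ := complexPoint_mem hX ((PosDef.one (n := Fin n) (R := ℝ)).smul hε0)
    refine ⟨_, F.hasSum_coeff hZ, ?_⟩
    set Z := complexPoint X (ε • (1 : Matrix (Fin n) (Fin n) ℝ))
    set b := (ε ^ 2 / K) ^ n with hb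
    have hb0 : 0 < b := by positivity
    have hb1 : b ≤ 1 := by
      refine pow_le_one₀ (by positivity) ?_
      rw [div_le_one (by linarith)]
      nlinarith
    have hlow : ∀ M ∈ symplecticGroup (Fin n) ℤ, b ≤ ‖(den M Z).det‖ ^ 2 := fun M hM =>
      le_norm_det_den_sq hM hX hXb hε0 hε1
    obtain ⟨M, hM, hMr⟩ := hred Z hZ b hb0 hlow
    have h1 := hbound _ (moebius_mem hM hZ) hMr
    rw [F.toFun_moebius hM hZ, norm_mul, norm_pow] at h1
    -- The bound is known for the square; `b ≤ 1` lets it pass to the root without extracting one.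
    have h2 : b ^ k ≤ ‖(den M Z).det‖ ^ k := by
      have h3 : b ^ k ≤ (‖(den M Z).det‖ ^ k) ^ 2 := by
        rw [← pow_mul (‖(den M Z).det‖), mul_comm k 2, pow_mul (‖(den M Z).det‖)]
        exact pow_le_pow_left₀ hb0.le (hlow M hM) k
      have h4 : b ^ k ≤ 1 := pow_le_one₀ hb0.le hb1
      by_contra! hcon
      have h5 : 0 ≤ ‖(den M Z).det‖ ^ k := by positivity
      nlinarith
    have h6 : b ^ k * ‖F.toFun Z‖ ≤ B :=
      (mul_le_mul_of_nonneg_right h2 (norm_nonneg _)).trans h1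
    have h7 : b ^ k * ((K ^ n) ^ k * t ^ (2 * n * k)) = 1 := by
      rw [hb, mul_assoc 2 n k, pow_mul t 2, pow_mul (t ^ 2) n k, ← mul_pow, ← mul_pow, ← mul_pow,
        ← mul_pow, hε]
      have : t⁻¹ ^ 2 / K * (K * t ^ 2) = 1 := by
        have : K ≠ 0 := by linarith
        field_simp
      rw [this, one_pow, one_pow]
    calc ‖F.toFun Z‖ = (b ^ k * ((K ^ n) ^ k * t ^ (2 * n * k))) * ‖F.toFun Z‖ := by
          rw [h7, one_mul]
      _ = (b ^ k * ‖F.toFun Z‖) * ((K ^ n) ^ k * t ^ (2 * n * k)) := by ring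
      _ ≤ B * ((K ^ n) ^ k * t ^ (2 * n * k)) := by gcongr
      _ = _ := by ring

end SiegelModularForm

/-! ### Summability over classes -/

theorem summable_prod_pi {f : ℤ → ℝ} (hf : ∀ k, 0 ≤ f k) (hs : Summable f) (d : ℕ) :
    Summable fun k : Fin d → ℤ => ∏ i, f (k i) := by
  induction d with
  | zero => exact Summable.of_finite
  | succ d ih =>
    rw [← (Fin.consEquiv fun _ : Fin (d + 1) => ℤ).summable_iff]
    refine (hs.mul_of_nonneg ih hf fun k => Finset.prod_nonneg fun i _ => hf _).congr fun x => ?_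
    simp [Fin.consEquiv, Fin.prod_univ_succ]

theorem summable_prod_pi' {ι : Type*} [Fintype ι] {f : ℤ → ℝ} (hf : ∀ k, 0 ≤ f k)
    (hs : Summable f) : Summable fun k : ι → ℤ => ∏ i, f (k i) := by
  let e := Fintype.equivFin ι
  rw [← (e.symm.arrowCongr (Equiv.refl ℤ)).summable_iff]
  refine (summable_prod_pi hf hs _).congr fun k => ?_
  simp only [Function.comp_apply, Equiv.arrowCongr_apply, Equiv.symm_symm, Equiv.coe_refl, id_eq]
  exact (Fintype.prod_equiv e _ _ fun i => rfl).symm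

theorem summable_inv_one_add_abs_sq : Summable fun k : ℤ => ((1 + |(k : ℝ)|) ^ 2)⁻¹ := by
  have h1 : Summable fun k : ℕ => ((1 + (k : ℝ)) ^ 2)⁻¹ := by
    have := (summable_nat_add_iff 1).2 (Real.summable_nat_pow_inv.2 (show 1 < 2 by norm_num))
    refine this.congr fun k => ?_
    push_cast
    rw [add_comm]
  refine Summable.of_nat_of_neg (h1.congr fun k => ?_) (h1.congr fun k => ?_) <;> simp

theorem one_le_diag (T : PosHalf n) (i : Fin n) : 1 ≤ T.1 i i := by
  obtain ⟨a, ha⟩ := T.2.1.2.1 i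
  have h : 0 < T.1 i i := T.2.2.diag_pos
  rw [ha] at h ⊢
  exact_mod_cast h

theorem two_mul_abs_le {Y : Matrix (Fin n) (Fin n) ℝ} (hY : Y.PosDef) (i j : Fin n) :
    2 * |Y i j| ≤ Y i i + Y j j := by
  have hs : Y j i = Y i j := congrFun (congrFun (transpose_eq_of_posDef hY) i) j
  have h : ∀ a : ℝ, 0 ≤ Y i i + 2 * a * Y i j + a ^ 2 * Y j j := by
    intro a
    have := hY.posSemidef.dotProduct_mulVec_nonneg (Pi.single i 1 + a • Pi.single j 1)
    simp only [star_trivial, mulVec_add, mulVec_smul, add_dotProduct, dotProduct_add,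
      smul_dotProduct, dotProduct_smul, single_dotProduct, mulVec_single_one, col_apply, one_mul,
      smul_eq_mul, hs] at this
    linarith
  have h1 := h 1
  have h2 := h (-1)
  rw [show 2 * |Y i j| = |2 * Y i j| by rw [abs_mul, abs_two], abs_le]
  constructor <;> linarith

/-- Diagonal entries of a positive definite half-integral matrix are at least one, so the bound on
their product bounds each of them, and positivity then bounds the off-diagonal entries. -/
theorem exists_reduced_representative (n : ℕ) : ∃ C > 0, ∀ T : PosHalf n,
    ∃ U : SpecialLinearGroup (Fin n) ℤ, 1 ≤ C * T.1.det ∧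
      ∀ i j, |(actPos T U).1 i j| ≤ C * T.1.det := by
  obtain ⟨C, hC, _, -, h⟩ := exists_reduced n
  refine ⟨C, hC, fun T => ?_⟩
  obtain ⟨U, hU, -⟩ := h T.1 T.2.2
  have h1 : ∀ i, 1 ≤ act T.1 U i i := one_le_diag (actPos T U)
  have h2 : ∀ i, act T.1 U i i ≤ C * T.1.det := fun i =>
    le_trans (by
      rw [← Finset.mul_prod_erase _ _ (Finset.mem_univ i)]
      exact le_mul_of_one_le_right (by linarith [h1 i]) (Finset.one_le_prod fun j _ => h1 j)) hU
  refine ⟨U, (Finset.one_le_prod fun i _ => h1 i).trans hU, fun i j => ?_⟩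
  have h3 := two_mul_abs_le (actPos T U).2.2 i j
  have h4 := h2 i
  have h5 := h2 j
  change 2 * |act T.1 U i j| ≤ act T.1 U i i + act T.1 U j j at h3
  change |act T.1 U i j| ≤ _
  linarith

theorem actPos_toSemi (T : PosHalf n) (U : SpecialLinearGroup (Fin n) ℤ) :
    (actPos T U).toSemi = actSemi T.toSemi U := rfl

theorem SiegelModularForm.coeff_actPos {k : ℕ} (F : SiegelModularForm n k) (T : PosHalf n)
    (U : SpecialLinearGroup (Fin n) ℤ) : F.coeff (actPos T U).toSemi = F.coeff T.toSemi := by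
  rw [actPos_toSemi, F.coeff_actSemi]

theorem mk_actPos (T : PosHalf n) (U : SpecialLinearGroup (Fin n) ℤ) :
    (Quotient.mk (equivMod ⊤) (actPos T U)) = Quotient.mk (equivMod ⊤) T :=
  Quotient.sound ((equivMod (n := n) ⊤).symm ⟨U, Subgroup.mem_top U, rfl⟩)

theorem inv_sq_le_nine_mul {D x : ℝ} (hD : 1 ≤ D) (hx : |x| ≤ 2 * D) :
    (D ^ 2)⁻¹ ≤ 9 * ((1 + |x|) ^ 2)⁻¹ := by
  have h0 := abs_nonneg x
  rw [← div_eq_mul_inv, inv_eq_one_div, div_le_div_iff₀ (by positivity) (by positivity)]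
  nlinarith

theorem inv_pow_le_prod {ι : Type*} [Fintype ι] {D : ℝ} (hD : 1 ≤ D) {x : ι → ℝ}
    (hx : ∀ i, |x i| ≤ 2 * D) : ((D ^ 2) ^ Fintype.card ι)⁻¹ ≤
      9 ^ Fintype.card ι * ∏ i, ((1 + |x i|) ^ 2)⁻¹ := by
  calc ((D ^ 2) ^ Fintype.card ι)⁻¹ = ∏ _i : ι, (D ^ 2)⁻¹ := by simp
    _ ≤ ∏ i, 9 * ((1 + |x i|) ^ 2)⁻¹ :=
      Finset.prod_le_prod (fun _ _ => by positivity) fun i _ => inv_sq_le_nine_mul hD (hx i)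
    _ = _ := by rw [Finset.prod_mul_distrib]; simp

theorem inv_rpow_le {C d σ : ℝ} {A m : ℕ} (hC : 0 < C) (hd : 0 < d) (hD : 1 ≤ C * d)
    (hσ : A + 2 * m ≤ σ) : (d ^ σ)⁻¹ ≤ C ^ σ * ((C * d) ^ A * ((C * d) ^ 2) ^ m)⁻¹ := by
  have h4 : d ^ σ = (C * d) ^ σ / C ^ σ := by
    rw [← Real.div_rpow (by positivity) hC.le, mul_div_cancel_left₀ _ hC.ne']
  rw [h4, inv_div, div_eq_mul_inv]
  refine mul_le_mul_of_nonneg_left (inv_anti₀ (by positivity) ?_) (by positivity)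
  rw [← pow_mul, ← pow_add, ← Real.rpow_natCast]
  refine Real.rpow_le_rpow_of_exponent_le hD ?_
  push_cast
  linarith

/-- A class is determined by the integers `2 T_ij` of a reduced representative, all at most `2C det
T` in absolute value. This compares the series with the convergent sum of `∏ (1 + |k_ij|)⁻²` over
integral matrices. -/
theorem SiegelModularForm.exists_summable {k : ℕ} (hn : 1 ≤ n) (F : SiegelModularForm n k) :
    ∃ σ₀ : ℝ, ∀ σ, σ₀ < σ → Summable fun q : Classes (⊤ : Subgroup (SpecialLinearGroup (Fin n) ℤ)) =>
      ‖F.coeff q.out.toSemi‖ / q.out.1.det ^ σ := by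
  obtain ⟨C, hC, hrep⟩ := exists_reduced_representative n
  obtain ⟨C₁, hC₁, A, hcoeff⟩ := F.exists_norm_coeff_le
  choose U hU1 hU2 using fun q : Classes (⊤ : Subgroup (SpecialLinearGroup (Fin n) ℤ)) => hrep q.out
  let R : Classes (⊤ : Subgroup (SpecialLinearGroup (Fin n) ℤ)) → PosHalf n :=
    fun q => actPos q.out (U q)
  let κ : Classes (⊤ : Subgroup (SpecialLinearGroup (Fin n) ℤ)) → Fin n × Fin n → ℤ :=
    fun q ij => ⌊2 * (R q).1 ij.1 ij.2⌋
  have hκ : Function.Injective κ := by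
    intro q q' h
    have h1 : R q = R q' := by
      apply Subtype.ext
      ext i j
      obtain ⟨b, hb⟩ := (R q).2.1.2.2 i j
      obtain ⟨b', hb'⟩ := (R q').2.1.2.2 i j
      have := congrFun h (i, j)
      simp only [κ, hb, hb', Int.floor_intCast] at this
      subst this
      linarith
    have h2 : ∀ q, Quotient.mk (equivMod ⊤) (R q) = q := fun q => by
      rw [mk_actPos, Quotient.out_eq]
    rw [← h2 q, h1, h2]
  have hsum := (summable_prod_pi' (ι := Fin n × Fin n) (fun k => by positivity)
    summable_inv_one_add_abs_sq).comp_injective hκ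
  -- `A` absorbs the growth of the coefficients, and each of the `n²` entries uses up an exponent
  -- two.
  refine ⟨A + 2 * (n * n), fun σ hσ => ?_⟩
  refine Summable.of_nonneg_of_le (fun q => div_nonneg (norm_nonneg _)
    (Real.rpow_nonneg q.out.2.2.det_pos.le _)) (fun q => ?_)
    (hsum.mul_left (C₁ * n ^ A * C ^ σ * 9 ^ (n * n)))
  have hd : 0 < q.out.1.det := q.out.2.2.det_pos
  set D := C * q.out.1.det with hD
  have hD1 : 1 ≤ D := hU1 q
  have hD0 : 0 < D := by linarith
  have hT : (R q).1.trace ≤ n * D := by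
    refine (Finset.sum_le_card_nsmul _ _ D fun i _ => ?_).trans (by simp)
    exact (le_abs_self _).trans (hU2 q i i)
  have hT1 : 1 ≤ (R q).1.trace := by
    let i₀ : Fin n := ⟨0, hn⟩
    refine (one_le_diag (R q) i₀).trans ?_
    exact Finset.single_le_sum (f := fun i => (R q).1 i i)
      (fun i _ => zero_le_one.trans (one_le_diag (R q) i)) (Finset.mem_univ i₀)
  have h1 : ‖F.coeff q.out.toSemi‖ ≤ C₁ * (n * D) ^ A := by
    have h2 : F.coeff (R q).toSemi = F.coeff q.out.toSemi := F.coeff_actPos q.out (U q)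
    rw [← h2]
    refine (hcoeff (R q).toSemi hT1).trans ?_
    exact mul_le_mul_of_nonneg_left (pow_le_pow_left₀ (by linarith) hT A) hC₁
  have h3 : (q.out.1.det ^ σ)⁻¹ ≤ C ^ σ * (D ^ A * (D ^ 2) ^ (n * n))⁻¹ :=
    inv_rpow_le hC hd hD1 (by push_cast; exact hσ.le)
  have h5 : ((D ^ 2) ^ (n * n))⁻¹ ≤ 9 ^ (n * n) * ∏ ij, ((1 + |(κ q ij : ℝ)|) ^ 2)⁻¹ := by
    have h6 := inv_pow_le_prod hD1 (x := fun ij : Fin n × Fin n => (κ q ij : ℝ)) fun ij => by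
      obtain ⟨b, hb⟩ := (R q).2.1.2.2 ij.1 ij.2
      simp only [κ, hb, Int.floor_intCast]
      rw [← hb, abs_mul, abs_two]
      linarith [hU2 q ij.1 ij.2]
    simpa using h6
  have hP : 0 ≤ C₁ * (n : ℝ) ^ A * C ^ σ := by positivity
  have hDA : D ^ A * (D ^ A)⁻¹ = 1 := mul_inv_cancel₀ (by positivity)
  calc ‖F.coeff q.out.toSemi‖ / q.out.1.det ^ σ
      ≤ C₁ * (n * D) ^ A * (C ^ σ * (D ^ A * (D ^ 2) ^ (n * n))⁻¹) := by
        rw [div_eq_mul_inv]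
        exact mul_le_mul h1 h3 (by positivity) (by positivity)
    _ = C₁ * n ^ A * C ^ σ * ((D ^ 2) ^ (n * n))⁻¹ := by
        rw [mul_pow, mul_inv]
        linear_combination (C₁ * n ^ A * C ^ σ * ((D ^ 2) ^ (n * n))⁻¹) * hDA
    _ ≤ C₁ * n ^ A * C ^ σ * (9 ^ (n * n) * ∏ ij, ((1 + |(κ q ij : ℝ)|) ^ 2)⁻¹) :=
        mul_le_mul_of_nonneg_left h5 hP
    _ = _ := (mul_assoc _ _ _).symm

end KM
end

noncomputable section
open Matrix

namespace KM

variable {n : ℕ}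

/-! ### Reduction of half-integral matrices modulo `N` -/

/-- The reduction of a half-integral matrix modulo an odd number. -/
def redMatrix (N : ℕ) (T : Matrix (Fin n) (Fin n) ℝ) : Matrix (Fin n) (Fin n) (ZMod N) :=
  Matrix.of fun i j => (2 : ZMod N)⁻¹ * (⌊2 * T i j⌋ : ZMod N)

/-- Reduction modulo `N` on `SL_n(ℤ)`. -/
abbrev redSL (n N : ℕ) : SpecialLinearGroup (Fin n) ℤ →* SpecialLinearGroup (Fin n) (ZMod N) :=
  SpecialLinearGroup.map (n := Fin n) (Int.castRingHom (ZMod N))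

theorem redMatrix_eq {N : ℕ} {T : Matrix (Fin n) (Fin n) ℝ} {B : Matrix (Fin n) (Fin n) ℤ}
    (hB : (2 : ℝ) • T = (B + Bᵀ).map Int.cast) :
    redMatrix N T = (2 : ZMod N)⁻¹ • (B + Bᵀ).map (Int.cast : ℤ → ZMod N) := by
  ext i j
  have h : 2 * T i j = ((B + Bᵀ) i j : ℤ) := congrFun (congrFun hB i) j
  simp [redMatrix, h]

theorem transpose_redMatrix {N : ℕ} {T : Matrix (Fin n) (Fin n) ℝ} (hT : IsHalfIntegral T) :
    (redMatrix N T)ᵀ = redMatrix N T := by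
  ext i j
  have h : T j i = T i j := congrFun (congrFun hT.1.eq i) j
  simp [redMatrix, h]

theorem redMatrix_act {N : ℕ} {T : Matrix (Fin n) (Fin n) ℝ} (hT : IsHalfIntegral T)
    (U : SpecialLinearGroup (Fin n) ℤ) :
    redMatrix N (act T U) = (redSL n N U).1ᵀ * redMatrix N T * (redSL n N U).1 := by
  obtain ⟨B, hB⟩ := isHalfIntegral_iff.1 hT
  have hmap : ∀ A B : Matrix (Fin n) (Fin n) ℤ, (A * B).map (Int.cast : ℤ → ZMod N) =
      A.map (Int.cast : ℤ → ZMod N) * B.map (Int.cast : ℤ → ZMod N) := fun A B =>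
    Matrix.map_mul (f := Int.castRingHom (ZMod N))
  have h : U.1ᵀ * B * U.1 + (U.1ᵀ * B * U.1)ᵀ = U.1ᵀ * (B + Bᵀ) * U.1 := by
    simp only [transpose_mul, transpose_transpose, Matrix.mul_add, Matrix.add_mul, Matrix.mul_assoc]
  have hU : (redSL n N U).1 = U.1.map (Int.cast : ℤ → ZMod N) := rfl
  rw [redMatrix_eq hB, redMatrix_eq (two_smul_act hB U), h, hmap, hmap, hU, Matrix.mul_smul,
    Matrix.smul_mul, transpose_map]

theorem floor_trace_eq {N : ℕ} (h2 : IsUnit (2 : ZMod N)) {T : Matrix (Fin n) (Fin n) ℝ}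
    (hT : IsHalfIntegral T) : ((⌊T.trace⌋ : ℤ) : ZMod N) = (redMatrix N T).trace := by
  obtain ⟨B, hB⟩ := isHalfIntegral_iff.1 hT
  have h1 : T.trace = (B.trace : ℤ) := by
    have h3 := congrArg Matrix.trace hB
    have h4 : ((B + Bᵀ).map (Int.cast : ℤ → ℝ)).trace = 2 * (B.trace : ℤ) := by
      simp [Matrix.trace, Finset.sum_add_distrib, two_mul]
    rw [h4, trace_smul, smul_eq_mul] at h3
    linarith
  have h5 : ((B + Bᵀ).map (Int.cast : ℤ → ZMod N)).trace = 2 * ((B.trace : ℤ) : ZMod N) := by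
    simp [Matrix.trace, Finset.sum_add_distrib, two_mul]
  rw [h1, Int.floor_intCast, redMatrix_eq hB, trace_smul, h5, smul_eq_mul, ← mul_assoc,
    ZMod.inv_mul_of_unit _ h2, one_mul]

/-- Modulo two the matrix agrees with `B - Bᵀ`, an antisymmetric integral matrix of odd size, whose
determinant is zero. -/
theorem even_det_add_transpose (hn : Odd n) (B : Matrix (Fin n) (Fin n) ℤ) :
    Even (B + Bᵀ).det := by
  have h1 : (B - Bᵀ).det = 0 := by
    have h2 : (B - Bᵀ).det = -(B - Bᵀ).det := by
      conv_lhs => rw [← det_transpose, transpose_sub, transpose_transpose, ← neg_sub, det_neg,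
        Fintype.card_fin, hn.neg_one_pow, neg_one_mul]
    omega
  rw [← ZMod.intCast_eq_zero_iff_even]
  have h3 : ((Int.castRingHom (ZMod 2)).mapMatrix (B + Bᵀ)) =
      (Int.castRingHom (ZMod 2)).mapMatrix (B - Bᵀ) := by
    ext i j
    have : ∀ a b : ZMod 2, a + b = a - b := by decide
    simp [this]
  have h4 := (Int.castRingHom (ZMod 2)).map_det (B + Bᵀ)
  rw [h3, ← RingHom.map_det, h1, map_zero] at h4
  exact h4

/-- `2^n det T = det(B + Bᵀ)` is an integer, and for odd `n` it is even, so `2^(n-1) det T` is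
already integral and the floor is exact. -/
theorem floor_det_eq {N : ℕ} (h2 : IsUnit (2 : ZMod N)) {T : Matrix (Fin n) (Fin n) ℝ}
    (hT : IsHalfIntegral T) : ((⌊(2 : ℝ) ^ (2 * (n / 2)) * T.det⌋ : ℤ) : ZMod N) =
      2 ^ (2 * (n / 2)) * (redMatrix N T).det := by
  obtain ⟨B, hB⟩ := isHalfIntegral_iff.1 hT
  have h3 : (2 : ℝ) ^ n * T.det = ((B + Bᵀ).det : ℤ) := by
    have h4 := congrArg det hB
    rw [det_smul, Fintype.card_fin] at h4
    rw [h4]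
    exact ((Int.castRingHom ℝ).map_det (B + Bᵀ)).symm
  have h5 : (2 : ZMod N) ^ n * (redMatrix N T).det = ((B + Bᵀ).det : ℤ) := by
    have h6 : ((B + Bᵀ).map (Int.cast : ℤ → ZMod N)).det = ((B + Bᵀ).det : ℤ) :=
      ((Int.castRingHom (ZMod N)).map_det (B + Bᵀ)).symm
    rw [redMatrix_eq hB, det_smul, Fintype.card_fin, h6, ← mul_assoc, ← mul_pow,
      ZMod.mul_inv_of_unit _ h2, one_pow, one_mul]
  rcases Nat.even_or_odd n with hn | hn
  · rw [Nat.two_mul_div_two_of_even hn, h3, Int.floor_intCast, h5]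
  · obtain ⟨d, hd⟩ := even_det_add_transpose hn B
    have hn' : n = 2 * (n / 2) + 1 := (Nat.two_mul_div_two_add_one_of_odd hn).symm
    have h7 : (2 : ℝ) ^ (2 * (n / 2)) * T.det = (d : ℤ) := by
      have : (2 : ℝ) ^ n = 2 ^ (2 * (n / 2)) * 2 := by rw [← pow_succ, ← hn']
      rw [this, hd] at h3
      push_cast at h3
      linarith
    have h8 : (2 : ZMod N) ^ (2 * (n / 2)) * (redMatrix N T).det = d := by
      have h9 : (2 : ZMod N) ^ n = 2 * 2 ^ (2 * (n / 2)) := by rw [← pow_succ', ← hn']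
      rw [h9, hd, mul_assoc] at h5
      push_cast at h5
      rw [← two_mul] at h5
      exact h2.mul_left_cancel h5
    rw [h7, Int.floor_intCast, h8]

/-! ### Stabilizers -/

/-- The stabilizer of `T` in `SL_n(ℤ)`. -/
def stabilizer (T : PosHalf n) : Subgroup (SpecialLinearGroup (Fin n) ℤ) where
  carrier := {U | act T.1 U = T.1}
  one_mem' := act_one _
  mul_mem' := by
    intro U V hU hV
    have hU' : act T.1 U = T.1 := hU
    have hV' : act T.1 V = T.1 := hV
    change act T.1 (U * V) = T.1
    rw [act_mul, hU', hV']
  inv_mem' := by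
    intro U hU
    have hU' : act T.1 U = T.1 := hU
    change act T.1 U⁻¹ = T.1
    conv_lhs => rw [← hU']
    rw [← act_mul, mul_inv_cancel, act_one]

theorem mem_stabilizer {T : PosHalf n} {U : SpecialLinearGroup (Fin n) ℤ} :
    U ∈ stabilizer T ↔ act T.1 U = T.1 := Iff.rfl

/-- The columns of an automorphism have the same `T`-length as the basis vectors, which bounds their
integral entries. -/
theorem finite_stabilizer (T : PosHalf n) : Finite (stabilizer T) := by
  obtain ⟨b, hb, h⟩ := exists_mul_sum_sq_le_qform T.2.2
  let K : ℤ := ⌈∑ j, T.1 j j / b⌉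
  have hK : ∀ (U : stabilizer T) (i j : Fin n), U.1.1 i j ∈ Set.Icc (-K) K := by
    intro U i j
    have h1 : qform T.1 (U.1.1.map (Int.cast : ℤ → ℝ) *ᵥ Pi.single j 1) = T.1 j j := by
      rw [← qform_act, mem_stabilizer.1 U.2, qform_single]
    have h2 := h (U.1.1.map (Int.cast : ℤ → ℝ) *ᵥ Pi.single j 1)
    rw [h1] at h2
    have h3 : (U.1.1 i j : ℝ) ^ 2 ≤ T.1 j j / b := by
      rw [le_div_iff₀' hb]
      refine le_trans (mul_le_mul_of_nonneg_left ?_ hb.le) h2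
      have := Finset.single_le_sum (f := fun i => (U.1.1.map (Int.cast : ℤ → ℝ) *ᵥ Pi.single j 1) i ^ 2)
        (fun i _ => sq_nonneg _) (Finset.mem_univ i)
      simpa using this
    have h4 : T.1 j j / b ≤ K := by
      refine le_trans ?_ (Int.le_ceil _)
      exact Finset.single_le_sum (f := fun j => T.1 j j / b)
        (fun j _ => div_nonneg (zero_le_one.trans (one_le_diag T j)) hb.le) (Finset.mem_univ j)
    have h5 : U.1.1 i j ^ 2 ≤ K := by exact_mod_cast h3.trans h4
    constructor <;> nlinarith
  refine Finite.of_injective (β := Fin n → Fin n → Set.Icc (-K) K)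
    (fun U i j => ⟨U.1.1 i j, hK U i j⟩) fun U V hUV => ?_
  apply Subtype.ext
  apply Subtype.ext
  ext i j
  exact congrArg Subtype.val (congrFun (congrFun hUV i) j)

theorem autCard_top (T : PosHalf n) : autCard ⊤ T = Nat.card (stabilizer T) :=
  Nat.card_congr (Equiv.subtypeEquivRight fun U => by simp [mem_stabilizer])

theorem autCard_ne_zero (G : Subgroup (SpecialLinearGroup (Fin n) ℤ)) (T : PosHalf n) :
    autCard G T ≠ 0 := by
  have := finite_stabilizer T
  have : Finite {U : SpecialLinearGroup (Fin n) ℤ // U ∈ G ∧ act T.1 U = T.1} :=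
    Finite.of_injective (β := stabilizer T) (fun U => ⟨U.1, U.2.2⟩) fun U V h =>
      Subtype.ext (congrArg (fun x : stabilizer T => x.1) h)
  have : Nonempty {U : SpecialLinearGroup (Fin n) ℤ // U ∈ G ∧ act T.1 U = T.1} :=
    ⟨⟨1, G.one_mem, act_one _⟩⟩
  exact Nat.card_pos.ne'

/-- The kernel of reduction on the stabilizer is what `e_N(T)` counts. -/
theorem card_map_stabilizer_mul (N : ℕ) (T : PosHalf n) :
    Nat.card ((stabilizer T).map (redSL n N)) * autCard (congSubgroup n N) T = autCard ⊤ T := by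
  let φ := (redSL n N).comp (stabilizer T).subtype
  have h1 : autCard (congSubgroup n N) T = Nat.card φ.ker :=
    Nat.card_congr
      { toFun := fun U => ⟨⟨U.1, U.2.2⟩, U.2.1⟩
        invFun := fun U => ⟨U.1.1, U.2, U.1.2⟩
        left_inv := fun _ => rfl
        right_inv := fun _ => rfl }
  have h2 : (stabilizer T).map (redSL n N) = φ.range := by
    rw [MonoidHom.range_comp, Subgroup.range_subtype]
  rw [autCard_top, h1, h2, ← Subgroup.index_ker, mul_comm, Subgroup.card_mul_index]

theorem autCard_actPos (G : Subgroup (SpecialLinearGroup (Fin n) ℤ)) [hG : G.Normal] (T : PosHalf n)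
    (U : SpecialLinearGroup (Fin n) ℤ) : autCard G (actPos T U) = autCard G T := by
  refine Nat.card_congr ((MulAut.conj U).toEquiv.subtypeEquiv fun W => ?_)
  refine and_congr ?_ ?_
  · exact ⟨fun h => hG.conj_mem W h U, fun h => by
      simpa [mul_assoc] using hG.conj_mem _ h U⁻¹⟩
  · change act (act T.1 U) W = act T.1 U ↔ act T.1 (U * W * U⁻¹) = T.1
    rw [act_mul, act_mul]
    constructor
    · intro h
      rw [h, ← act_mul, mul_inv_cancel, act_one]
    · intro h
      have := congrArg (fun X => act X U) h
      rwa [← act_mul _ U⁻¹ U, inv_mul_cancel, act_one] at this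

instance (n N : ℕ) : (congSubgroup n N).Normal :=
  inferInstanceAs (redSL n N).ker.Normal

/-! ### The terms of the two series -/

theorem firstTerm_actPos {k N : ℕ} (h2 : IsUnit (2 : ZMod N)) (F : SiegelModularForm n k)
    (χ : DirichletCharacter ℂ N) (s : ℂ) (T : PosHalf n) (U : SpecialLinearGroup (Fin n) ℤ) :
    firstTerm F χ s (actPos T U) =
      χ ((redSL n N U).1ᵀ * redMatrix N T.1 * (redSL n N U).1).trace * F.coeff T.toSemi /
        ((autCard (congSubgroup n N) T : ℂ) * ((T.1.det : ℝ) : ℂ) ^ s) := by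
  rw [firstTerm, floor_trace_eq h2 (actPos T U).2.1, F.coeff_actPos, autCard_actPos]
  change χ (redMatrix N (act T.1 U)).trace * _ / (_ * (((act T.1 U).det : ℝ) : ℂ) ^ s) = _
  rw [redMatrix_act T.2.1, det_act]

theorem secondTerm_eq {k N : ℕ} (h2 : IsUnit (2 : ZMod N)) (F : SiegelModularForm n k)
    (χ : DirichletCharacter ℂ N) (s : ℂ) (T : PosHalf n) :
    secondTerm F χ s T = χ (2 ^ (2 * (n / 2))) * (χ (redMatrix N T.1).det * F.coeff T.toSemi /
        ((autCard ⊤ T : ℂ) * ((T.1.det : ℝ) : ℂ) ^ s)) := by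
  rw [secondTerm, floor_det_eq h2 T.2.1, map_mul]
  ring

end KM
end

noncomputable section
open Matrix

namespace KM

variable {n : ℕ}

/-! ### Unfolding the series of the first kind -/

/-- Inside the class of `T`, the classes modulo the congruence subgroup correspond to cosets of the
image of the stabilizer in `SL_n(ℤ/N)`. -/
theorem mk_actPos_eq_iff {N : ℕ} (T : PosHalf n) (U V : SpecialLinearGroup (Fin n) ℤ) :
    Quotient.mk (equivMod (congSubgroup n N)) (actPos T U) =
        Quotient.mk (equivMod (congSubgroup n N)) (actPos T V) ↔
      redSL n N V * (redSL n N U)⁻¹ ∈ (stabilizer T).map (redSL n N) := by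
  rw [Quotient.eq]
  change (∃ W ∈ congSubgroup n N, act T.1 V = act (act T.1 U) W) ↔ _
  constructor
  · rintro ⟨W, hW, h⟩
    have hW' : redSL n N W = 1 := hW
    refine ⟨V * W⁻¹ * U⁻¹, ?_, by rw [map_mul, map_mul, map_inv, map_inv, hW', inv_one, mul_one]⟩
    change act T.1 (V * W⁻¹ * U⁻¹) = T.1
    rw [act_mul, act_mul, h, ← act_mul _ W, mul_inv_cancel, act_one, ← act_mul, mul_inv_cancel,
      act_one]
  · rintro ⟨S, hS, h⟩
    have hS' : act T.1 S = T.1 := hS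
    refine ⟨U⁻¹ * (S⁻¹ * V), ?_, ?_⟩
    · change redSL n N (U⁻¹ * (S⁻¹ * V)) = 1
      rw [map_mul, map_mul, map_inv, map_inv, h]
      group
    · rw [← act_mul, mul_inv_cancel_left, act_mul]
      conv_rhs => rw [← hS', ← act_mul _ S, mul_inv_cancel, act_one]

theorem mk_top_eq_of_mk_eq {G : Subgroup (SpecialLinearGroup (Fin n) ℤ)} {T T' : PosHalf n}
    (h : Quotient.mk (equivMod G) T = Quotient.mk (equivMod G) T') :
    Quotient.mk (equivMod ⊤) T = Quotient.mk (equivMod ⊤) T' := by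
  obtain ⟨U, _, hU⟩ := Quotient.exact h
  exact Quotient.sound ⟨U, Subgroup.mem_top U, hU⟩

section Unfold

variable {N : ℕ} (hsurj : Function.Surjective (redSL n N))

theorem redSL_surjInv (g : SpecialLinearGroup (Fin n) (ZMod N)) :
    redSL n N (Function.surjInv hsurj g) = g := Function.surjInv_eq hsurj g

/-- The class modulo `SL_{n,N}(ℤ)` of `T[U]`, where `T` represents a class modulo `SL_n(ℤ)` and
`U` lifts an element of `SL_n(ℤ/N)`. -/
def liftClass (x : SpecialLinearGroup (Fin n) (ZMod N) ×
    Classes (⊤ : Subgroup (SpecialLinearGroup (Fin n) ℤ))) : Classes (congSubgroup n N) :=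
  Quotient.mk _ (actPos x.2.out (Function.surjInv hsurj x.1))

theorem mk_top_actPos_out (Q : Classes (⊤ : Subgroup (SpecialLinearGroup (Fin n) ℤ)))
    (U : SpecialLinearGroup (Fin n) ℤ) : Quotient.mk (equivMod ⊤) (actPos Q.out U) = Q := by
  rw [mk_actPos, Quotient.out_eq]

theorem liftClass_eq_iff {x y : SpecialLinearGroup (Fin n) (ZMod N) ×
    Classes (⊤ : Subgroup (SpecialLinearGroup (Fin n) ℤ))} :
    liftClass hsurj x = liftClass hsurj y ↔
      x.2 = y.2 ∧ x.1 * y.1⁻¹ ∈ (stabilizer y.2.out).map (redSL n N) := by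
  have key : ∀ g h Q, liftClass hsurj (g, Q) = liftClass hsurj (h, Q) ↔
      g * h⁻¹ ∈ (stabilizer Q.out).map (redSL n N) := by
    intro g h Q
    rw [eq_comm, liftClass, liftClass, mk_actPos_eq_iff, redSL_surjInv,
      redSL_surjInv]
  obtain ⟨g, Q⟩ := x
  obtain ⟨h, Q'⟩ := y
  constructor
  · intro hx
    have h1 := mk_top_eq_of_mk_eq hx
    rw [mk_top_actPos_out, mk_top_actPos_out] at h1
    obtain rfl : Q = Q' := h1
    exact ⟨rfl, (key g h Q).1 hx⟩
  · rintro ⟨rfl, h2⟩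
    exact (key g h Q).2 h2

theorem liftClass_surjective : Function.Surjective (liftClass hsurj) := by
  intro q
  obtain ⟨T, rfl⟩ := Quotient.exists_rep q
  let Q : Classes (⊤ : Subgroup (SpecialLinearGroup (Fin n) ℤ)) := Quotient.mk _ T
  have hQ : Quotient.mk (equivMod ⊤) Q.out = Quotient.mk (equivMod ⊤) T := Quotient.out_eq Q
  obtain ⟨U, _, hU⟩ := Quotient.exact hQ
  have hT : T = actPos Q.out U := Subtype.ext hU
  refine ⟨(redSL n N U, Q), ?_⟩
  rw [hT]
  change Quotient.mk _ (actPos Q.out _) = _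
  rw [mk_actPos_eq_iff, redSL_surjInv, mul_inv_cancel]
  exact one_mem _

theorem card_fiber_liftClass (x : SpecialLinearGroup (Fin n) (ZMod N) ×
    Classes (⊤ : Subgroup (SpecialLinearGroup (Fin n) ℤ))) :
    Nat.card {y // liftClass hsurj y = liftClass hsurj x} =
      Nat.card ((stabilizer x.2.out).map (redSL n N)) :=
  Nat.card_congr
    { toFun := fun y => ⟨y.1.1 * x.1⁻¹, ((liftClass_eq_iff hsurj).1 y.2).2⟩
      invFun := fun h => ⟨(h.1 * x.1, x.2), (liftClass_eq_iff hsurj).2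
        ⟨rfl, by rw [mul_inv_cancel_right]; exact h.2⟩⟩
      left_inv := fun y => Subtype.ext (Prod.ext (inv_mul_cancel_right _ _)
        ((liftClass_eq_iff hsurj).1 y.2).1.symm)
      right_inv := fun h => Subtype.ext (mul_inv_cancel_right _ _) }

theorem exists_out_liftClass (x : SpecialLinearGroup (Fin n) (ZMod N) ×
    Classes (⊤ : Subgroup (SpecialLinearGroup (Fin n) ℤ))) :
    ∃ U, redSL n N U = x.1 ∧ (liftClass hsurj x).out = actPos x.2.out U := by
  have h : Quotient.mk (equivMod (congSubgroup n N)) (actPos x.2.out (Function.surjInv hsurj x.1)) =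
      Quotient.mk (equivMod (congSubgroup n N)) (liftClass hsurj x).out :=
    (Quotient.out_eq (liftClass hsurj x)).symm
  obtain ⟨W, hW, hU⟩ := Quotient.exact h
  refine ⟨Function.surjInv hsurj x.1 * W, ?_, Subtype.ext (hU.trans (act_mul _ _ _).symm)⟩
  have hW' : redSL n N W = 1 := hW
  rw [map_mul, hW', mul_one, redSL_surjInv]

/-- The contribution of a matrix `T` and of `g ∈ SL_n(ℤ/N)` to the unfolded series of the first
kind. -/
def unfoldedTerm {k : ℕ} (F : SiegelModularForm n k) (χ : DirichletCharacter ℂ N) (s : ℂ)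
    (g : SpecialLinearGroup (Fin n) (ZMod N)) (T : PosHalf n) : ℂ :=
  χ (g.1ᵀ * redMatrix N T.1 * g.1).trace *
    (F.coeff T.toSemi / ((autCard ⊤ T : ℂ) * ((T.1.det : ℝ) : ℂ) ^ s))

theorem norm_div_autCard_le {k : ℕ} (F : SiegelModularForm n k) (s : ℂ) (T : PosHalf n) :
    ‖F.coeff T.toSemi / ((autCard ⊤ T : ℂ) * ((T.1.det : ℝ) : ℂ) ^ s)‖ ≤
      ‖F.coeff T.toSemi‖ / T.1.det ^ s.re := by
  have hd : 0 < T.1.det := T.2.2.det_pos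
  have h1 : (1 : ℝ) ≤ autCard ⊤ T := by
    exact_mod_cast Nat.one_le_iff_ne_zero.2 (autCard_ne_zero ⊤ T)
  rw [norm_div, norm_mul, Complex.norm_natCast, Complex.norm_cpow_eq_rpow_re_of_pos hd]
  have h2 := Real.rpow_pos_of_pos hd s.re
  exact div_le_div_of_nonneg_left (norm_nonneg _) h2 (le_mul_of_one_le_left h2.le h1)

variable {k : ℕ} {F : SiegelModularForm n k} {s : ℂ}

theorem norm_char_mul_le (χ : DirichletCharacter ℂ N) (a : ZMod N) (z : ℂ) :
    ‖χ a * z‖ ≤ ‖z‖ := by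
  rw [norm_mul]
  exact mul_le_of_le_one_left (norm_nonneg _) (DirichletCharacter.norm_le_one χ a)

theorem secondSummable (h2 : IsUnit (2 : ZMod N))
    (hs : Summable fun q : Classes (⊤ : Subgroup (SpecialLinearGroup (Fin n) ℤ)) =>
      ‖F.coeff q.out.toSemi‖ / q.out.1.det ^ s.re) (χ : DirichletCharacter ℂ N) :
    SecondSummable F χ s := by
  refine Summable.of_norm_bounded hs fun q => ?_
  rw [secondTerm_eq h2, mul_div_assoc]
  exact (norm_char_mul_le _ _ _).trans ((norm_char_mul_le _ _ _).trans (norm_div_autCard_le F s _))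

theorem unfoldedTerm_eq (h2 : IsUnit (2 : ZMod N)) (χ : DirichletCharacter ℂ N)
    (x : SpecialLinearGroup (Fin n) (ZMod N) ×
      Classes (⊤ : Subgroup (SpecialLinearGroup (Fin n) ℤ))) :
    unfoldedTerm F χ s x.1 x.2.out = firstTerm F χ s (liftClass hsurj x).out /
      Nat.card ((stabilizer x.2.out).map (redSL n N)) := by
  obtain ⟨U, hU, hout⟩ := exists_out_liftClass hsurj x
  rw [hout, firstTerm_actPos h2, hU, unfoldedTerm, ← card_map_stabilizer_mul N x.2.out,
    div_div, mul_div_assoc]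
  push_cast
  congr 2
  ring

/-- Sum over all pairs of an element of `SL_n(ℤ/N)` and an `SL_n(ℤ)`-class. The fibre over a finer
class has `e(T)/e_N(T)` elements with equal terms, which turns the weight `1/e(T)` into `1/e_N(T)`.
Absolute convergence permits both orders of summation. -/
theorem firstSeries_eq_tsum [NeZero N] (hsurj : Function.Surjective (redSL n N)) (h2 : IsUnit (2 : ZMod N)) (χ : DirichletCharacter ℂ N)
    (hs : Summable fun q : Classes (⊤ : Subgroup (SpecialLinearGroup (Fin n) ℤ)) =>
      ‖F.coeff q.out.toSemi‖ / q.out.1.det ^ s.re) :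
    FirstSummable F χ s ∧ firstSeries F χ s =
      ∑' q : Classes (⊤ : Subgroup (SpecialLinearGroup (Fin n) ℤ)),
        traceCharSum (redMatrix N q.out.1) χ *
          (F.coeff q.out.toSemi / ((autCard ⊤ q.out : ℂ) * ((q.out.1.det : ℝ) : ℂ) ^ s)) := by
  let f : SpecialLinearGroup (Fin n) (ZMod N) ×
      Classes (⊤ : Subgroup (SpecialLinearGroup (Fin n) ℤ)) → ℂ :=
    fun x => unfoldedTerm F χ s x.1 x.2.out
  have hbound : Summable fun x : SpecialLinearGroup (Fin n) (ZMod N) ×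
      Classes (⊤ : Subgroup (SpecialLinearGroup (Fin n) ℤ)) =>
        (1 : ℝ) * (‖F.coeff x.2.out.toSemi‖ / x.2.out.1.det ^ s.re) := by
    refine Summable.mul_of_nonneg (f := fun _ : SpecialLinearGroup (Fin n) (ZMod N) => (1 : ℝ))
      ?_ hs (fun _ => zero_le_one) fun q => ?_
    · exact (hasSum_fintype _).summable
    · exact div_nonneg (norm_nonneg _) (Real.rpow_nonneg q.out.2.2.det_pos.le _)
  have hf : Summable f := Summable.of_norm_bounded hbound fun x => by
    rw [one_mul]
    exact (norm_char_mul_le _ _ _).trans (norm_div_autCard_le F s _)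
  have hσ : Summable (f ∘ Equiv.sigmaFiberEquiv (liftClass hsurj)) :=
    (Equiv.summable_iff _).2 hf
  have hfib : ∀ q : Classes (congSubgroup n N),
      ∑' y : {y // liftClass hsurj y = q}, f y.1 = firstTerm F χ s q.out := by
    intro q
    obtain ⟨x, rfl⟩ := liftClass_surjective hsurj q
    have hc : ∀ y : {y // liftClass hsurj y = liftClass hsurj x}, f y.1 =
        firstTerm F χ s (liftClass hsurj x).out /
          Nat.card ((stabilizer x.2.out).map (redSL n N)) := by
      rintro ⟨y, hy⟩
      refine (unfoldedTerm_eq hsurj h2 χ y).trans ?_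
      rw [hy, ((liftClass_eq_iff hsurj).1 hy).1]
    have h0 : (Nat.card ((stabilizer x.2.out).map (redSL n N)) : ℂ) ≠ 0 := by
      intro h
      have h3 := card_map_stabilizer_mul N x.2.out
      rw [Nat.cast_eq_zero.1 h, zero_mul] at h3
      exact autCard_ne_zero ⊤ _ h3.symm
    rw [tsum_congr hc, tsum_const, card_fiber_liftClass, nsmul_eq_mul, mul_div_cancel₀ _ h0]
  constructor
  · refine hσ.sigma.congr fun q => ?_
    exact hfib q
  · have h1 : firstSeries F χ s = ∑' x, f x := by
      rw [← (Equiv.sigmaFiberEquiv (liftClass hsurj)).tsum_eq f]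
      exact (tsum_congr fun q => (hfib q).symm).trans hσ.tsum_sigma.symm
    rw [h1, ← (Equiv.prodComm _ _).tsum_eq f]
    refine (Summable.tsum_prod ((Equiv.summable_iff (Equiv.prodComm _ _)).2 hf)).trans
      (tsum_congr fun q => ?_)
    rw [tsum_fintype, traceCharSum, Finset.sum_mul]
    rfl

end Unfold

end KM
end

noncomputable section
open Matrix

namespace KM

/-! ### Expansion of the series of the first kind in series of the second kind -/

/-- The `n`-torsion of `F_pˣ` is the group of roots of unity of order dividing `gcd(p - 1, n)`,
generated by `u`. -/
theorem mulChar_eq_one_of_pow_eq_one {n p : ℕ} [Fact p.Prime] (hn : 1 ≤ n)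
    {θ : DirichletCharacter ℂ p} {u : ZMod p} (hu : IsPrimitiveRoot u (Nat.gcd (p - 1) n))
    (hθ : θ u = 1) {x : ZMod p} (hx : x ^ n = 1) : θ x = 1 := by
  have hx0 : x ≠ 0 := by
    rintro rfl
    rw [zero_pow (by omega)] at hx
    exact zero_ne_one hx
  have : NeZero (Nat.gcd (p - 1) n) := ⟨(Nat.gcd_pos_of_pos_right _ hn).ne'⟩
  have hg : x ^ Nat.gcd (p - 1) n = 1 := pow_gcd_eq_one.2 ⟨ZMod.pow_card_sub_one_eq_one hx0, hx⟩
  obtain ⟨i, _, rfl⟩ := hu.eq_pow_of_pow_eq_one hg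
  rw [map_pow, hθ, one_pow]

variable {n k N : ℕ} [NeZero N]

/-- Insert an expansion of the finite sum in characters of `det T` into the unfolded series. The
conjugate value at `2^(2[n/2])` undoes the power of two in the second series, since character values
at units have modulus one. -/
theorem firstSeries_eq_sum_secondSeries (hsurj : Function.Surjective (redSL n N))
    (h2 : IsUnit (2 : ZMod N)) {F : SiegelModularForm n k} {s : ℂ} {χ ψ : DirichletCharacter ℂ N}
    (hs : Summable fun q : Classes (⊤ : Subgroup (SpecialLinearGroup (Fin n) ℤ)) =>
      ‖F.coeff q.out.toSemi‖ / q.out.1.det ^ s.re)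
    {S : Finset (DirichletCharacter ℂ N)} {C : ℂ} {c : DirichletCharacter ℂ N → ℂ}
    (h : ∀ T : Matrix (Fin n) (Fin n) (ZMod N), Tᵀ = T →
      traceCharSum T χ = C * ∑ η ∈ S, c η * (ψ * η) T.det) :
    firstSeries F χ s = C * ∑ η ∈ S,
      (starRingEnd ℂ) ((ψ * η) (2 ^ (2 * (n / 2)))) * c η * secondSeries F (ψ * η) s := by
  let a : Classes (⊤ : Subgroup (SpecialLinearGroup (Fin n) ℤ)) → ℂ := fun q =>
    F.coeff q.out.toSemi / ((autCard ⊤ q.out : ℂ) * ((q.out.1.det : ℝ) : ℂ) ^ s)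
  have hsec : ∀ θ : DirichletCharacter ℂ N, secondSeries F θ s =
      θ (2 ^ (2 * (n / 2))) * ∑' q, θ (redMatrix N q.out.1).det * a q := by
    intro θ
    rw [secondSeries, ← tsum_mul_left]
    exact tsum_congr fun q => by rw [secondTerm_eq h2, mul_div_assoc]
  have hconj : ∀ θ : DirichletCharacter ℂ N,
      (starRingEnd ℂ) (θ (2 ^ (2 * (n / 2)))) * θ (2 ^ (2 * (n / 2))) = 1 := by
    intro θ
    rw [conj_mulChar, ← MulChar.mul_apply, inv_mul_cancel, MulChar.one_apply (h2.pow _)]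
  have hsum : ∀ θ : DirichletCharacter ℂ N,
      Summable fun q => θ (redMatrix N q.out.1).det * a q := fun θ =>
    Summable.of_norm_bounded hs fun q =>
      (norm_char_mul_le θ _ _).trans (norm_div_autCard_le F s q.out)
  have hterm : ∀ η, (starRingEnd ℂ) ((ψ * η) (2 ^ (2 * (n / 2)))) * c η *
      secondSeries F (ψ * η) s = ∑' q, c η * ((ψ * η) (redMatrix N q.out.1).det * a q) := by
    intro η
    rw [tsum_mul_left, hsec]
    linear_combination (c η * ∑' q, (ψ * η) (redMatrix N q.out.1).det * a q) * hconj (ψ * η)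
  rw [(firstSeries_eq_tsum hsurj h2 χ hs).2, Finset.sum_congr rfl fun η _ => hterm η,
    ← Summable.tsum_finsetSum fun η _ => (hsum _).mul_left _, ← tsum_mul_left]
  refine tsum_congr fun q => ?_
  rw [h _ (transpose_redMatrix q.out.2.1), mul_assoc, Finset.sum_mul]
  simp only [mul_assoc]
  rfl

end KM

end

/-! ### Assembly of the local identities, the unfolding and the convergence bounds. -/

theorem theorem5p11
    {n k : ℕ} (hn : 1 ≤ n) (hk : 1 ≤ k) (F : KM.SiegelModularForm n k)
    {r N : ℕ} [NeZero N] (p : Fin r → ℕ) (hp : ∀ i, (p i).Prime) (hodd : ∀ i, p i ≠ 2)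
    (hinj : Function.Injective p) (hN : N = ∏ i, p i)
    (χ : DirichletCharacter ℂ N) (hχ : χ.IsPrimitive)
    (u : Fin r → ℤ) (hu : ∀ i, IsPrimitiveRoot ((u i : ℤ) : ZMod (p i)) (Nat.gcd (p i - 1) n)) :
    ((∀ i, KM.primeComponent χ (p i) (u i) = 1) → ∃ ψ : DirichletCharacter ℂ N, ψ ^ n = χ) ∧
    ∃ σ₀ : ℝ, ∀ s : ℂ, σ₀ < s.re →
      KM.FirstSummable F χ s ∧
      (∀ ψ : DirichletCharacter ℂ N, KM.SecondSummable F ψ s) ∧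
      ((∃ i, KM.primeComponent χ (p i) (u i) ≠ 1) → KM.firstSeries F χ s = 0) ∧
      ((∀ i, KM.primeComponent χ (p i) (u i) = 1) →
        ∀ ψ : DirichletCharacter ℂ N, ψ ^ n = χ →
          (Even n →
            KM.firstSeries F χ s =
              (∏ i, (-1 : ℂ) ^ ((n - 2) * (p i - 1) / 4) * (p i : ℂ) ^ ((n - 2) / 2) *
                KM.gammaConst n (p i)) *
              ∑ η ∈ KM.torsionChars N n,
                (starRingEnd ℂ) ((ψ * η) ((2 : ZMod N) ^ n)) *
                (starRingEnd ℂ) (jacobiSum (ψ * η * KM.jacobiChar N) (KM.jacobiChar N)) *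
                (starRingEnd ℂ) (KM.matrixJacobiSum' (n - 1) (ψ * η)) *
                KM.secondSeries F (ψ * η) s) ∧
          (Odd n → (n = 1 ∨ (χ ^ 2).IsPrimitive) →
            KM.firstSeries F χ s =
              (∏ i, (-1 : ℂ) ^ ((n - 1) * (p i - 1) / 4) * (p i : ℂ) ^ ((n - 1) / 2) *
                KM.gammaConst n (p i)) *
              ∑ η ∈ KM.torsionChars N n,
                (starRingEnd ℂ) ((ψ * η) ((2 : ZMod N) ^ (n - 1))) *
                (starRingEnd ℂ) (KM.matrixJacobiSum' (n - 1) (ψ * η)) *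
                KM.secondSeries F (ψ * η) s)) := by
  have : ∀ i, Fact (p i).Prime := fun i => ⟨hp i⟩
  have hcop : Pairwise fun i j => Nat.Coprime (p i) (p j) := fun i j hij =>
    (Nat.coprime_primes (hp i) (hp j)).2 fun h => hij (hinj h)
  let e : ZMod N ≃+* ∀ i, ZMod (p i) :=
    (ZMod.ringEquivCongr hN).trans (ZMod.prodEquivPi p hcop)
  have h2 : IsUnit (2 : ZMod N) := by
    have h : Nat.Coprime 2 N := by
      rw [hN]
      exact Nat.Coprime.prod_right fun i _ =>
        (Nat.coprime_primes Nat.prime_two (hp i)).2 (hodd i).symm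
    exact_mod_cast (ZMod.isUnit_iff_coprime 2 N).2 h
  have hl : ∀ i, Nat.gcd (p i - 1) n ≠ 0 := fun i => (Nat.gcd_pos_of_pos_right _ hn).ne'
  have hcomp : ∀ i, KM.primeComponent χ (p i) (u i) = KM.charComp e χ i (u i) := fun i =>
    KM.primeComponent_eq_charComp e hinj hN χ i ((hu i).isUnit (hl i))
  have hun : ∀ i, ((u i : ℤ) : ZMod (p i)) ^ n = 1 := fun i =>
    ((hu i).pow_eq_one_iff_dvd n).2 (Nat.gcd_dvd_right _ _)
  have hsurj := KM.specialLinearGroup_map_surjective e n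
  obtain ⟨σ₀, hσ₀⟩ := F.exists_summable hn
  have hχ1 := KM.charComp_ne_one_of_isPrimitive e hN hχ
  refine ⟨fun h => KM.exists_pow_eq_of_torsion fun m hm => ?_, σ₀, fun s hs => ?_⟩
  · rw [KM.eq_prod_charComp e, Finset.prod_eq_one]
    intro i _
    refine KM.mulChar_eq_one_of_pow_eq_one hn (hu i) ((hcomp i).symm.trans (h i)) ?_
    rw [← KM.crtProj_apply, ← map_pow, ← Units.val_pow_eq_pow_val, hm, Units.val_one, map_one]
  · have hsum := hσ₀ s.re hs
    have hfirst := KM.firstSeries_eq_tsum hsurj h2 χ hsum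
    refine ⟨hfirst.1, fun ψ => KM.secondSummable h2 hsum ψ, ?_, fun h ψ hψ => ⟨?_, ?_⟩⟩
    · rintro ⟨i, hi⟩
      rw [hcomp] at hi
      rw [hfirst.2, ← tsum_zero]
      -- One vanishing local factor makes every term of the unfolded series zero.
      refine tsum_congr fun q => ?_
      rw [KM.traceCharSum_eq_prod e, Finset.prod_eq_zero (Finset.mem_univ i)
        (KM.traceCharSum_eq_zero_of_torsion hn _ (hun i) hi), zero_mul]
    · intro hev
      rw [KM.firstSeries_eq_sum_secondSeries hsurj h2 hsum fun T hT =>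
        KM.traceCharSum_even e hN hodd hn hev hχ1 hψ hT, Nat.two_mul_div_two_of_even hev]
      simp only [mul_assoc]
    · intro hn' hχ2
      have hχ2' : n = 1 ∨ ∀ i, KM.charComp e (χ ^ 2) i ≠ 1 :=
        hχ2.imp id fun h => KM.charComp_ne_one_of_isPrimitive e hN h
      have hm : 2 * (n / 2) = n - 1 := by
        obtain ⟨m, rfl⟩ := hn'
        omega
      rw [KM.firstSeries_eq_sum_secondSeries hsurj h2 hsum fun T hT =>
        KM.traceCharSum_odd e hN hodd hn' hχ1 hχ2' hψ hT, hm]
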